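/- Let $\mathcal B$ be a closed, locally cocomplete bicategory; a map of $\mathcal B$ is a $1$-cell that has a right adjoint. A $\mathcal B$-category $(M,A)$ is a set $A$ of elements $a$ with types $ta\in\mathrm{Ob}(\mathcal B)$, together with $1$-cells $M(b,a):ta\to tb$, units $\mathrm{id}_{ta}\Rightarrow M(a,a)$ and associative, unital compositions $M(c,b)M(b,a)\Rightarrow M(c,a)$. A singleton of type $x$ is a distributor from the one-element category $(\mathrm{id}_x,x)$ to $(M,A)$ that has a right adjoint, for instance $M(-,a)$; $(M,A)$ is complete if every singleton is representable, i.e. isomorphic to some $M(-,a)$. Write $\mathcal C(M,A)$ for the complete $\mathcal B$-category of singletons of $(M,A)$, with its Yoneda embedding $(M,A)\to\mathcal C(M,A)$; $\mathcal C$ is left adjoint to the inclusion of complete $\mathcal B$-categories. For a complete $(M,A)$, let $P_{(M,A)}:\mathrm{Map}(\mathcal B)^{\mathrm{coop}}\to\mathbf{Cat}$ be the pseudofunctor that sends $x$ to the category of elements of type $x$, with the $2$-cells $\mathrm{id}_x\Rightarrow M(b,a)$ as arrows $a\to b$, and sends a map $\gamma:x\to y$ to the functor $b\mapsto b\gamma$,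 where $b\gamma$ represents the singleton $M(-,b)\gamma$. For a pseudofunctor $F:\mathrm{Map}(\mathcal B)^{\mathrm{coop}}\to\mathbf{Cat}$, let $\Sigma F$ be the $\mathcal B$-category whose elements of type $x$ are the objects of $F(x)$ and whose $1$-cell $N(b,a):x\to y$, for $a\in F(x)$ and $b\in F(y)$, is the colimit of the maps $\gamma:x\to y$, taken over all pairs $(\gamma,\ a\to F(\gamma)(b))$. The functor $P$ is right adjoint to $\mathcal C\Sigma$. Its counit at $(M,A)$ is the functor $\mathcal C\Sigma P_{(M,A)}\to(M,A)$, unique up to isomorphism, that extends along the Yoneda embedding the canonical functor $\kappa:\Sigma P_{(M,A)}\to(M,A)$; here $\kappa$ is the identity on elements, and on the leg of the colimit at $(\gamma, u: a\to b\gamma)$ it is the $2$-cell $\gamma\Rightarrow M(b,a)$ that corresponds to $u$. The category $(M,A)$ is a fixed point of the adjunction if the counit exists and is an equivalence of $\mathcal B$-categories. (1) Let $\mathcal Q$ be a quantaloid in which maps are dense: for every arrow $f:x\to y$ of $\mathcal Q$, $$f=\bigvee\{\gamma:x\to y\ |\ \gamma\text{ is a map and }\gamma\le f\}.$$ Then,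 for every complete $\mathcal Q$-category $(M,A)$, the functor $\kappa$ is an isomorphism, that is, $\Sigma P_{(M,A)}=(M,A)$, and $(M,A)$ is a fixed point of the adjunction. If moreover elements of $(M,A)$ that represent the same singleton are equal, then the counit is an isomorphism of $\mathcal Q$-categories. (2) Let $\mathcal V$ be a Bénabou cosmos (a complete and cocomplete symmetric monoidal closed category) in which every object $X$ is the colimit of the diagram of all morphisms $I\to X$, the arrows of the diagram being the morphisms $I\to I$ over $X$; and let $\mathcal B_{\mathcal V}$ be the associated one-object bicategory. Then, for every (small) complete $\mathcal B_{\mathcal V}$-category $(M,A)$, the colimits that define $\Sigma P_{(M,A)}$ exist, the functor $\kappa$ is an isomorphism, that is, $\Sigma P_{(M,A)}=(M,A)$, and $(M,A)$ is a fixed point of the adjunction. -/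

import Mathlib

set_option linter.unusedSectionVars false

open CategoryTheory CategoryTheory.Bicategory CategoryTheory.Limits

universe w v u a a₁ a₂ w₁

namespace BicatEnriched

/-- A category enriched in a bicategory `B`.  The underlying typed set is given by its fibres:
`Obj x` is the set of elements of type `x`.  The structural matrix `M` is written in
diagrammatic order: `hom p q : x ⟶ y` is the `1`-cell `M(q, p)`. -/
structure ECat (B : Type u) [Bicategory.{w, v} B] where
  Obj : B → Type a
  hom : ∀ {x y : B}, Obj x → Obj y → (x ⟶ y)
  one : ∀ {x : B} (p : Obj x), 𝟙 x ⟶ hom p p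
  comp : ∀ {x y z : B} (p : Obj x) (q : Obj y) (r : Obj z), hom p q ≫ hom q r ⟶ hom p r
  one_comp : ∀ {x y : B} (p : Obj x) (q : Obj y),
    one p ▷ hom p q ≫ comp p p q = (λ_ (hom p q)).hom
  comp_one : ∀ {x y : B} (p : Obj x) (q : Obj y),
    hom p q ◁ one q ≫ comp p q q = (ρ_ (hom p q)).hom
  comp_assoc : ∀ {x y z t : B} (p : Obj x) (q : Obj y) (r : Obj z) (s : Obj t),
    comp p q r ▷ hom r s ≫ comp p r s =
      (α_ (hom p q) (hom q r) (hom r s)).hom ≫ hom p q ◁ comp q r s ≫ comp p q s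

variable {B : Type u} [Bicategory.{w, v} B]

namespace ECat

variable (X : ECat.{w, v, u, a} B)

theorem comp_assoc' {x y z t : B} (p : X.Obj x) (q : X.Obj y) (r : X.Obj z) (s : X.Obj t) :
    X.hom p q ◁ X.comp q r s ≫ X.comp p q s =
      (α_ _ _ _).inv ≫ X.comp p q r ▷ X.hom r s ≫ X.comp p r s := by
  simp [X.comp_assoc]

/-- Composition of generalized elements `f ⟶ X.hom p q` and `g ⟶ X.hom q r`. -/
def mul {x y z : B} {p : X.Obj x} {q : X.Obj y} {r : X.Obj z} {f : x ⟶ y} {g : y ⟶ z}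
    (s : f ⟶ X.hom p q) (t : g ⟶ X.hom q r) : f ≫ g ⟶ X.hom p r :=
  s ▷ g ≫ X.hom p q ◁ t ≫ X.comp p q r

section mul

variable {X}
variable {x y z t : B} {p : X.Obj x} {q : X.Obj y} {r : X.Obj z} {o : X.Obj t}
  {f f' : x ⟶ y} {g g' : y ⟶ z} {h : z ⟶ t}

theorem comp_mul (k : f' ⟶ f) (s : f ⟶ X.hom p q) (t : g ⟶ X.hom q r) :
    X.mul (k ≫ s) t = k ▷ g ≫ X.mul s t := by
  simp [mul]

theorem mul_comp (k : g' ⟶ g) (s : f ⟶ X.hom p q) (t : g ⟶ X.hom q r) :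
    X.mul s (k ≫ t) = f ◁ k ≫ X.mul s t := by
  simp only [mul, Bicategory.whiskerLeft_comp, Category.assoc]
  rw [whisker_exchange_assoc]

theorem one_mul (s : f ⟶ X.hom p q) : X.mul (X.one p) s = (λ_ f).hom ≫ s := by
  simp only [mul]
  rw [← whisker_exchange_assoc, X.one_comp]
  simp

theorem mul_one (s : f ⟶ X.hom p q) : X.mul s (X.one q) = (ρ_ f).hom ≫ s := by
  simp only [mul]
  rw [X.comp_one]
  simp

theorem mul_assoc (s : f ⟶ X.hom p q) (t : g ⟶ X.hom q r) (k : h ⟶ X.hom r o) :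
    X.mul (X.mul s t) k = (α_ f g h).hom ≫ X.mul s (X.mul t k) := by
  simp only [mul, comp_whiskerRight, Category.assoc, Bicategory.whiskerLeft_comp]
  have := X.comp_assoc p q r o
  rw [← whisker_exchange_assoc, this]
  simp

theorem mul_id_id : X.mul (𝟙 (X.hom p q)) (𝟙 (X.hom q r)) = X.comp p q r := by
  simp [mul]

end mul

/-- The fibre of `X` over `x`: its objects are the elements of `X` of type `x`. -/
structure Fib (x : B) where
  elt : X.Obj x

/-- An arrow `p ⟶ q` of the fibre over `x` is a `2`-cell from `𝟙 x` to `M(q, p) = hom p q`. -/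
@[ext]
structure FibHom {x : B} (p q : X.Fib x) where
  cell : 𝟙 x ⟶ X.hom p.elt q.elt

instance (x : B) : Category.{w} (X.Fib x) where
  Hom p q := X.FibHom p q
  id p := ⟨X.one p.elt⟩
  comp s t := ⟨(λ_ (𝟙 x)).inv ≫ X.mul s.cell t.cell⟩
  id_comp s := by simp [one_mul]
  comp_id s := by simp [mul_one]
  assoc s t k := by
    congr 1
    rw [comp_mul, mul_comp, mul_assoc]
    simp only [← Category.assoc]
    congr 1
    bicategory

variable {X} in
@[ext]
theorem fib_hom_ext {x : B} {p q : X.Fib x} {s t : p ⟶ q} (h : s.cell = t.cell) : s = t :=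
  FibHom.ext h

@[simp]
theorem fib_id_cell {x : B} (p : X.Fib x) : FibHom.cell (𝟙 p) = X.one p.elt := rfl

@[simp]
theorem fib_comp_cell {x : B} {p q r : X.Fib x} (s : p ⟶ q) (t : q ⟶ r) :
    (s ≫ t).cell = (λ_ (𝟙 x)).inv ≫ X.mul s.cell t.cell := rfl

end ECat

/-- A `B`-functor: a type-preserving function together with a compatible family of `2`-cells. -/
structure EFunctor (X : ECat.{w, v, u, a} B) (Y : ECat.{w, v, u, a₁} B) where
  obj : ∀ {x : B}, X.Obj x → Y.Obj x
  map : ∀ {x y : B} (p : X.Obj x) (q : X.Obj y), X.hom p q ⟶ Y.hom (obj p) (obj q)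
  map_one : ∀ {x : B} (p : X.Obj x), X.one p ≫ map p p = Y.one (obj p)
  map_comp : ∀ {x y z : B} (p : X.Obj x) (q : X.Obj y) (r : X.Obj z),
    X.comp p q r ≫ map p r = Y.mul (map p q) (map q r)

namespace EFunctor

variable {X : ECat.{w, v, u, a} B} {Y : ECat.{w, v, u, a₁} B}

/-- All the `2`-cells of the functor are invertible. -/
def FullyFaithful (F : EFunctor X Y) : Prop :=
  ∀ {x y : B} (p : X.Obj x) (q : X.Obj y), IsIso (F.map p q)

/-- Every element of the codomain is isomorphic, in its fibre, to an element of the image. -/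
def EssSurj (F : EFunctor X Y) : Prop :=
  ∀ {x : B} (q : Y.Obj x), ∃ p : X.Obj x, Nonempty (ECat.Fib.mk (F.obj p) ≅ ECat.Fib.mk q)

/-- An equivalence of `B`-categories. -/
def IsEquivalence (F : EFunctor X Y) : Prop :=
  F.FullyFaithful ∧ F.EssSurj

/-- An isomorphism of `B`-categories. -/
def IsIsomorphism (F : EFunctor X Y) : Prop :=
  F.FullyFaithful ∧ ∀ x : B, Function.Bijective (F.obj (x := x))

end EFunctor

namespace ECat

/-- A presingleton of type `x`, that is, a distributor from the one-object category `(𝟙 x, x)`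
to `X`, given by `1`-cells `val p : x ⟶ y` for `p` of type `y`, and an action of `X`. -/
structure PreSing (X : ECat.{w, v, u, a} B) (x : B) where
  val : ∀ {y : B}, X.Obj y → (x ⟶ y)
  act : ∀ {y z : B} (p : X.Obj y) (q : X.Obj z), val p ≫ X.hom p q ⟶ val q
  act_one : ∀ {y : B} (p : X.Obj y), val p ◁ X.one p ≫ act p p = (ρ_ (val p)).hom
  act_comp : ∀ {y z t : B} (p : X.Obj y) (q : X.Obj z) (r : X.Obj t),
    act p q ▷ X.hom q r ≫ act q r =
      (α_ (val p) (X.hom p q) (X.hom q r)).hom ≫ val p ◁ X.comp p q r ≫ act p r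

/-- A precosingleton of type `x`, that is, a distributor from `X` to the one-object category
`(𝟙 x, x)`. -/
structure PreCosing (X : ECat.{w, v, u, a} B) (x : B) where
  val : ∀ {y : B}, X.Obj y → (y ⟶ x)
  act : ∀ {y z : B} (p : X.Obj y) (q : X.Obj z), X.hom p q ≫ val q ⟶ val p
  act_one : ∀ {y : B} (p : X.Obj y), X.one p ▷ val p ≫ act p p = (λ_ (val p)).hom
  act_comp : ∀ {y z t : B} (p : X.Obj y) (q : X.Obj z) (r : X.Obj t),
    X.comp p q r ▷ val r ≫ act p r =
      (α_ (X.hom p q) (X.hom q r) (val r)).hom ≫ X.hom p q ◁ act q r ≫ act p q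

namespace PreSing

variable {X : ECat.{w, v, u, a} B}

/-- A morphism of presingletons of the same type is a morphism of distributors. -/
@[ext]
structure Hom {x : B} (σ τ : X.PreSing x) where
  app : ∀ {y : B} (p : X.Obj y), σ.val p ⟶ τ.val p
  naturality : ∀ {y z : B} (p : X.Obj y) (q : X.Obj z),
    σ.act p q ≫ app q = app p ▷ X.hom p q ≫ τ.act p q

instance (x : B) : Category (X.PreSing x) where
  Hom σ τ := Hom σ τ
  id σ := ⟨fun p => 𝟙 (σ.val p), by simp⟩
  comp f g := ⟨fun p => f.app p ≫ g.app p, by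
    intros; rw [reassoc_of% f.naturality, g.naturality]; simp⟩

@[ext]
theorem hom_ext {x : B} {σ τ : X.PreSing x} {f g : σ ⟶ τ}
    (h : ∀ {y : B} (p : X.Obj y), f.app p = g.app p) : f = g :=
  Hom.ext (by funext y p; exact h p)

@[simp]
theorem id_app {x y : B} (σ : X.PreSing x) (p : X.Obj y) : Hom.app (𝟙 σ) p = 𝟙 (σ.val p) := rfl

@[simp]
theorem comp_app {x y : B} {σ τ υ : X.PreSing x} (f : σ ⟶ τ) (g : τ ⟶ υ) (p : X.Obj y) :
    (f ≫ g).app p = f.app p ≫ g.app p := rfl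

/-- The composite `σ f` of a presingleton with a `1`-cell. -/
@[simps]
def precomp {x z : B} (f : z ⟶ x) (σ : X.PreSing x) : X.PreSing z where
  val p := f ≫ σ.val p
  act p q := (α_ f (σ.val p) (X.hom p q)).hom ≫ f ◁ σ.act p q
  act_one p := by
    simp only [comp_whiskerLeft, Category.assoc, Iso.inv_hom_id_assoc]
    rw [← Bicategory.whiskerLeft_comp, σ.act_one]
    simp
  act_comp p q r := by
    have h := congrArg (fun k => f ◁ k) (σ.act_comp p q r)
    simp only [Bicategory.whiskerLeft_comp] at h
    simp [h]

/-- The representable presingleton `M(-, p)`. -/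
@[simps]
def repr (X : ECat.{w, v, u, a} B) {x : B} (p : X.Obj x) : X.PreSing x where
  val q := X.hom p q
  act q r := X.comp p q r
  act_one q := X.comp_one p q
  act_comp q r s := X.comp_assoc p q r s

end PreSing

/-- The precosingleton `M(p, -)`. -/
@[simps]
def PreCosing.repr (X : ECat.{w, v, u, a} B) {x : B} (p : X.Obj x) : X.PreCosing x where
  val q := X.hom q p
  act q r := X.comp q r p
  act_one q := X.one_comp q p
  act_comp q r s := X.comp_assoc q r s p

/-- The composite `f τ` of a precosingleton with a `1`-cell. -/
@[simps]
def PreCosing.postcomp {X : ECat.{w, v, u, a} B} {x z : B} (τ : X.PreCosing x) (f : x ⟶ z) :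
    X.PreCosing z where
  val p := τ.val p ≫ f
  act p q := (α_ (X.hom p q) (τ.val q) f).inv ≫ τ.act p q ▷ f
  act_one p := by
    have h := congrArg (fun k => k ▷ f) (τ.act_one p)
    simp only [comp_whiskerRight] at h
    simp [h]
  act_comp p q r := by
    have h := congrArg (fun k => k ▷ f) (τ.act_comp p q r)
    simp only [comp_whiskerRight] at h
    simp [h]

end ECat

/-- A bicategory is closed when all right Kan extensions and all right Kan lifts exist, that is,
when all functors of pre- and postcomposition with a `1`-cell have right adjoints. -/
class ClosedBicategory (B : Type u) [Bicategory.{w, v} B] : Prop where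
  precomp : ∀ {x y : B} (z : B) (f : x ⟶ y), (Bicategory.precomp z f).IsLeftAdjoint
  postcomp : ∀ (x : B) {y z : B} (f : y ⟶ z), (Bicategory.postcomp x f).IsLeftAdjoint

attribute [instance] ClosedBicategory.precomp ClosedBicategory.postcomp

/-- A bicategory is locally cocomplete (at a given universe level) when its hom-categories have
all colimits of that size. -/
class LocallyCocomplete (B : Type u) [Bicategory.{w, v} B] : Prop where
  hasColimits : ∀ x y : B, HasColimitsOfSize.{a, a} (x ⟶ y)

attribute [instance] LocallyCocomplete.hasColimits

section MapsOut

variable {C : Type*} [Category* C] {D : Type*} [Category* D] (L : C ⥤ D) [L.IsLeftAdjoint]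

/-- Maps out of the image of a multicoequalizer under a left adjoint. -/
noncomputable def mcDesc {J : MultispanShape} (I : MultispanIndex J C) [HasMulticoequalizer I]
    {d : D} (k : ∀ j, L.obj (I.right j) ⟶ d)
    (hk : ∀ i, L.map (I.fst i) ≫ k _ = L.map (I.snd i) ≫ k _) : L.obj (multicoequalizer I) ⟶ d :=
  ((Adjunction.ofIsLeftAdjoint L).homEquiv _ _).symm
    (Multicoequalizer.desc I _ (fun j => (Adjunction.ofIsLeftAdjoint L).homEquiv _ _ (k j))
      (fun i => by
        rw [← Adjunction.homEquiv_naturality_left, hk, Adjunction.homEquiv_naturality_left]))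

theorem mcDesc_fac {J : MultispanShape} (I : MultispanIndex J C) [HasMulticoequalizer I]
    {d : D} (k : ∀ j, L.obj (I.right j) ⟶ d)
    (hk : ∀ i, L.map (I.fst i) ≫ k _ = L.map (I.snd i) ≫ k _) (j : J.R) :
    L.map (Multicoequalizer.π I j) ≫ mcDesc L I k hk = k j := by
  rw [mcDesc, ← Adjunction.homEquiv_naturality_left_symm, Multicoequalizer.π_desc,
    Equiv.symm_apply_apply]

theorem mc_hom_ext {J : MultispanShape} (I : MultispanIndex J C) [HasMulticoequalizer I]
    {d : D} {f g : L.obj (multicoequalizer I) ⟶ d}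
    (h : ∀ j, L.map (Multicoequalizer.π I j) ≫ f = L.map (Multicoequalizer.π I j) ≫ g) :
    f = g := by
  apply ((Adjunction.ofIsLeftAdjoint L).homEquiv _ _).injective
  apply Multicoequalizer.hom_ext
  intro j
  rw [← Adjunction.homEquiv_naturality_left, h, Adjunction.homEquiv_naturality_left]

/-- Maps out of the image of a colimit under a left adjoint. -/
noncomputable def colDesc {J : Type*} [Category* J] (F : J ⥤ C) [HasColimit F]
    {d : D} (k : ∀ j, L.obj (F.obj j) ⟶ d)
    (hk : ∀ ⦃i j⦄ (m : i ⟶ j), L.map (F.map m) ≫ k j = k i) : L.obj (colimit F) ⟶ d :=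
  ((Adjunction.ofIsLeftAdjoint L).homEquiv _ _).symm
    (colimit.desc F ⟨_, {
      app := fun j => (Adjunction.ofIsLeftAdjoint L).homEquiv _ _ (k j)
      naturality := fun i j m => by
        rw [← Adjunction.homEquiv_naturality_left, hk]; simp }⟩)

theorem colDesc_fac {J : Type*} [Category* J] (F : J ⥤ C) [HasColimit F]
    {d : D} (k : ∀ j, L.obj (F.obj j) ⟶ d)
    (hk : ∀ ⦃i j⦄ (m : i ⟶ j), L.map (F.map m) ≫ k j = k i) (j : J) :
    L.map (colimit.ι F j) ≫ colDesc L F k hk = k j := by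
  rw [colDesc, ← Adjunction.homEquiv_naturality_left_symm]
  simp

theorem col_hom_ext {J : Type*} [Category* J] (F : J ⥤ C) [HasColimit F]
    {d : D} {f g : L.obj (colimit F) ⟶ d}
    (h : ∀ j, L.map (colimit.ι F j) ≫ f = L.map (colimit.ι F j) ≫ g) : f = g := by
  apply ((Adjunction.ofIsLeftAdjoint L).homEquiv _ _).injective
  apply colimit.hom_ext
  intro j
  rw [← Adjunction.homEquiv_naturality_left, h, Adjunction.homEquiv_naturality_left]

end MapsOut

namespace ECat

variable {X : ECat.{w, v, u, a} B} [LocallyCocomplete.{w, v, u, max u a} B]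

/-- The diagram of which the composite `τ σ` of a presingleton and a precosingleton is the
universal cowedge: the two actions of `X` on the `1`-cells `τ(c) M(c, b) σ(b)`. -/
@[simps]
def cowedgeIndex {z x : B} (σ : X.PreSing z) (τ : X.PreCosing x) :
    MultispanIndex (MultispanShape.prod (Σ y : B, X.Obj y)) (z ⟶ x) where
  left i := (σ.val i.1.2 ≫ X.hom i.1.2 i.2.2) ≫ τ.val i.2.2
  right i := σ.val i.2 ≫ τ.val i.2
  fst i := (α_ _ _ _).hom ≫ σ.val i.1.2 ◁ τ.act i.1.2 i.2.2
  snd i := σ.act i.1.2 i.2.2 ▷ τ.val i.2.2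

/-- The composite `τ σ = ∫^c τ(c) σ(c)` of a presingleton and a precosingleton. -/
noncomputable def coend {z x : B} (σ : X.PreSing z) (τ : X.PreCosing x) : z ⟶ x :=
  multicoequalizer (cowedgeIndex σ τ)

/-- The universal cowedge. -/
noncomputable def coendι {z x y : B} (σ : X.PreSing z) (τ : X.PreCosing x) (p : X.Obj y) :
    σ.val p ≫ τ.val p ⟶ coend σ τ :=
  Multicoequalizer.π (cowedgeIndex σ τ) ⟨y, p⟩

theorem coend_condition {z x y y' : B} (σ : X.PreSing z) (τ : X.PreCosing x)
    (p : X.Obj y) (q : X.Obj y') :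
    σ.val p ◁ τ.act p q ≫ coendι σ τ p =
      (α_ _ _ _).inv ≫ σ.act p q ▷ τ.val q ≫ coendι σ τ q := by
  rw [Iso.eq_inv_comp, ← Category.assoc]
  exact Multicoequalizer.condition (cowedgeIndex σ τ) ⟨⟨y, p⟩, ⟨y', q⟩⟩

/-- Right adjoints of presingletons in the bicategory of distributors: a unit and a counit,
satisfying the two triangle identities.  The `2`-cells `Φ` and `Ψ` are those which are induced on
the composites with the coend `τ σ` by the counit and by the actions on `σ` and on `τ`. -/
structure SingAdj {x : B} (σ : X.PreSing x) (τ : X.PreCosing x) where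
  unit : 𝟙 x ⟶ coend σ τ
  counit : ∀ {y z : B} (p : X.Obj y) (q : X.Obj z), τ.val p ≫ σ.val q ⟶ X.hom p q
  counit_right : ∀ {y z t : B} (p : X.Obj y) (q : X.Obj z) (r : X.Obj t),
    counit p q ▷ X.hom q r ≫ X.comp p q r =
      (α_ _ _ _).hom ≫ τ.val p ◁ σ.act q r ≫ counit p r
  counit_left : ∀ {y z t : B} (p : X.Obj y) (q : X.Obj z) (r : X.Obj t),
    X.hom p q ◁ counit q r ≫ X.comp p q r =
      (α_ _ _ _).inv ≫ τ.act p q ▷ σ.val r ≫ counit p r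
  triangle_left : ∀ {y : B} (q : X.Obj y), ∃ Φ : coend σ τ ≫ σ.val q ⟶ σ.val q,
    (∀ {z : B} (p : X.Obj z), coendι σ τ p ▷ σ.val q ≫ Φ =
      (α_ _ _ _).hom ≫ σ.val p ◁ counit p q ≫ σ.act p q) ∧
    unit ▷ σ.val q ≫ Φ = (λ_ (σ.val q)).hom
  triangle_right : ∀ {y : B} (q : X.Obj y), ∃ Ψ : τ.val q ≫ coend σ τ ⟶ τ.val q,
    (∀ {z : B} (p : X.Obj z), τ.val q ◁ coendι σ τ p ≫ Ψ =
      (α_ _ _ _).inv ≫ counit q p ▷ τ.val p ≫ τ.act q p) ∧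
    τ.val q ◁ unit ≫ Ψ = (ρ_ (τ.val q)).hom

/-- A singleton of type `x`: a presingleton together with a right adjoint. -/
structure Sing (X : ECat.{w, v, u, a} B) (x : B) where
  left : X.PreSing x
  right : X.PreCosing x
  adj : SingAdj left right

variable (X) in
/-- `X` is (Cauchy-)complete: every singleton is representable. -/
def IsComplete : Prop :=
  ∀ {x : B} (σ : X.Sing x), ∃ p : X.Obj x, Nonempty (PreSing.repr X p ≅ σ.left)

variable (X) in
/-- `X` is skeletal: elements which represent the same singleton are equal. -/
def IsSkeletal : Prop :=
  ∀ {x : B} (p q : X.Obj x), Nonempty (PreSing.repr X p ≅ PreSing.repr X q) → p = q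

end ECat

namespace ECat

section Coend

variable {X : ECat.{w, v, u, a} B}

theorem PreSing.act_comp' {x y z t : B} (θ : X.PreSing x) (p : X.Obj y) (q : X.Obj z)
    (r : X.Obj t) : θ.val p ◁ X.comp p q r ≫ θ.act p r =
      (α_ _ _ _).inv ≫ θ.act p q ▷ X.hom q r ≫ θ.act q r := by
  simp [θ.act_comp]

variable [LocallyCocomplete.{w, v, u, max u a} B]

theorem SingAdj.counit_left' {x y z t : B} {σ : X.PreSing x} {τ : X.PreCosing x}
    (h : SingAdj σ τ) (p : X.Obj y) (q : X.Obj z) (r : X.Obj t) :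
    τ.act p q ▷ σ.val r ≫ h.counit p r =
      (α_ _ _ _).hom ≫ X.hom p q ◁ h.counit q r ≫ X.comp p q r := by
  simp [h.counit_left]

theorem SingAdj.counit_right' {x y z t : B} {σ : X.PreSing x} {τ : X.PreCosing x}
    (h : SingAdj σ τ) (p : X.Obj y) (q : X.Obj z) (r : X.Obj t) :
    τ.val p ◁ σ.act q r ≫ h.counit p r =
      (α_ _ _ _).inv ≫ h.counit p q ▷ X.hom q r ≫ X.comp p q r := by
  simp [h.counit_right]

variable {z x : B} (σ : X.PreSing z) (τ : X.PreCosing x)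

section

variable {D : Type*} [Category* D] (L : (z ⟶ x) ⥤ D) [L.IsLeftAdjoint]

/-- Maps out of the image of a coend under a left adjoint. -/
noncomputable def coendDesc {d : D} (k : ∀ {y : B} (p : X.Obj y), L.obj (σ.val p ≫ τ.val p) ⟶ d)
    (hk : ∀ {y y' : B} (p : X.Obj y) (q : X.Obj y'),
      L.map ((α_ _ _ _).hom ≫ σ.val p ◁ τ.act p q) ≫ k p = L.map (σ.act p q ▷ τ.val q) ≫ k q) :
    L.obj (coend σ τ) ⟶ d :=
  mcDesc L (cowedgeIndex σ τ) (fun j => k j.2) (fun i => hk i.1.2 i.2.2)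

theorem coendDesc_fac {d : D} (k : ∀ {y : B} (p : X.Obj y), L.obj (σ.val p ≫ τ.val p) ⟶ d)
    (hk : ∀ {y y' : B} (p : X.Obj y) (q : X.Obj y'),
      L.map ((α_ _ _ _).hom ≫ σ.val p ◁ τ.act p q) ≫ k p = L.map (σ.act p q ▷ τ.val q) ≫ k q)
    {y : B} (p : X.Obj y) :
    L.map (coendι σ τ p) ≫ coendDesc σ τ L k hk = k p :=
  mcDesc_fac L (cowedgeIndex σ τ) (fun j => k j.2) (fun i => hk i.1.2 i.2.2) ⟨y, p⟩

theorem coend_hom_ext {d : D} {s t : L.obj (coend σ τ) ⟶ d}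
    (h : ∀ {y : B} (p : X.Obj y), L.map (coendι σ τ p) ≫ s = L.map (coendι σ τ p) ≫ t) : s = t :=
  mc_hom_ext L (cowedgeIndex σ τ) (fun j => h j.2)

end

variable [ClosedBicategory B]

variable {σ τ} in
theorem coend_ext_right {y : B} {g : x ⟶ y} {d : z ⟶ y} {s t : coend σ τ ≫ g ⟶ d}
    (h : ∀ {y : B} (p : X.Obj y), coendι σ τ p ▷ g ≫ s = coendι σ τ p ▷ g ≫ t) : s = t :=
  coend_hom_ext σ τ (Bicategory.postcomp z g) h

variable {σ τ} in
theorem coend_ext_right_right {y y' : B} {g : x ⟶ y} {g' : y ⟶ y'} {d : z ⟶ y'}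
    {s t : (coend σ τ ≫ g) ≫ g' ⟶ d}
    (h : ∀ {y : B} (p : X.Obj y), coendι σ τ p ▷ g ▷ g' ≫ s = coendι σ τ p ▷ g ▷ g' ≫ t) :
    s = t :=
  coend_hom_ext σ τ (Bicategory.postcomp z g ⋙ Bicategory.postcomp z g') h

variable {σ τ} in
theorem coend_ext_left_right {y y' : B} {g : y ⟶ z} {g' : x ⟶ y'} {d : y ⟶ y'}
    {s t : (g ≫ coend σ τ) ≫ g' ⟶ d}
    (h : ∀ {y : B} (p : X.Obj y), (g ◁ coendι σ τ p) ▷ g' ≫ s = (g ◁ coendι σ τ p) ▷ g' ≫ t) :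
    s = t :=
  coend_hom_ext σ τ (Bicategory.precomp x g ⋙ Bicategory.postcomp y g') h

variable {σ τ} in
theorem coend_ext_left {y : B} {g : y ⟶ z} {d : y ⟶ x}
    {s t : g ≫ coend σ τ ⟶ d}
    (h : ∀ {y : B} (p : X.Obj y), g ◁ coendι σ τ p ≫ s = g ◁ coendι σ τ p ≫ t) :
    s = t :=
  coend_hom_ext σ τ (Bicategory.precomp x g) h

end Coend

namespace Sing

variable {X : ECat.{w, v, u, a} B} [LocallyCocomplete.{w, v, u, max u a} B] [ClosedBicategory B]

variable {x : B} (S : X.Sing x)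

theorem ev_aux {z y t t' : B} (θ : X.PreSing z) (p : X.Obj y) (b : X.Obj t) (c : X.Obj t') :
    ((α_ _ _ _).hom ≫ θ.val b ◁ S.right.act b c) ▷ S.left.val p ≫
      (α_ _ _ _).hom ≫ θ.val b ◁ S.adj.counit b p ≫ θ.act b p =
    (θ.act b c ▷ S.right.val c) ▷ S.left.val p ≫
      (α_ _ _ _).hom ≫ θ.val c ◁ S.adj.counit c p ≫ θ.act c p := by
  simp only [comp_whiskerRight, Category.assoc, associator_naturality_middle_assoc,
        associator_naturality_left_assoc]
  rw [← Bicategory.whiskerLeft_comp_assoc, S.adj.counit_left', ← whisker_exchange_assoc]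
  simp [θ.act_comp']

/-- The evaluation `2`-cells `σ(p) (σ^* θ) ⟶ θ(p)` of a singleton `σ`. -/
noncomputable def ev {z y : B} (θ : X.PreSing z) (p : X.Obj y) :
    coend θ S.right ≫ S.left.val p ⟶ θ.val p :=
  coendDesc θ S.right (Bicategory.postcomp z (S.left.val p))
    (fun b => (α_ _ _ _).hom ≫ θ.val b ◁ S.adj.counit b p ≫ θ.act b p)
    (fun b c => S.ev_aux θ p b c)

theorem ι_ev {z y y' : B} (θ : X.PreSing z) (b : X.Obj y') (p : X.Obj y) :
    coendι θ S.right b ▷ S.left.val p ≫ S.ev θ p =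
      (α_ _ _ _).hom ≫ θ.val b ◁ S.adj.counit b p ≫ θ.act b p :=
  coendDesc_fac θ S.right (Bicategory.postcomp z (S.left.val p)) _ _ b

/-- The evaluation `2`-cells form a morphism of presingletons. -/
theorem ev_act {z y y' : B} (θ : X.PreSing z) (p : X.Obj y) (q : X.Obj y') :
    S.ev θ p ▷ X.hom p q ≫ θ.act p q =
      (α_ _ _ _).hom ≫ coend θ S.right ◁ S.left.act p q ≫ S.ev θ q := by
  apply coend_ext_right_right
  intro t b
  have h1 := congrArg (fun k => θ.val b ◁ k) (S.adj.counit_right' b p q)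
  simp only [Bicategory.whiskerLeft_comp] at h1
  rw [← comp_whiskerRight_assoc, ι_ev, associator_naturality_left_assoc,
    ← whisker_exchange_assoc, ι_ev]
  simp only [comp_whiskerRight, whisker_assoc, Category.assoc, θ.act_comp,
    Iso.inv_hom_id_assoc, comp_whiskerLeft]
  rw [reassoc_of% h1]
  simp

/-- The unit of a singleton evaluates to the identity. -/
theorem unit_ev {y : B} (p : X.Obj y) :
    S.adj.unit ▷ S.left.val p ≫ S.ev S.left p = (λ_ _).hom := by
  obtain ⟨Φ, h1, h2⟩ := S.adj.triangle_left p
  rw [← h2]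
  congr 1
  apply coend_ext_right
  intro t b
  exact (S.ι_ev S.left b p).trans (h1 b).symm

section lift

variable {z : B} {θ : X.PreSing z} {f : z ⟶ x}

theorem lift_aux (k : ∀ {y : B} (p : X.Obj y), f ≫ S.left.val p ⟶ θ.val p)
    (hk : ∀ {y y' : B} (p : X.Obj y) (q : X.Obj y'),
      k p ▷ X.hom p q ≫ θ.act p q = (α_ _ _ _).hom ≫ f ◁ S.left.act p q ≫ k q)
    {t t' : B} (b : X.Obj t) (c : X.Obj t') :
    f ◁ ((α_ _ _ _).hom ≫ S.left.val b ◁ S.right.act b c) ≫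
      (α_ _ _ _).inv ≫ k b ▷ S.right.val b ≫ coendι θ S.right b =
    f ◁ (S.left.act b c ▷ S.right.val c) ≫
      (α_ _ _ _).inv ≫ k c ▷ S.right.val c ≫ coendι θ S.right c := by
  have h' := congrArg (fun k => (α_ _ _ _).inv ▷ S.right.val c ≫ k ▷ S.right.val c) (hk b c)
  simp only [comp_whiskerRight, inv_hom_whiskerRight_assoc] at h'
  rw [associator_inv_naturality_middle_assoc, ← reassoc_of% h', Bicategory.whiskerLeft_comp_assoc,
    associator_inv_naturality_right_assoc, whisker_exchange_assoc, coend_condition]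
  simp

variable (k : ∀ {y : B} (p : X.Obj y), f ≫ S.left.val p ⟶ θ.val p)
  (hk : ∀ {y y' : B} (p : X.Obj y) (q : X.Obj y'),
    k p ▷ X.hom p q ≫ θ.act p q = (α_ _ _ _).hom ≫ f ◁ S.left.act p q ≫ k q)

/-- The `2`-cell `f (σ^* σ) ⟶ σ^* θ` induced by a morphism of presingletons `σ f ⟶ θ`. -/
noncomputable def liftAux : f ≫ coend S.left S.right ⟶ coend θ S.right :=
  coendDesc S.left S.right (Bicategory.precomp x f)
      (fun b => (α_ _ _ _).inv ≫ k b ▷ S.right.val b ≫ coendι θ S.right b)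
      (fun b c => S.lift_aux k hk b c)

theorem ι_liftAux {t : B} (b : X.Obj t) :
    f ◁ coendι S.left S.right b ≫ S.liftAux k hk =
      (α_ _ _ _).inv ≫ k b ▷ S.right.val b ≫ coendι θ S.right b :=
  coendDesc_fac S.left S.right (Bicategory.precomp x f) _ (fun b c => S.lift_aux k hk b c) b

theorem liftAux_ev {y : B} (p : X.Obj y) : S.liftAux k hk ▷ S.left.val p ≫ S.ev θ p =
      (α_ _ _ _).hom ≫ f ◁ S.ev S.left p ≫ k p := by
  apply coend_ext_left_right
  intro t b
  have h1 := congrArg (fun m => f ◁ m) (S.ι_ev S.left b p)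
  simp only [Bicategory.whiskerLeft_comp] at h1
  rw [← comp_whiskerRight_assoc, ι_liftAux, associator_naturality_middle_assoc,
    reassoc_of% h1]
  have h2 := hk b p
  rw [← cancel_epi (α_ _ _ _).inv, Iso.inv_hom_id_assoc] at h2
  rw [← h2]
  simp only [comp_whiskerRight, Category.assoc, ι_ev]
  rw [associator_naturality_left_assoc, ← whisker_exchange_assoc]
  simp

/-- The `2`-cell `f ⟶ σ^* θ` corresponding to a morphism of presingletons `σ f ⟶ θ`. -/
noncomputable def lift : f ⟶ coend θ S.right :=
  (ρ_ f).inv ≫ f ◁ S.adj.unit ≫ S.liftAux k hk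

theorem lift_ev {y : B} (p : X.Obj y) : S.lift k hk ▷ S.left.val p ≫ S.ev θ p = k p := by
  have h1 := congrArg (fun m => f ◁ m) (S.unit_ev p)
  simp only [Bicategory.whiskerLeft_comp] at h1
  simp only [lift, comp_whiskerRight, Category.assoc, liftAux_ev]
  rw [associator_naturality_middle_assoc, reassoc_of% h1]
  simp

end lift

section injective

variable {z : B} (θ : X.PreSing z)

/-- The `2`-cell `(σ^* θ) (σ^* σ) ⟶ σ^* θ` induced by evaluation. -/
theorem evr_unit : (coend θ S.right ◁ S.adj.unit) ≫
    S.liftAux (fun p => S.ev θ p) (fun p q => S.ev_act θ p q) = (ρ_ _).hom := by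
  apply coend_hom_ext θ S.right (Bicategory.postcomp z (𝟙 x))
  intro t b
  change coendι θ S.right b ▷ 𝟙 x ≫ _ = coendι θ S.right b ▷ 𝟙 x ≫ _
  obtain ⟨Ψ, h1, h2⟩ := S.adj.triangle_right b
  rw [← whisker_exchange_assoc]
  have key : coendι θ S.right b ▷ coend S.left S.right ≫
      S.liftAux (fun p => S.ev θ p) (fun p q => S.ev_act θ p q) =
      (α_ _ _ _).hom ≫ θ.val b ◁ Ψ ≫ coendι θ S.right b := by
    apply coend_ext_left
    intro t' c
    have h3 := congrArg (fun m => θ.val b ◁ m) (h1 c)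
    simp only [Bicategory.whiskerLeft_comp] at h3
    rw [whisker_exchange_assoc, ι_liftAux]
    simp only [comp_whiskerLeft, Category.assoc, Iso.inv_hom_id_assoc]
    rw [reassoc_of% h3, coend_condition]
    have h4 := congrArg (fun m => m ▷ S.right.val c) (S.ι_ev θ b c)
    simp only [comp_whiskerRight] at h4
    rw [associator_inv_naturality_left_assoc, reassoc_of% h4]
    simp
  rw [key]
  have h5 := congrArg (fun m => θ.val b ◁ m) h2
  simp only [Bicategory.whiskerLeft_comp] at h5
  simp [reassoc_of% h5]

variable {S θ} in
theorem ev_injective {f : z ⟶ x} {s t : f ⟶ coend θ S.right}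
    (h : ∀ {y : B} (p : X.Obj y), s ▷ S.left.val p ≫ S.ev θ p = t ▷ S.left.val p ≫ S.ev θ p) :
    s = t := by
  have key : s ▷ coend S.left S.right ≫
      S.liftAux (fun p => S.ev θ p) (fun p q => S.ev_act θ p q) =
      t ▷ coend S.left S.right ≫
      S.liftAux (fun p => S.ev θ p) (fun p q => S.ev_act θ p q) := by
    apply coend_ext_left
    intro t' c
    have h4 := congrArg (fun m => m ▷ S.right.val c) (h c)
    simp only [comp_whiskerRight] at h4
    rw [whisker_exchange_assoc, ι_liftAux, whisker_exchange_assoc, ι_liftAux,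
      associator_inv_naturality_left_assoc, reassoc_of% h4]
    simp
  have h6 := congrArg (fun m => f ◁ S.adj.unit ≫ m) key
  simp only [whisker_exchange_assoc, evr_unit] at h6
  simpa using h6

end injective

end Sing

end ECat

namespace ECat

section Adj

variable {X : ECat.{w, v, u, a} B} [LocallyCocomplete.{w, v, u, max u a} B] [ClosedBicategory B]

/-- A right adjoint of a presingleton whose unit factors through a leg of the coend. -/
noncomputable def SingAdj.ofElt {x y : B} {σ : X.PreSing x} {τ : X.PreCosing x} (p : X.Obj y)
    (unit : 𝟙 x ⟶ σ.val p ≫ τ.val p)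
    (counit : ∀ {y z : B} (p : X.Obj y) (q : X.Obj z), τ.val p ≫ σ.val q ⟶ X.hom p q)
    (hr : ∀ {y z t : B} (p : X.Obj y) (q : X.Obj z) (r : X.Obj t),
      counit p q ▷ X.hom q r ≫ X.comp p q r =
        (α_ _ _ _).hom ≫ τ.val p ◁ σ.act q r ≫ counit p r)
    (hl : ∀ {y z t : B} (p : X.Obj y) (q : X.Obj z) (r : X.Obj t),
      X.hom p q ◁ counit q r ≫ X.comp p q r =
        (α_ _ _ _).inv ≫ τ.act p q ▷ σ.val r ≫ counit p r)
    (tl : ∀ {z : B} (q : X.Obj z), unit ▷ σ.val q ≫ (α_ _ _ _).hom ≫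
      σ.val p ◁ counit p q ≫ σ.act p q = (λ_ (σ.val q)).hom)
    (tr : ∀ {z : B} (q : X.Obj z), τ.val q ◁ unit ≫ (α_ _ _ _).inv ≫
      counit q p ▷ τ.val p ≫ τ.act q p = (ρ_ (τ.val q)).hom) :
    SingAdj σ τ where
  unit := unit ≫ coendι σ τ p
  counit := counit
  counit_right := hr
  counit_left := hl
  triangle_left q := by
    have hc : ∀ {t t' : B} (b : X.Obj t) (c : X.Obj t'),
        ((α_ _ _ _).hom ≫ σ.val b ◁ τ.act b c) ▷ σ.val q ≫
          (α_ _ _ _).hom ≫ σ.val b ◁ counit b q ≫ σ.act b q =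
        (σ.act b c ▷ τ.val c) ▷ σ.val q ≫
          (α_ _ _ _).hom ≫ σ.val c ◁ counit c q ≫ σ.act c q := by
      intro t t' b c
      have h := congrArg (fun m => σ.val b ◁ m) (hl b c q)
      simp only [Bicategory.whiskerLeft_comp] at h
      simp only [comp_whiskerRight, Category.assoc, associator_naturality_left_assoc]
      rw [← whisker_exchange_assoc, σ.act_comp, associator_naturality_right_assoc, reassoc_of% h]
      simp
    obtain ⟨Φ, hΦ⟩ : ∃ Φ : coend σ τ ≫ σ.val q ⟶ σ.val q, ∀ {z : B} (p : X.Obj z),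
        coendι σ τ p ▷ σ.val q ≫ Φ = (α_ _ _ _).hom ≫ σ.val p ◁ counit p q ≫ σ.act p q :=
      ⟨coendDesc σ τ (Bicategory.postcomp x (σ.val q)) _ hc,
        fun b => coendDesc_fac σ τ (Bicategory.postcomp x (σ.val q)) _ hc b⟩
    exact ⟨Φ, hΦ, by rw [comp_whiskerRight, Category.assoc, hΦ, tl]⟩
  triangle_right q := by
    have hc : ∀ {t t' : B} (b : X.Obj t) (c : X.Obj t'),
        τ.val q ◁ ((α_ _ _ _).hom ≫ σ.val b ◁ τ.act b c) ≫
          (α_ _ _ _).inv ≫ counit q b ▷ τ.val b ≫ τ.act q b =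
        τ.val q ◁ (σ.act b c ▷ τ.val c) ≫
          (α_ _ _ _).inv ≫ counit q c ▷ τ.val c ≫ τ.act q c := by
      intro t t' b c
      have h := congrArg (fun m => (α_ _ _ _).inv ▷ _ ≫ m ▷ τ.val c) (hr q b c)
      simp only [comp_whiskerRight, inv_hom_whiskerRight_assoc] at h
      have h3 := τ.act_comp q b c
      have h4 : X.hom q b ◁ τ.act b c ≫ τ.act q b = (α_ _ _ _).inv ≫
        X.comp q b c ▷ τ.val c ≫ τ.act q c := by simp [h3]
      rw [Bicategory.whiskerLeft_comp_assoc, associator_inv_naturality_right_assoc,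
        whisker_exchange_assoc, h4, associator_inv_naturality_middle_assoc, ← reassoc_of% h]
      simp
    obtain ⟨Ψ, hΨ⟩ : ∃ Ψ : τ.val q ≫ coend σ τ ⟶ τ.val q, ∀ {z : B} (p : X.Obj z),
        τ.val q ◁ coendι σ τ p ≫ Ψ = (α_ _ _ _).inv ≫ counit q p ▷ τ.val p ≫ τ.act q p :=
      ⟨coendDesc σ τ (Bicategory.precomp x (τ.val q)) _ hc,
        fun b => coendDesc_fac σ τ (Bicategory.precomp x (τ.val q)) _ hc b⟩
    exact ⟨Ψ, hΨ, by rw [Bicategory.whiskerLeft_comp, Category.assoc, hΨ, tr]⟩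

end Adj

section Singletons

variable (X : ECat.{w, v, u, a} B) [LocallyCocomplete.{w, v, u, max u a} B] [ClosedBicategory B]

theorem singComp_aux {x y z t t' : B} (Θ : X.Sing x) (S : X.Sing y) (T : X.Sing z)
    (p : X.Obj t) (q : X.Obj t') :
    ((α_ _ _ _).hom ≫ coend Θ.left S.right ◁ T.ev S.left p ≫ S.ev Θ.left p) ▷ X.hom p q ≫
        Θ.left.act p q =
      (α_ _ _ _).hom ≫ (coend Θ.left S.right ≫ coend S.left T.right) ◁ T.left.act p q ≫
        (α_ _ _ _).hom ≫ coend Θ.left S.right ◁ T.ev S.left q ≫ S.ev Θ.left q := by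
  have h1 := congrArg (fun m => coend Θ.left S.right ◁ m) (T.ev_act S.left p q)
  simp only [Bicategory.whiskerLeft_comp] at h1
  simp only [comp_whiskerRight, Category.assoc, S.ev_act, whisker_assoc, comp_whiskerLeft,
    Iso.inv_hom_id_assoc]
  rw [reassoc_of% h1]
  simp

/-- The composition of the category of singletons. -/
noncomputable def singComp {x y z : B} (Θ : X.Sing x) (S : X.Sing y) (T : X.Sing z) :
    coend Θ.left S.right ≫ coend S.left T.right ⟶ coend Θ.left T.right :=
  T.lift (θ := Θ.left)
    (fun p => (α_ _ _ _).hom ≫ coend Θ.left S.right ◁ T.ev S.left p ≫ S.ev Θ.left p)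
    (fun p q => X.singComp_aux Θ S T p q)

theorem singComp_ev {x y z t : B} (Θ : X.Sing x) (S : X.Sing y) (T : X.Sing z) (p : X.Obj t) :
    X.singComp Θ S T ▷ T.left.val p ≫ T.ev Θ.left p =
      (α_ _ _ _).hom ≫ coend Θ.left S.right ◁ T.ev S.left p ≫ S.ev Θ.left p :=
  T.lift_ev _ (fun p q => X.singComp_aux Θ S T p q) p

/-- The category of singletons of `X`. The `2`-cells of the structure are those induced by the
units and by the evaluations `σ(p) (σ^* θ) ⟶ θ(p)`. -/
noncomputable def singletons : ECat.{w, v, u, max u v w a} B where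
  Obj x := X.Sing x
  hom Θ S := coend Θ.left S.right
  one S := S.adj.unit
  comp Θ S T := X.singComp Θ S T
  one_comp Θ S := by
    apply Sing.ev_injective
    intro t p
    rw [comp_whiskerRight, Category.assoc, singComp_ev, associator_naturality_left_assoc,
      ← whisker_exchange_assoc, Θ.unit_ev]
    simp
  comp_one Θ S := by
    apply Sing.ev_injective
    intro t p
    have h1 := congrArg (fun m => coend Θ.left S.right ◁ m) (S.unit_ev p)
    simp only [Bicategory.whiskerLeft_comp] at h1
    rw [comp_whiskerRight, Category.assoc, singComp_ev, associator_naturality_middle_assoc,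
      reassoc_of% h1]
    simp
  comp_assoc Θ S T U := by
    apply Sing.ev_injective
    intro t p
    have h1 := congrArg (fun m => coend Θ.left S.right ◁ m) (X.singComp_ev S T U p)
    simp only [Bicategory.whiskerLeft_comp] at h1
    simp only [comp_whiskerRight, Category.assoc]
    rw [singComp_ev, singComp_ev, associator_naturality_left_assoc, ← whisker_exchange_assoc,
      singComp_ev, associator_naturality_middle_assoc, reassoc_of% h1]
    simp

theorem repr_triangle_left {x z : B} (p : X.Obj x) (q : X.Obj z) :
    ((λ_ (𝟙 x)).inv ≫ X.one p ▷ 𝟙 x ≫ X.hom p p ◁ X.one p) ▷ X.hom p q ≫ (α_ _ _ _).hom ≫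
      X.hom p p ◁ X.comp p p q ≫ X.comp p p q = (λ_ (X.hom p q)).hom := by
  have h1 := congrArg (fun m => X.hom p p ◁ m) (X.one_comp p q)
  simp only [Bicategory.whiskerLeft_comp] at h1
  simp only [comp_whiskerRight, Category.assoc, associator_naturality_middle_assoc]
  have h3 : X.one p ▷ 𝟙 x = (ρ_ _).hom ≫ X.one p ≫ (ρ_ _).inv := by simp
  rw [reassoc_of% h1, h3]
  simp [X.one_comp]

theorem repr_triangle_right {x z : B} (p : X.Obj x) (q : X.Obj z) :
    X.hom q p ◁ ((λ_ (𝟙 x)).inv ≫ X.one p ▷ 𝟙 x ≫ X.hom p p ◁ X.one p) ≫ (α_ _ _ _).inv ≫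
      X.comp q p p ▷ X.hom p p ≫ X.comp q p p = (ρ_ (X.hom q p)).hom := by
  have h1 := congrArg (fun m => m ▷ X.hom p p) (X.comp_one q p)
  simp only [comp_whiskerRight] at h1
  have h2 : X.one p ▷ 𝟙 x ≫ X.hom p p ◁ X.one p = 𝟙 x ◁ X.one p ≫ X.one p ▷ X.hom p p := by
    rw [whisker_exchange]
  rw [h2]
  simp only [Bicategory.whiskerLeft_comp, Category.assoc, associator_inv_naturality_middle_assoc,
    reassoc_of% h1]
  have h3 : 𝟙 x ◁ X.one p = (λ_ _).hom ≫ X.one p ≫ (λ_ _).inv := by simp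
  rw [h3]
  simp [X.comp_one]

/-- The representable singleton of an element `p`. -/
noncomputable def Sing.repr {x : B} (p : X.Obj x) : X.Sing x where
  left := PreSing.repr X p
  right := PreCosing.repr X p
  adj := SingAdj.ofElt p ((λ_ (𝟙 x)).inv ≫ X.one p ▷ 𝟙 x ≫ X.hom p p ◁ X.one p)
    (fun b c => X.comp b p c)
    (fun b c d => X.comp_assoc b p c d)
    (fun b c d => X.comp_assoc' b c p d)
    (fun q => X.repr_triangle_left p q)
    (fun q => X.repr_triangle_right p q)

/-- The composite of two representable singletons. -/
noncomputable def reprHom {x y : B} (p : X.Obj x) (q : X.Obj y) : x ⟶ y :=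
  coend (PreSing.repr X p) (PreCosing.repr X q)

noncomputable def reprι {x y z : B} (p : X.Obj x) (q : X.Obj y) (b : X.Obj z) :
    X.hom p b ≫ X.hom b q ⟶ X.reprHom p q :=
  coendι (PreSing.repr X p) (PreCosing.repr X q) b

noncomputable def reprEv {x y z : B} (p : X.Obj x) (q : X.Obj y) (b : X.Obj z) :
    X.reprHom p q ≫ X.hom q b ⟶ X.hom p b :=
  (Sing.repr X q).ev (PreSing.repr X p) b

noncomputable def reprComp {x y z : B} (p : X.Obj x) (q : X.Obj y) (r : X.Obj z) :
    X.reprHom p q ≫ X.reprHom q r ⟶ X.reprHom p r :=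
  X.singComp (Sing.repr X p) (Sing.repr X q) (Sing.repr X r)

noncomputable def reprUnit {x : B} (p : X.Obj x) : 𝟙 x ⟶ X.reprHom p p :=
  (Sing.repr X p).adj.unit

theorem reprι_ev {x y z t : B} (p : X.Obj x) (q : X.Obj y) (b : X.Obj z) (c : X.Obj t) :
    X.reprι p q b ▷ X.hom q c ≫ X.reprEv p q c =
      (α_ _ _ _).hom ≫ X.hom p b ◁ X.comp b q c ≫ X.comp p b c :=
  (Sing.repr X q).ι_ev (PreSing.repr X p) b c

theorem reprUnit_ev {x z : B} (p : X.Obj x) (b : X.Obj z) :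
    X.reprUnit p ▷ X.hom p b ≫ X.reprEv p p b = (λ_ _).hom :=
  (Sing.repr X p).unit_ev b

theorem reprComp_ev {x y z t : B} (p : X.Obj x) (q : X.Obj y) (r : X.Obj z) (b : X.Obj t) :
    X.reprComp p q r ▷ X.hom r b ≫ X.reprEv p r b =
      (α_ _ _ _).hom ≫ X.reprHom p q ◁ X.reprEv q r b ≫ X.reprEv p q b :=
  X.singComp_ev (Sing.repr X p) (Sing.repr X q) (Sing.repr X r) b

variable {X} in
theorem reprEv_injective {x y : B} {p : X.Obj x} {q : X.Obj y} {f : x ⟶ y}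
    {s t : f ⟶ X.reprHom p q}
    (h : ∀ {z : B} (b : X.Obj z), s ▷ X.hom q b ≫ X.reprEv p q b =
      t ▷ X.hom q b ≫ X.reprEv p q b) : s = t :=
  Sing.ev_injective (S := Sing.repr X q) (fun b => h b)

/-- The `2`-cells of the Yoneda embedding. -/
noncomputable def yonedaMap {x y : B} (p : X.Obj x) (q : X.Obj y) : X.hom p q ⟶ X.reprHom p q :=
  (ρ_ _).inv ≫ X.hom p q ◁ X.one q ≫ X.reprι p q q

theorem yonedaMap_ev {x y z : B} (p : X.Obj x) (q : X.Obj y) (b : X.Obj z) :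
    X.yonedaMap p q ▷ X.hom q b ≫ X.reprEv p q b = X.comp p q b := by
  have h3 := congrArg (fun m => X.hom p q ◁ m) (X.one_comp q b)
  simp only [Bicategory.whiskerLeft_comp] at h3
  simp only [yonedaMap, comp_whiskerRight, Category.assoc, reprι_ev]
  rw [associator_naturality_middle_assoc, reassoc_of% h3]
  simp

theorem yonedaMap_one {x : B} (p : X.Obj x) : X.one p ≫ X.yonedaMap p p = X.reprUnit p := by
  apply reprEv_injective
  intro z b
  rw [comp_whiskerRight, Category.assoc, yonedaMap_ev, reprUnit_ev, X.one_comp]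

theorem yonedaMap_comp {x y z : B} (p : X.Obj x) (q : X.Obj y) (r : X.Obj z) :
    X.comp p q r ≫ X.yonedaMap p r = X.yonedaMap p q ▷ X.hom q r ≫
      X.reprHom p q ◁ X.yonedaMap q r ≫ X.reprComp p q r := by
  apply reprEv_injective
  intro t b
  have h3 := congrArg (fun m => X.reprHom p q ◁ m) (X.yonedaMap_ev q r b)
  simp only [Bicategory.whiskerLeft_comp] at h3
  simp only [comp_whiskerRight, Category.assoc, yonedaMap_ev, reprComp_ev]
  rw [associator_naturality_middle_assoc, reassoc_of% h3, associator_naturality_left_assoc,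
      ← whisker_exchange_assoc, X.yonedaMap_ev, X.comp_assoc]

/-- The Yoneda embedding of `X` in its category of singletons. -/
noncomputable def yoneda : EFunctor X (singletons X) where
  obj p := Sing.repr X p
  map p q := X.yonedaMap p q
  map_one p := X.yonedaMap_one p
  map_comp p q r := X.yonedaMap_comp p q r

end Singletons

end ECat

namespace ECat

variable {X : ECat.{w, v, u, a} B}

variable (X) in
/-- A restriction of the element `p` along a `1`-cell `γ`: an element representing the
presingleton `M(-, p) γ`, by means of the universal `2`-cell `j`. -/
structure Restr {z y : B} (γ : z ⟶ y) (p : X.Obj y) where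
  elt : X.Obj z
  j : γ ⟶ X.hom elt p
  isIso : ∀ {t : B} (b : X.Obj t), IsIso (X.mul j (𝟙 (X.hom p b)))

theorem mul_assoc' {x y z t : B} {p : X.Obj x} {q : X.Obj y} {r : X.Obj z} {o : X.Obj t}
    {f : x ⟶ y} {g : y ⟶ z} {h : z ⟶ t}
    (s : f ⟶ X.hom p q) (t : g ⟶ X.hom q r) (k : h ⟶ X.hom r o) :
    X.mul s (X.mul t k) = (α_ f g h).inv ≫ X.mul (X.mul s t) k := by
  simp [mul_assoc]

namespace Restr

section

variable {z y : B} {γ : z ⟶ y} {p : X.Obj y} (R : X.Restr γ p)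

/-- The `2`-cell which corresponds to the identity of the restriction. -/
noncomputable def unit : 𝟙 z ⟶ γ ≫ X.hom p R.elt :=
  have := R.isIso R.elt
  X.one R.elt ≫ inv (X.mul R.j (𝟙 (X.hom p R.elt)))

theorem unit_fac : R.unit ≫ X.mul R.j (𝟙 (X.hom p R.elt)) = X.one R.elt := by
  have := R.isIso R.elt
  simp [unit]

theorem unit_j : R.unit ▷ γ ≫ (α_ _ _ _).hom ≫ γ ◁ X.mul (𝟙 (X.hom p R.elt)) R.j =
    (λ_ γ).hom ≫ (ρ_ γ).inv ≫ γ ◁ X.one p := by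
  have := R.isIso p
  rw [← cancel_mono (X.mul R.j (𝟙 (X.hom p p)))]
  simp only [Category.assoc, ← mul_comp, Category.comp_id]
  rw [← mul_assoc, ← comp_mul, unit_fac, one_mul, mul_one]
  simp

variable {x : B} {q : X.Obj x} {f : x ⟶ z}

/-- The factorization of a `2`-cell through `j`. -/
noncomputable def fac (k : f ≫ γ ⟶ X.hom q p) : f ⟶ X.hom q R.elt :=
  (ρ_ f).inv ≫ f ◁ R.unit ≫ (α_ _ _ _).inv ≫ X.mul k (𝟙 (X.hom p R.elt))

theorem mul_fac (k : f ≫ γ ⟶ X.hom q p) : X.mul (R.fac k) R.j = k := by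
  have h := congrArg (fun m => f ◁ m) R.unit_j
  simp only [Bicategory.whiskerLeft_comp] at h
  have h2 : X.mul k (X.mul (𝟙 (X.hom p R.elt)) R.j) =
      (f ≫ γ) ◁ X.mul (𝟙 (X.hom p R.elt)) R.j ≫ X.mul k (𝟙 (X.hom p p)) := by
    rw [← mul_comp, Category.comp_id]
  have h3 : f ◁ γ ◁ X.one p ≫ (α_ f γ (X.hom p p)).inv ≫ X.mul k (𝟙 (X.hom p p)) =
      (α_ f γ _).inv ≫ (ρ_ _).hom ≫ k := by
    rw [associator_inv_naturality_right_assoc, ← mul_comp, Category.comp_id, mul_one]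
  have h4 : (ρ_ f).inv ▷ γ ≫ (f ◁ R.unit) ▷ γ ≫ (α_ f γ (X.hom p R.elt)).inv ▷ γ ≫
      (α_ _ _ _).hom ≫ (α_ _ _ _).hom = (ρ_ f).inv ▷ γ ≫ (α_ _ _ _).hom ≫
        f ◁ R.unit ▷ γ ≫ f ◁ (α_ _ _ _).hom := by
    simp
  have h5 : (f ≫ γ) ◁ X.mul (𝟙 (X.hom p R.elt)) R.j =
     (α_ _ _ _).hom ≫ f ◁ γ ◁ X.mul (𝟙 (X.hom p R.elt)) R.j ≫ (α_ _ _ _).inv := by simp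
  simp only [fac, comp_mul, mul_assoc]
  rw [h2, h5]
  simp only [Category.assoc]
  rw [reassoc_of% h4, reassoc_of% h, h3]
  simp

theorem fac_mul (k : f ⟶ X.hom q R.elt) : R.fac (X.mul k R.j) = k := by
  rw [fac, mul_assoc, Iso.inv_hom_id_assoc, ← mul_comp, unit_fac, mul_one, Iso.inv_hom_id_assoc]

theorem j_injective {k k' : f ⟶ X.hom q R.elt} (h : X.mul k R.j = X.mul k' R.j) : k = k' := by
  rw [← R.fac_mul k, h, R.fac_mul]

end

section Map

variable {z y y' y'' : B} {γ : z ⟶ y} {γ' : z ⟶ y} {γ'' : z ⟶ y}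
  {p p' p'' : X.Obj y}

/-- The arrow of restrictions induced by a `2`-cell and by an arrow. -/
noncomputable def map (R : X.Restr γ p) (R' : X.Restr γ' p') (α : γ' ⟶ γ)
    (s : Fib.mk p ⟶ Fib.mk p') : Fib.mk R.elt ⟶ Fib.mk R'.elt :=
  ⟨R'.fac ((λ_ γ').hom ≫ α ≫ (ρ_ γ).inv ≫ X.mul R.j s.cell)⟩

theorem map_j (R : X.Restr γ p) (R' : X.Restr γ' p') (α : γ' ⟶ γ)
    (s : Fib.mk p ⟶ Fib.mk p') : X.mul (R.map R' α s).cell R'.j =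
      (λ_ γ').hom ≫ α ≫ (ρ_ γ).inv ≫ X.mul R.j s.cell :=
  R'.mul_fac _

theorem eq_map (R : X.Restr γ p) (R' : X.Restr γ' p') (α : γ' ⟶ γ)
    (s : Fib.mk p ⟶ Fib.mk p') (k : Fib.mk R.elt ⟶ Fib.mk R'.elt)
    (h : X.mul k.cell R'.j = (λ_ γ').hom ≫ α ≫ (ρ_ γ).inv ≫ X.mul R.j s.cell) :
    k = R.map R' α s := by
  apply fib_hom_ext
  apply R'.j_injective
  rw [h, map_j]

theorem map_id (R : X.Restr γ p) : R.map R (𝟙 γ) (𝟙 (Fib.mk p)) = 𝟙 _ := by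
  symm
  apply eq_map
  simp [one_mul, mul_one]

theorem map_comp (R : X.Restr γ p) (R' : X.Restr γ' p') (R'' : X.Restr γ'' p'') (α : γ' ⟶ γ)
    (s : Fib.mk p ⟶ Fib.mk p') (α' : γ'' ⟶ γ') (s' : Fib.mk p' ⟶ Fib.mk p'') :
    R.map R' α s ≫ R'.map R'' α' s' = R.map R'' (α' ≫ α) (s ≫ s') := by
  apply eq_map
  rw [fib_comp_cell, comp_mul, mul_assoc, map_j, mul_comp, mul_comp, mul_comp, mul_assoc', map_j,
    comp_mul, comp_mul, comp_mul, mul_assoc, fib_comp_cell, mul_comp]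
  simp only [← Category.assoc]
  congr 1
  simp only [Category.assoc]
  have h : 𝟙 z ◁ α' ≫ 𝟙 z ◁ (ρ_ γ').inv ≫ (α_ (𝟙 z) γ' (𝟙 y)).inv ≫ (λ_ γ').hom ▷ 𝟙 y ≫
      α ▷ 𝟙 y = (λ_ _).hom ≫ α' ≫ α ≫ (ρ_ γ).inv := by
    simp
  rw [reassoc_of% h]
  simp

end Map

/-- An element is its own restriction along the identity. -/
abbrev id {y : B} (p : X.Obj y) : X.Restr (𝟙 y) p where
  elt := p
  j := X.one p
  isIso b := by rw [one_mul, Category.comp_id]; infer_instance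

/-- Restrictions compose. -/
abbrev comp {t z y : B} {γ : z ⟶ y} {δ : t ⟶ z} {p : X.Obj y} (R : X.Restr γ p)
    (S : X.Restr δ R.elt) : X.Restr (δ ≫ γ) p where
  elt := S.elt
  j := X.mul S.j R.j
  isIso b := by
    have := R.isIso b
    have := S.isIso b
    rw [mul_assoc]
    have h : X.mul S.j (X.mul R.j (𝟙 (X.hom p b))) =
      δ ◁ X.mul R.j (𝟙 (X.hom p b)) ≫ X.mul S.j (𝟙 (X.hom R.elt b)) := by
      rw [← mul_comp, Category.comp_id]
    rw [h]
    infer_instance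

theorem map_comp_comp {t z y : B} {γ γ' : z ⟶ y} {δ δ' : t ⟶ z} {p p' : X.Obj y}
    (R : X.Restr γ p) (R' : X.Restr γ' p') (S : X.Restr δ R.elt) (S' : X.Restr δ' R'.elt)
    (α : γ' ⟶ γ) (β : δ' ⟶ δ) (s : Fib.mk p ⟶ Fib.mk p') :
    S.map S' β (R.map R' α s) = (R.comp S).map (R'.comp S') (β ▷ γ' ≫ δ ◁ α) s := by
  refine eq_map (R.comp S) (R'.comp S') (β ▷ γ' ≫ δ ◁ α) s (S.map S' β (R.map R' α s)) ?_
  change X.mul (S.map S' β (R.map R' α s)).cell (X.mul S'.j R'.j) =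
    (λ_ (δ' ≫ γ')).hom ≫ (β ▷ γ' ≫ δ ◁ α) ≫ (ρ_ (δ ≫ γ)).inv ≫ X.mul (X.mul S.j R.j) s.cell
  rw [mul_assoc', map_j, comp_mul, comp_mul, comp_mul, mul_assoc, map_j, mul_comp, mul_comp,
    mul_comp, mul_assoc']
  simp

theorem map_assoc {s t z y : B} {γ : z ⟶ y} {δ : t ⟶ z} {κ : s ⟶ t} {p : X.Obj y}
    (R : X.Restr γ p) (S : X.Restr δ R.elt) (T : X.Restr κ S.elt) :
    ((R.comp S).comp T).map (R.comp (S.comp T)) (α_ κ δ γ).hom (𝟙 _) = 𝟙 (Fib.mk T.elt) := by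
  symm
  refine eq_map ((R.comp S).comp T) (R.comp (S.comp T)) (α_ κ δ γ).hom (𝟙 _) (𝟙 _) ?_
  change X.mul (X.one T.elt) (X.mul (X.mul T.j S.j) R.j) =
    (λ_ _).hom ≫ (α_ κ δ γ).hom ≫ (ρ_ _).inv ≫ X.mul (X.mul T.j (X.mul S.j R.j)) (X.one p)
  rw [one_mul, mul_one, mul_assoc]
  simp

theorem map_assoc_inv {s t z y : B} {γ : z ⟶ y} {δ : t ⟶ z} {κ : s ⟶ t} {p : X.Obj y}
    (R : X.Restr γ p) (S : X.Restr δ R.elt) (T : X.Restr κ S.elt) :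
    (R.comp (S.comp T)).map ((R.comp S).comp T) (α_ κ δ γ).inv (𝟙 _) = 𝟙 (Fib.mk T.elt) := by
  symm
  refine eq_map (R.comp (S.comp T)) ((R.comp S).comp T) (α_ κ δ γ).inv (𝟙 _) (𝟙 _) ?_
  change X.mul (X.one T.elt) (X.mul T.j (X.mul S.j R.j)) =
    (λ_ _).hom ≫ (α_ κ δ γ).inv ≫ (ρ_ _).inv ≫ X.mul (X.mul (X.mul T.j S.j) R.j) (X.one p)
  rw [one_mul, mul_one, mul_assoc]
  simp

theorem map_id_comp {z y : B} {γ : z ⟶ y} {p : X.Obj y} (R : X.Restr γ p) :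
    ((Restr.id p).comp R).map R (ρ_ γ).inv (𝟙 _) = 𝟙 (Fib.mk R.elt) := by
  symm
  refine eq_map ((Restr.id p).comp R) R (ρ_ γ).inv (𝟙 _) (𝟙 _) ?_
  change X.mul (X.one R.elt) R.j =
    (λ_ _).hom ≫ (ρ_ γ).inv ≫ (ρ_ _).inv ≫ X.mul (X.mul R.j (X.one p)) (X.one p)
  rw [one_mul, mul_one, mul_one]
  simp

theorem map_comp_id {z y : B} {γ : z ⟶ y} {p : X.Obj y} (R : X.Restr γ p) :
    (R.comp (Restr.id R.elt)).map R (λ_ γ).inv (𝟙 _) = 𝟙 (Fib.mk R.elt) := by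
  symm
  refine eq_map (R.comp (Restr.id R.elt)) R (λ_ γ).inv (𝟙 _) (𝟙 _) ?_
  change X.mul (X.one R.elt) R.j =
    (λ_ _).hom ≫ (λ_ γ).inv ≫ (ρ_ _).inv ≫ X.mul (X.mul (X.one R.elt) R.j) (X.one p)
  rw [one_mul, mul_one]
  simp


end Restr
end ECat

namespace ECat

variable {X : ECat.{w, v, u, a} B}

section Restriction

variable {z y : B} {γ : z ⟶ y} {δ : y ⟶ z} (adj : Bicategory.Adjunction γ δ) (p : X.Obj y)

/-- The counit of the singleton `M(-, p) γ`. -/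
def restrCounit {s t : B} (b : X.Obj s) (c : X.Obj t) :
    (X.hom b p ≫ δ) ≫ γ ≫ X.hom p c ⟶ X.hom b c :=
  (α_ _ _ _).hom ≫ X.hom b p ◁ ((α_ _ _ _).inv ≫ adj.counit ▷ X.hom p c ≫ (λ_ _).hom) ≫
    X.comp b p c

/-- The unit of the singleton `M(-, p) γ`, before composition with the leg at `p`. -/
def restrUnit : 𝟙 z ⟶ (γ ≫ X.hom p p) ≫ X.hom p p ≫ δ :=
  adj.unit ≫ ((ρ_ γ).inv ≫ γ ◁ X.one p) ▷ δ ≫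
    (γ ≫ X.hom p p) ◁ ((λ_ δ).inv ≫ X.one p ▷ δ)

theorem left_triangle' : adj.unit ▷ γ ≫ (α_ _ _ _).hom ≫ γ ◁ adj.counit =
    (λ_ γ).hom ≫ (ρ_ γ).inv := by
  have h := adj.left_triangle
  simpa [leftZigzag, bicategoricalComp] using h

theorem right_triangle' : δ ◁ adj.unit ≫ (α_ _ _ _).inv ≫ adj.counit ▷ δ =
    (ρ_ δ).hom ≫ (λ_ δ).inv := by
  have h := adj.right_triangle
  simpa [rightZigzag, bicategoricalComp] using h

theorem restr_left {s : B} (b : X.Obj s) : restrUnit adj p ▷ (γ ≫ X.hom p b) ≫ (α_ _ _ _).hom ≫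
    (γ ≫ X.hom p p) ◁ restrCounit adj p p b ≫ (α_ _ _ _).hom ≫ γ ◁ X.comp p p b =
      (λ_ (γ ≫ X.hom p b)).hom := by
  have h1 : restrUnit adj p = adj.unit ≫ (ρ_ γ).inv ▷ δ ≫ (γ ≫ 𝟙 y) ◁ (λ_ δ).inv ≫
      (γ ≫ 𝟙 y) ◁ X.one p ▷ δ ≫ (γ ◁ X.one p) ▷ (X.hom p p ≫ δ) := by
    simp only [restrUnit, comp_whiskerRight, Bicategory.whiskerLeft_comp, Category.assoc]
    rw [← whisker_exchange_assoc, ← whisker_exchange]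
  have h2 : (γ ◁ X.one p) ▷ (X.hom p p ≫ δ) ▷ (γ ≫ X.hom p b) ≫ (α_ _ _ _).hom ≫
    (γ ≫ X.hom p p) ◁ restrCounit adj p p b ≫ (α_ _ _ _).hom ≫ γ ◁ X.comp p p b =
      (α_ _ _ _).hom ≫ (γ ≫ 𝟙 y) ◁ restrCounit adj p p b ≫ (ρ_ _).hom ▷ X.hom p b := by
    have h := congrArg (fun m => γ ◁ m) (X.one_comp p b)
    simp only [Bicategory.whiskerLeft_comp] at h
    rw [associator_naturality_left_assoc, ← whisker_exchange_assoc,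
      associator_naturality_middle_assoc, h]
    simp
  have h3 : X.one p ▷ δ ▷ (γ ≫ X.hom p b) ≫ restrCounit adj p p b =
      (α_ (𝟙 y) δ (γ ≫ X.hom p b)).hom ≫ (λ_ _).hom ≫
      (α_ δ γ (X.hom p b)).inv ≫ adj.counit ▷ X.hom p b ≫ (λ_ _).hom := by
    have h := X.one_comp p b
    simp only [restrCounit]
    rw [associator_naturality_left_assoc, ← whisker_exchange_assoc, h]
    simp
  have h3' := congrArg (fun m => (γ ≫ 𝟙 y) ◁ m) h3
  simp only [Bicategory.whiskerLeft_comp] at h3'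
  have h4 := congrArg (fun m => m ▷ X.hom p b) (left_triangle' adj)
  simp only [comp_whiskerRight] at h4
  rw [h1]
  simp only [comp_whiskerRight, Category.assoc]
  rw [h2, associator_naturality_middle_assoc, reassoc_of% h3']
  have h5 : (ρ_ γ).inv ▷ δ ▷ (γ ≫ X.hom p b) ≫ ((γ ≫ 𝟙 y) ◁ (λ_ δ).inv) ▷ (γ ≫ X.hom p b) ≫
      (α_ _ _ _).hom ≫ (γ ≫ 𝟙 y) ◁ (α_ _ _ _).hom ≫ (γ ≫ 𝟙 y) ◁ (λ_ _).hom ≫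
      (γ ≫ 𝟙 y) ◁ (α_ _ _ _).inv ≫ (γ ≫ 𝟙 y) ◁ adj.counit ▷ X.hom p b =
      (α_ _ _ _).inv ≫ (α_ _ _ _).hom ▷ _ ≫ (γ ◁ adj.counit) ▷ X.hom p b ≫
        (γ ≫ 𝟙 y) ◁ (λ_ _).inv := by
    bicategory
  rw [reassoc_of% h5, associator_inv_naturality_left_assoc, reassoc_of% h4]
  bicategory

theorem restr_right {s : B} (b : X.Obj s) : (X.hom b p ≫ δ) ◁ restrUnit adj p ≫ (α_ _ _ _).inv ≫
    restrCounit adj p b p ▷ (X.hom p p ≫ δ) ≫ (α_ _ _ _).inv ≫ X.comp b p p ▷ δ =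
      (ρ_ (X.hom b p ≫ δ)).hom := by
  have h2 : (X.hom b p ≫ δ) ◁ (γ ≫ X.hom p p) ◁ X.one p ▷ δ ≫ (α_ _ _ _).inv ≫
    restrCounit adj p b p ▷ (X.hom p p ≫ δ) ≫ (α_ _ _ _).inv ≫ X.comp b p p ▷ δ =
      (α_ _ _ _).inv ≫ restrCounit adj p b p ▷ (𝟙 y ≫ δ) ≫ X.hom b p ◁ (λ_ _).hom := by
    have h := congrArg (fun m => m ▷ δ) (X.comp_one b p)
    simp only [comp_whiskerRight] at h
    rw [associator_inv_naturality_right_assoc, whisker_exchange_assoc,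
      associator_inv_naturality_middle_assoc, h]
    simp
  have h3 : (X.hom b p ≫ δ) ◁ γ ◁ X.one p ≫ restrCounit adj p b p =
      (α_ (X.hom b p) δ _).hom ≫ X.hom b p ◁ δ ◁ (ρ_ _).hom ≫
        X.hom b p ◁ adj.counit ≫ (ρ_ _).hom := by
    have h := X.comp_one b p
    simp only [restrCounit]
    have h6 : (X.hom b p ≫ δ) ◁ γ ◁ X.one p ≫ (α_ _ _ _).hom ≫ X.hom b p ◁
      ((α_ δ γ (X.hom p p)).inv ≫ adj.counit ▷ X.hom p p ≫ (λ_ (X.hom p p)).hom) =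
      (α_ _ _ _).hom ≫ X.hom b p ◁ ((α_ δ γ (𝟙 y)).inv ≫ adj.counit ▷ 𝟙 y ≫ (λ_ _).hom) ≫
        X.hom b p ◁ X.one p := by
      simp only [comp_whiskerLeft, Category.assoc, Iso.inv_hom_id_assoc,
        ← Bicategory.whiskerLeft_comp]
      congr 2
      rw [associator_inv_naturality_right_assoc, whisker_exchange_assoc]
      simp
    rw [reassoc_of% h6, h]
    simp
  have h3' := congrArg (fun m => m ▷ (𝟙 y ≫ δ)) h3
  simp only [comp_whiskerRight] at h3'
  have h4 := congrArg (fun m => X.hom b p ◁ m) (right_triangle' adj)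
  simp only [Bicategory.whiskerLeft_comp] at h4
  have h1 : restrUnit adj p = adj.unit ≫ (ρ_ γ).inv ▷ δ ≫ (γ ≫ 𝟙 y) ◁ (λ_ δ).inv ≫
      (γ ◁ X.one p) ▷ (𝟙 y ≫ δ) ≫ (γ ≫ X.hom p p) ◁ X.one p ▷ δ := by
    simp only [restrUnit, comp_whiskerRight, Bicategory.whiskerLeft_comp, Category.assoc]
    rw [← whisker_exchange_assoc]
  rw [h1]
  simp only [Bicategory.whiskerLeft_comp, Category.assoc]
  rw [h2, associator_inv_naturality_middle_assoc, reassoc_of% h3']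
  have h5 : (X.hom b p ≫ δ) ◁ (ρ_ γ).inv ▷ δ ≫ (X.hom b p ≫ δ) ◁ (γ ≫ 𝟙 y) ◁ (λ_ δ).inv ≫
      (α_ _ _ _).inv ≫ (α_ _ _ _).hom ▷ (𝟙 y ≫ δ) ≫ (X.hom b p ◁ δ ◁ (ρ_ _).hom) ▷ (𝟙 y ≫ δ) ≫
      (X.hom b p ◁ adj.counit) ▷ (𝟙 y ≫ δ) =
      (α_ _ _ _).hom ≫ X.hom b p ◁ (α_ _ _ _).inv ≫ X.hom b p ◁ adj.counit ▷ δ ≫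
        (α_ _ _ _).inv ≫ (X.hom b p ≫ 𝟙 y) ◁ (λ_ _).inv := by
    bicategory
  rw [reassoc_of% h5, associator_naturality_right_assoc, reassoc_of% h4]
  bicategory

theorem restr_counit_right {s t r : B} (b : X.Obj s) (c : X.Obj t) (d : X.Obj r) :
    restrCounit adj p b c ▷ X.hom c d ≫ X.comp b c d = (α_ _ _ _).hom ≫
      (X.hom b p ≫ δ) ◁ ((α_ _ _ _).hom ≫ γ ◁ X.comp p c d) ≫ restrCounit adj p b d := by
  simp only [restrCounit, comp_whiskerRight, Category.assoc, X.comp_assoc, whisker_assoc,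
    Bicategory.whiskerLeft_comp, associator_naturality_right_assoc]
  have h : adj.counit ▷ X.hom p c ▷ X.hom c d ≫ (λ_ (X.hom p c)).hom ▷ X.hom c d ≫ X.comp p c d =
    (α_ _ _ _).hom ≫ (δ ≫ γ) ◁ X.comp p c d ≫ adj.counit ▷ X.hom p d ≫ (λ_ _).hom := by
    rw [whisker_exchange_assoc]
    simp
  have h' := congrArg (fun m => X.hom b p ◁ m) h
  simp only [Bicategory.whiskerLeft_comp] at h'
  simp only [Iso.inv_hom_id_assoc]
  rw [reassoc_of% h']
  simp only [Bicategory.whiskerLeft_comp, comp_whiskerLeft, Category.assoc]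
  simp only [← Category.assoc]
  congr 5
  bicategory

theorem restr_counit_left {s t r : B} (b : X.Obj s) (c : X.Obj t) (d : X.Obj r) :
    X.hom b c ◁ restrCounit adj p c d ≫ X.comp b c d = (α_ _ _ _).inv ≫
      ((α_ _ _ _).inv ≫ X.comp b c p ▷ δ) ▷ (γ ≫ X.hom p d) ≫ restrCounit adj p b d := by
  have h := X.comp_assoc' b c p d
  simp only [restrCounit, Bicategory.whiskerLeft_comp, Category.assoc, h]
  simp only [comp_whiskerRight, Category.assoc]
  rw [associator_naturality_left_assoc, ← whisker_exchange_assoc, ← whisker_exchange_assoc,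
    ← whisker_exchange_assoc]
  simp only [comp_whiskerLeft, Category.assoc, Iso.inv_hom_id_assoc]
  simp only [← Category.assoc]
  congr 5
  bicategory

variable [LocallyCocomplete.{w, v, u, max u a} B] [ClosedBicategory B]

/-- For a map `γ`, the presingleton `M(-, p) γ` is a singleton. -/
noncomputable def restrSing : X.Sing z where
  left := (PreSing.repr X p).precomp γ
  right := (PreCosing.repr X p).postcomp δ
  adj := SingAdj.ofElt p (restrUnit adj p) (fun b c => restrCounit adj p b c)
    (fun b c d => restr_counit_right adj p b c d)
    (fun b c d => restr_counit_left adj p b c d)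
    (fun b => restr_left adj p b)
    (fun b => restr_right adj p b)

end Restriction

end ECat

namespace ECat

variable {X : ECat.{w, v, u, a} B}

theorem mul_eq_of_natural {z y t : B} {γ : z ⟶ y} {p : X.Obj y} {c : X.Obj z} {b : X.Obj t}
    (ψ : γ ≫ X.hom p p ⟶ X.hom c p) (ψ' : γ ≫ X.hom p b ⟶ X.hom c b)
    (h : ((α_ γ (X.hom p p) (X.hom p b)).hom ≫ γ ◁ X.comp p p b) ≫ ψ' =
      ψ ▷ X.hom p b ≫ X.comp c p b) :
    X.mul ((ρ_ γ).inv ≫ γ ◁ X.one p ≫ ψ) (𝟙 (X.hom p b)) = ψ' := by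
  have h0 := congrArg (fun m => γ ◁ m) (X.one_comp p b)
  simp only [Bicategory.whiskerLeft_comp] at h0
  have h1 : X.mul ψ (𝟙 (X.hom p b)) = ψ ▷ X.hom p b ≫ X.comp c p b := by
    rw [mul, Bicategory.whiskerLeft_id, Category.id_comp]
  rw [comp_mul, comp_mul, h1, ← h, Category.assoc, associator_naturality_middle_assoc,
    reassoc_of% h0]
  simp

/-- An element which represents `M(-, p) γ` is a restriction. -/
noncomputable def Restr.ofIso {z y : B} {γ : z ⟶ y} {p : X.Obj y} (c : X.Obj z)
    (φ : PreSing.repr X c ≅ (PreSing.repr X p).precomp γ) : X.Restr γ p where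
  elt := c
  j := (ρ_ γ).inv ≫ γ ◁ X.one p ≫ φ.inv.app p
  isIso {t} b := by
    have hi : IsIso (φ.inv.app b) := ⟨φ.hom.app b,
      congrArg (fun m => PreSing.Hom.app m b) φ.inv_hom_id,
      congrArg (fun m => PreSing.Hom.app m b) φ.hom_inv_id⟩
    rw [mul_eq_of_natural (φ.inv.app p) (φ.inv.app b) (φ.inv.naturality p b)]
    exact hi

section

variable (X) [LocallyCocomplete.{w, v, u, max u a} B] [ClosedBicategory B]

theorem nonempty_restr (hX : X.IsComplete) {z y : B} (γ : z ⟶ y) [Bicategory.IsLeftAdjoint γ]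
    (p : X.Obj y) : Nonempty (X.Restr γ p) := by
  obtain ⟨c, ⟨φ⟩⟩ := hX (restrSing (Bicategory.Adjunction.ofIsLeftAdjoint γ) p)
  exact ⟨Restr.ofIso c φ⟩

/-- A choice of a restriction `p γ` of an element of a complete category along a map. -/
noncomputable def restr (hX : X.IsComplete) {z y : B} (γ : z ⟶ y)
    (hγ : Bicategory.IsLeftAdjoint γ) (p : X.Obj y) : X.Restr γ p :=
  (X.nonempty_restr hX γ p).some

end

end ECat

/-- The bicategory `Map(B)^coop`: its objects are those of `B`, and its hom-categories are
opposite to the full subcategories of the `B(y, x)` on the maps, that is, on the `1`-cells which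
have a right adjoint. -/
structure MapCoop (B : Type u) where
  of : B

namespace MapCoop

/-- A `1`-cell of `Map(B)^coop`: a map of `B` in the opposite direction. -/
structure Hom (x y : MapCoop B) where
  map : y.of ⟶ x.of
  isMap : Bicategory.IsLeftAdjoint map

/-- A `2`-cell of `Map(B)^coop`: a `2`-cell of `B` in the opposite direction. -/
@[ext]
structure Hom₂ {x y : MapCoop B} (f g : Hom x y) where
  cell : g.map ⟶ f.map

instance (x y : MapCoop B) : Category.{w} (Hom x y) where
  Hom f g := Hom₂ f g
  id f := ⟨𝟙 f.map⟩
  comp s t := ⟨t.cell ≫ s.cell⟩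

@[simp]
theorem id_cell {x y : MapCoop B} (f : Hom x y) : Hom₂.cell (𝟙 f) = 𝟙 f.map := rfl

@[simp]
theorem comp_cell {x y : MapCoop B} {f g h : Hom x y} (s : f ⟶ g) (t : g ⟶ h) :
    (s ≫ t).cell = t.cell ≫ s.cell := rfl

theorem isMap_id (x : B) : Bicategory.IsLeftAdjoint (𝟙 x) :=
  Bicategory.IsLeftAdjoint.mk (Bicategory.Adjunction.id x)

theorem isMap_comp {x y z : B} {f : x ⟶ y} {g : y ⟶ z} (hf : Bicategory.IsLeftAdjoint f)
    (hg : Bicategory.IsLeftAdjoint g) : Bicategory.IsLeftAdjoint (f ≫ g) :=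
  Bicategory.IsLeftAdjoint.mk ((Bicategory.Adjunction.ofIsLeftAdjoint f).comp
    (Bicategory.Adjunction.ofIsLeftAdjoint g))

/-- An invertible `2`-cell of `B` between maps gives one in `Map(B)^coop`. -/
@[simps]
def isoMk {x y : MapCoop B} {f g : Hom x y} (e : g.map ≅ f.map) : f ≅ g where
  hom := ⟨e.hom⟩
  inv := ⟨e.inv⟩
  hom_inv_id := Hom₂.ext e.inv_hom_id
  inv_hom_id := Hom₂.ext e.hom_inv_id

theorem hom₂_ext {x y : MapCoop B} {f g : Hom x y} {s t : f ⟶ g} (h : s.cell = t.cell) : s = t :=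
  Hom₂.ext h

instance : Bicategory.{w, v} (MapCoop B) where
  Hom x y := Hom x y
  id x := ⟨𝟙 x.of, isMap_id x.of⟩
  comp f g := ⟨g.map ≫ f.map, isMap_comp g.isMap f.isMap⟩
  homCategory x y := inferInstanceAs (Category (Hom x y))
  whiskerLeft f _ _ η := ⟨η.cell ▷ f.map⟩
  whiskerRight η h := ⟨h.map ◁ η.cell⟩
  associator f g h := isoMk (α_ h.map g.map f.map)
  leftUnitor f := isoMk (ρ_ f.map).symm
  rightUnitor f := isoMk (λ_ f.map).symm
  whiskerLeft_id f g := Hom₂.ext (id_whiskerRight g.map f.map)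
  whiskerLeft_comp f _ _ _ η θ := Hom₂.ext (comp_whiskerRight θ.cell η.cell f.map)
  id_whiskerLeft {_ _ f g} η := Hom₂.ext (show η.cell ▷ 𝟙 _ =
    ((ρ_ g.map).hom ≫ η.cell) ≫ (ρ_ f.map).inv by simp)
  comp_whiskerLeft f g h h' η := Hom₂.ext (show η.cell ▷ (g.map ≫ f.map) =
    ((α_ _ _ _).inv ≫ η.cell ▷ g.map ▷ f.map) ≫ (α_ _ _ _).hom by simp)
  id_whiskerRight f g := Hom₂.ext (Bicategory.whiskerLeft_id g.map f.map)
  comp_whiskerRight η θ h := Hom₂.ext (Bicategory.whiskerLeft_comp h.map θ.cell η.cell)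
  whiskerRight_id {_ _ f g} η := Hom₂.ext (show 𝟙 _ ◁ η.cell =
    ((λ_ g.map).hom ≫ η.cell) ≫ (λ_ f.map).inv by simp)
  whiskerRight_comp {_ _ _ _ f f'} η g h := Hom₂.ext (show (h.map ≫ g.map) ◁ η.cell =
    ((α_ _ _ _).hom ≫ h.map ◁ g.map ◁ η.cell) ≫ (α_ _ _ _).inv by simp)
  whisker_assoc f g g' η h := Hom₂.ext (show h.map ◁ η.cell ▷ f.map =
    ((α_ _ _ _).inv ≫ (h.map ◁ η.cell) ▷ f.map) ≫ (α_ _ _ _).hom by simp)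
  whisker_exchange {_ _ _ f g h i} η θ := Hom₂.ext (show i.map ◁ η.cell ≫ θ.cell ▷ f.map =
    θ.cell ▷ g.map ≫ h.map ◁ η.cell from Bicategory.whisker_exchange θ.cell η.cell)
  pentagon f g h i := Hom₂.ext (show ((α_ i.map h.map g.map).hom ▷ f.map ≫
      (α_ i.map (h.map ≫ g.map) f.map).hom) ≫ i.map ◁ (α_ h.map g.map f.map).hom =
    (α_ (i.map ≫ h.map) g.map f.map).hom ≫ (α_ i.map h.map (g.map ≫ f.map)).hom by
      rw [Category.assoc, Bicategory.pentagon])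
  triangle f g := Hom₂.ext (show (ρ_ g.map).inv ▷ f.map ≫ (α_ g.map (𝟙 _) f.map).hom =
    g.map ◁ (λ_ f.map).inv by simp)

end MapCoop

namespace ECat

variable {X : ECat.{w, v, u, a} B}

/-- Two restrictions of an element along the same `1`-cell are isomorphic. -/
@[simps]
noncomputable def Restr.iso {z y : B} {γ : z ⟶ y} {p : X.Obj y} (R R' : X.Restr γ p) :
    Fib.mk R.elt ≅ Fib.mk R'.elt where
  hom := R.map R' (𝟙 γ) (𝟙 _)
  inv := R'.map R (𝟙 γ) (𝟙 _)
  hom_inv_id := by rw [map_comp, Category.id_comp, Category.id_comp, map_id]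
  inv_hom_id := by rw [map_comp, Category.id_comp, Category.id_comp, map_id]

theorem Restr.eq_map_id {y : B} {p q : X.Obj y} (s : Fib.mk p ⟶ Fib.mk q) :
    s = (Restr.id p).map (Restr.id q) (𝟙 (𝟙 y)) s := by
  refine Restr.eq_map (Restr.id p) (Restr.id q) (𝟙 (𝟙 y)) s s ?_
  change X.mul s.cell (X.one q) = (λ_ (𝟙 y)).hom ≫ 𝟙 (𝟙 y) ≫ (ρ_ (𝟙 y)).inv ≫ X.mul (X.one p) s.cell
  rw [mul_one, one_mul, Category.id_comp]
  have h : (λ_ (𝟙 y)).hom ≫ (ρ_ (𝟙 y)).inv ≫ (λ_ (𝟙 y)).hom = (ρ_ (𝟙 y)).hom := by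
    bicategory
  rw [reassoc_of% h]

theorem Restr.map_comp_left {t z y : B} {γ : z ⟶ y} {δ δ' : t ⟶ z} {p : X.Obj y}
    (R : X.Restr γ p) (S : X.Restr δ R.elt) (S' : X.Restr δ' R.elt) (β : δ' ⟶ δ) :
    S.map S' β (𝟙 _) = (R.comp S).map (R.comp S') (β ▷ γ) (𝟙 _) := by
  rw [← Restr.map_id, map_comp_comp, Bicategory.whiskerLeft_id, Category.comp_id]

theorem Restr.map_comp_right {t z y : B} {γ γ' : z ⟶ y} {δ : t ⟶ z} {p p' : X.Obj y}
    (R : X.Restr γ p) (R' : X.Restr γ' p') (S : X.Restr δ R.elt) (S' : X.Restr δ R'.elt)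
    (α : γ' ⟶ γ) (s : Fib.mk p ⟶ Fib.mk p') :
    S.map S' (𝟙 δ) (R.map R' α s) = (R.comp S).map (R'.comp S') (δ ◁ α) s := by
  rw [map_comp_comp, Bicategory.id_whiskerRight, Category.id_comp]

section Coherence

variable {s t z y : B} {γ γ' : z ⟶ y} {δ δ' : t ⟶ z} {κ : s ⟶ t} {p q : X.Obj y}

theorem Restr.coh_id (R : X.Restr (𝟙 y) p) (R' : X.Restr (𝟙 y) q) (k : Fib.mk p ⟶ Fib.mk q) :
    R.map R' (𝟙 _) k ≫ R'.map (Restr.id q) (𝟙 _) (𝟙 _) =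
      R.map (Restr.id p) (𝟙 _) (𝟙 _) ≫ k := by
  conv_rhs => rw [Restr.eq_map_id k]
  rw [Restr.map_comp, Restr.map_comp, Category.id_comp, Category.comp_id, Category.id_comp]

theorem Restr.coh_comp (R : X.Restr γ p) (R' : X.Restr γ q) (S : X.Restr δ R.elt)
    (S' : X.Restr δ R'.elt) (T : X.Restr (δ ≫ γ) p) (T' : X.Restr (δ ≫ γ) q)
    (k : Fib.mk p ⟶ Fib.mk q) :
    T.map T' (𝟙 _) k ≫ T'.map (R'.comp S') (𝟙 _) (𝟙 _) =
      T.map (R.comp S) (𝟙 _) (𝟙 _) ≫ S.map S' (𝟙 δ) (R.map R' (𝟙 γ) k) := by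
  rw [Restr.map_comp_right, Restr.map_comp, Restr.map_comp]
  simp

theorem Restr.coh_whiskerLeft (R : X.Restr γ p) (S : X.Restr δ R.elt) (S' : X.Restr δ' R.elt)
    (T : X.Restr (δ ≫ γ) p) (T' : X.Restr (δ' ≫ γ) p) (β : δ' ⟶ δ) :
    T.map T' (β ▷ γ) (𝟙 _) = T.map (R.comp S) (𝟙 _) (𝟙 _) ≫ S.map S' β (𝟙 _) ≫
      (R.comp S').map T' (𝟙 _) (𝟙 _) := by
  rw [Restr.map_comp_left, Restr.map_comp, Restr.map_comp]
  simp

theorem Restr.coh_whiskerRight (R : X.Restr γ p) (R' : X.Restr γ' p) (S : X.Restr δ R.elt)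
    (S' : X.Restr δ R'.elt) (T : X.Restr (δ ≫ γ) p) (T' : X.Restr (δ ≫ γ') p) (α : γ' ⟶ γ) :
    T.map T' (δ ◁ α) (𝟙 _) = T.map (R.comp S) (𝟙 _) (𝟙 _) ≫
      S.map S' (𝟙 δ) (R.map R' α (𝟙 _)) ≫ (R'.comp S').map T' (𝟙 _) (𝟙 _) := by
  rw [Restr.map_comp_right, Restr.map_comp, Restr.map_comp]
  simp

theorem Restr.coh_assoc (R : X.Restr γ p) (S : X.Restr δ R.elt) (T : X.Restr κ S.elt)
    (U : X.Restr (δ ≫ γ) p) (V : X.Restr κ U.elt) (W : X.Restr (κ ≫ δ) R.elt)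
    (M : X.Restr (κ ≫ δ ≫ γ) p) (N : X.Restr ((κ ≫ δ) ≫ γ) p) :
    M.map N (α_ κ δ γ).hom (𝟙 _) =
      M.map (U.comp V) (𝟙 _) (𝟙 _) ≫ V.map T (𝟙 κ) (U.map (R.comp S) (𝟙 _) (𝟙 _)) ≫
        𝟙 (Fib.mk T.elt) ≫ (S.comp T).map W (𝟙 _) (𝟙 _) ≫ (R.comp W).map N (𝟙 _) (𝟙 _) := by
  have h1 : V.map T (𝟙 κ) (U.map (R.comp S) (𝟙 _) (𝟙 _)) =
    (U.comp V).map ((R.comp S).comp T) (κ ◁ 𝟙 _) (𝟙 _) := Restr.map_comp_right U (R.comp S) V T _ _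
  rw [h1, Restr.map_comp_left R (S.comp T) W, ← Restr.map_assoc R S T, Restr.map_comp,
    Restr.map_comp, Restr.map_comp, Restr.map_comp]
  simp

theorem Restr.coh_left (I : X.Restr (𝟙 y) p) (R : X.Restr γ p) (S : X.Restr γ I.elt)
    (T : X.Restr (γ ≫ 𝟙 y) p) :
    T.map R (ρ_ γ).inv (𝟙 _) = T.map (I.comp S) (𝟙 _) (𝟙 _) ≫
      S.map R (𝟙 γ) (I.map (Restr.id p) (𝟙 _) (𝟙 _)) ≫ 𝟙 (Fib.mk R.elt) := by
  have h1 : S.map R (𝟙 γ) (I.map (Restr.id p) (𝟙 _) (𝟙 _)) =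
    (I.comp S).map ((Restr.id p).comp R) (γ ◁ 𝟙 _) (𝟙 _) :=
      Restr.map_comp_right I (Restr.id p) S R _ _
  rw [h1, ← Restr.map_id_comp R, Restr.map_comp, Restr.map_comp]
  simp

theorem Restr.coh_right (R : X.Restr γ p) (I : X.Restr (𝟙 z) R.elt) (T : X.Restr (𝟙 z ≫ γ) p) :
    T.map R (λ_ γ).inv (𝟙 _) = T.map (R.comp I) (𝟙 _) (𝟙 _) ≫
      I.map (Restr.id R.elt) (𝟙 _) (𝟙 _) ≫ 𝟙 (Fib.mk R.elt) := by
  rw [Restr.map_comp_left R I (Restr.id R.elt), ← Restr.map_comp_id R, Restr.map_comp,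
    Restr.map_comp]
  simp

end Coherence

variable (X) [LocallyCocomplete.{w, v, u, max u a} B] [ClosedBicategory B]

variable (hX : X.IsComplete)

/-- The functor `p ↦ p γ` between the fibres of a complete category. -/
noncomputable def restrFunctor {z y : B} (γ : z ⟶ y) (hγ : Bicategory.IsLeftAdjoint γ) :
    X.Fib y ⥤ X.Fib z where
  obj p := ⟨(X.restr hX γ hγ p.elt).elt⟩
  map {p q} s := (X.restr hX γ hγ p.elt).map (X.restr hX γ hγ q.elt) (𝟙 γ) s
  map_id p := Restr.map_id _
  map_comp s t := by rw [Restr.map_comp, Category.id_comp]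

/-- The pseudofunctor `P : Map(B)^coop ⟶ Cat` of a complete category `X`: it sends `x` to the fibre
of `X` over `x`, and a map `γ` to the functor `p ↦ p γ`, where `p γ` represents `M(-, p) γ`. -/
noncomputable def P : Pseudofunctor (MapCoop B) Cat.{w, a} where
  obj x := Cat.of (X.Fib x.of)
  map f := (X.restrFunctor hX f.map f.isMap).toCatHom
  map₂ {x y f g} η := NatTrans.toCatHom₂
    { app := fun p => (X.restr hX f.map f.isMap p.elt).map (X.restr hX g.map g.isMap p.elt)
        η.cell (𝟙 _)
      naturality := fun p q s => by
        change Restr.map _ _ (𝟙 f.map) s ≫ Restr.map _ _ η.cell (𝟙 _) =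
          Restr.map _ _ η.cell (𝟙 _) ≫ Restr.map _ _ (𝟙 g.map) s
        rw [Restr.map_comp, Restr.map_comp]
        simp }
  map₂_id f := Cat.Hom₂.ext (NatTrans.ext (funext fun p => Restr.map_id _))
  map₂_comp η θ := Cat.Hom₂.ext (NatTrans.ext (funext fun p => by
    change Restr.map _ _ (θ.cell ≫ η.cell) _ = Restr.map _ _ η.cell _ ≫ Restr.map _ _ θ.cell _
    rw [Restr.map_comp, Category.id_comp]))
  mapId x := Cat.Hom.isoMk (NatIso.ofComponents
    (fun p => (X.restr hX (𝟙 x.of) (MapCoop.isMap_id x.of) p.elt).iso (Restr.id p.elt))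
    (fun {_ _} s => Restr.coh_id _ _ s))
  mapComp f g := Cat.Hom.isoMk (NatIso.ofComponents
    (fun p => (X.restr hX (g.map ≫ f.map) (MapCoop.isMap_comp g.isMap f.isMap) p.elt).iso
      ((X.restr hX f.map f.isMap p.elt).comp (X.restr hX g.map g.isMap _)))
    (fun {_ _} s => Restr.coh_comp _ _ _ _ _ _ s))
  map₂_whisker_left f _ _ η := Cat.Hom₂.ext (NatTrans.ext (funext fun _ =>
    Restr.coh_whiskerLeft _ _ _ _ _ η.cell))
  map₂_whisker_right η h := Cat.Hom₂.ext (NatTrans.ext (funext fun _ =>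
    Restr.coh_whiskerRight _ _ _ _ _ _ η.cell))
  map₂_associator f g h := Cat.Hom₂.ext (NatTrans.ext (funext fun p =>
    Restr.coh_assoc (X.restr hX f.map f.isMap p.elt) (X.restr hX g.map g.isMap _)
      (X.restr hX h.map h.isMap _) (X.restr hX (g.map ≫ f.map) _ p.elt) _
      (X.restr hX (h.map ≫ g.map) _ _) _ _))
  map₂_left_unitor f := Cat.Hom₂.ext (NatTrans.ext (funext fun _ => Restr.coh_left _ _ _ _))
  map₂_right_unitor f := Cat.Hom₂.ext (NatTrans.ext (funext fun _ => Restr.coh_right _ _ _))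

end ECat

section Grothendieck

variable (F : Pseudofunctor (MapCoop B) Cat.{w₁, a})

/-- An index of the colimit which defines the `1`-cell `(p, q)` of the Grothendieck construction:
a map `f : x ⟶ y` together with an arrow `p ⟶ F(f)(q)`. -/
structure GrothIdx {x y : B} (p : F.obj ⟨x⟩) (q : F.obj ⟨y⟩) where
  map : MapCoop.mk y ⟶ MapCoop.mk x
  arrow : p ⟶ (F.map map).toFunctor.obj q

namespace GrothIdx

variable {F} {x y z t : B} {p : F.obj ⟨x⟩} {q : F.obj ⟨y⟩} {r : F.obj ⟨z⟩} {o : F.obj ⟨t⟩}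

/-- An arrow of indices: a `2`-cell of maps which is compatible with the arrows. -/
@[ext]
structure Hom (i j : GrothIdx F p q) where
  cell : j.map ⟶ i.map
  fac : j.arrow ≫ (F.map₂ cell).toNatTrans.app q = i.arrow

instance : Category (GrothIdx F p q) where
  Hom i j := Hom i j
  id i := ⟨𝟙 _, by simp⟩
  comp s t := ⟨t.cell ≫ s.cell, by simp [reassoc_of% t.fac, s.fac]⟩

variable (p q) in
/-- The diagram of the maps of the indices. -/
@[simps]
def diag : GrothIdx F p q ⥤ (x ⟶ y) where
  obj i := i.map.map
  map s := s.cell.cell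

/-- The index of the identity. -/
def id (p : F.obj ⟨x⟩) : GrothIdx F p p where
  map := 𝟙 _
  arrow := (F.mapId _).inv.toNatTrans.app p

/-- The composite of two indices. -/
def comp (i : GrothIdx F p q) (j : GrothIdx F q r) : GrothIdx F p r where
  map := j.map ≫ i.map
  arrow := i.arrow ≫ (F.map i.map).toFunctor.map j.arrow ≫
    (F.mapComp j.map i.map).inv.toNatTrans.app r

def compMapLeft {i i' : GrothIdx F p q} (s : i ⟶ i') (j : GrothIdx F q r) :
    comp i j ⟶ comp i' j where
  cell := j.map ◁ s.cell
  fac := by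
    simp [comp, ← s.fac]

def compMapRight (i : GrothIdx F p q) {j j' : GrothIdx F q r} (s : j ⟶ j') :
    comp i j ⟶ comp i j' where
  cell := s.cell ▷ i.map
  fac := by
    simp [comp, ← s.fac]

def idComp (j : GrothIdx F p q) : comp (id p) j ⟶ j where
  cell := (ρ_ j.map).inv
  fac := by
    have h0 : F.map₂ (ρ_ j.map).inv = (ρ_ _).inv ≫ F.map j.map ◁ (F.mapId _).inv ≫
        (F.mapComp j.map (𝟙 _)).inv := by
      rw [← cancel_epi (F.map₂ (ρ_ j.map).hom), ← F.map₂_comp, Iso.hom_inv_id, F.map₂_id,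
        F.map₂_right_unitor]
      simp
    have h1 := congrArg (fun m : F.map j.map ⟶ F.map (j.map ≫ 𝟙 _) => m.toNatTrans.app q) h0
    have h2 := (F.mapId ⟨x⟩).inv.toNatTrans.naturality j.arrow
    simp at h1 h2
    simp [comp, id, h1, reassoc_of% h2]

def compId (j : GrothIdx F p q) : comp j (id q) ⟶ j where
  cell := (λ_ j.map).inv
  fac := by
    have h0 : F.map₂ (λ_ j.map).inv = (λ_ _).inv ≫ (F.mapId _).inv ▷ F.map j.map ≫
        (F.mapComp (𝟙 _) j.map).inv := by
      rw [← cancel_epi (F.map₂ (λ_ j.map).hom), ← F.map₂_comp, Iso.hom_inv_id, F.map₂_id,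
        F.map₂_left_unitor]
      simp
    have h1 := congrArg (fun m : F.map j.map ⟶ F.map (𝟙 _ ≫ j.map) => m.toNatTrans.app q) h0
    simp at h1
    simp [comp, id, h1]

def assoc (i : GrothIdx F p q) (j : GrothIdx F q r) (k : GrothIdx F r o) :
    comp (comp i j) k ⟶ comp i (comp j k) where
  cell := (α_ _ _ _).hom
  fac := by
    have h1 := (F.mapComp j.map i.map).inv.toNatTrans.naturality k.arrow
    have h2 : (F.map i.map).toFunctor.map ((F.mapComp k.map j.map).inv.toNatTrans.app o) ≫
        (F.map i.map).toFunctor.map ((F.mapComp k.map j.map).hom.toNatTrans.app o) = 𝟙 _ := by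
      rw [← Functor.map_comp]
      simp
    simp at h1
    simp [comp, reassoc_of% h1, reassoc_of% h2]

end GrothIdx

end Grothendieck

section Groth

variable (F : Pseudofunctor (MapCoop B) Cat.{w₁, a})

/-- The colimits which define the Grothendieck construction of `F` exist. -/
class HasGroth : Prop where
  hasColimit : ∀ {x y : B} (p : F.obj ⟨x⟩) (q : F.obj ⟨y⟩), HasColimit (GrothIdx.diag p q)

attribute [instance] HasGroth.hasColimit

variable [HasGroth F]

/-- The `1`-cells of the Grothendieck construction: the colimit of the maps `f` over all pairs
`(f, u : p ⟶ F(f)(q))`. -/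
noncomputable def grothHom {x y : B} (p : F.obj ⟨x⟩) (q : F.obj ⟨y⟩) : x ⟶ y :=
  colimit (GrothIdx.diag p q)

noncomputable def grothι {x y : B} {p : F.obj ⟨x⟩} {q : F.obj ⟨y⟩} (i : GrothIdx F p q) :
    i.map.map ⟶ grothHom F p q :=
  colimit.ι (GrothIdx.diag p q) i

/-- The leg at the composite of two indices. -/
noncomputable def grothι₂ {x y z : B} {p : F.obj ⟨x⟩} {q : F.obj ⟨y⟩} {r : F.obj ⟨z⟩}
    (i : GrothIdx F p q) (j : GrothIdx F q r) : i.map.map ≫ j.map.map ⟶ grothHom F p r :=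
  grothι F (i.comp j)

theorem grothι_w {x y : B} {p : F.obj ⟨x⟩} {q : F.obj ⟨y⟩} {i j : GrothIdx F p q} (s : i ⟶ j) :
    s.cell.cell ≫ grothι F j = grothι F i :=
  colimit.w (GrothIdx.diag p q) s

variable [ClosedBicategory B]

variable {F} in
theorem groth_ext {x y : B} {p : F.obj ⟨x⟩} {q : F.obj ⟨y⟩} {d : x ⟶ y}
    {s t : grothHom F p q ⟶ d}
    (h : ∀ i : GrothIdx F p q, grothι F i ≫ s = grothι F i ≫ t) : s = t :=
  colimit.hom_ext h

variable {F} in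
theorem groth_ext_right {x y z : B} {p : F.obj ⟨x⟩} {q : F.obj ⟨y⟩} {g : y ⟶ z} {d : x ⟶ z}
    {s t : grothHom F p q ≫ g ⟶ d}
    (h : ∀ i : GrothIdx F p q, grothι F i ▷ g ≫ s = grothι F i ▷ g ≫ t) : s = t :=
  col_hom_ext (Bicategory.postcomp x g) (GrothIdx.diag p q) h

variable {F} in
theorem groth_ext_left {x y z : B} {p : F.obj ⟨y⟩} {q : F.obj ⟨z⟩} {g : x ⟶ y} {d : x ⟶ z}
    {s t : g ≫ grothHom F p q ⟶ d}
    (h : ∀ i : GrothIdx F p q, g ◁ grothι F i ≫ s = g ◁ grothι F i ≫ t) : s = t :=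
  col_hom_ext (Bicategory.precomp z g) (GrothIdx.diag p q) h

variable {x y z t : B} (p : F.obj ⟨x⟩) (q : F.obj ⟨y⟩) (r : F.obj ⟨z⟩) (o : F.obj ⟨t⟩)

theorem grothCompAux_w (i : GrothIdx F p q) {j j' : GrothIdx F q r} (s : j ⟶ j') :
    i.map.map ◁ s.cell.cell ≫ grothι F (i.comp j') = grothι F (i.comp j) :=
  grothι_w F (i.compMapRight s)

noncomputable def grothCompAux (i : GrothIdx F p q) :
    i.map.map ≫ grothHom F q r ⟶ grothHom F p r :=
  colDesc (Bicategory.precomp z i.map.map) (GrothIdx.diag q r) (fun j => grothι F (i.comp j))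
    (fun _ _ s => grothCompAux_w F p q r i s)

theorem ι_grothCompAux (i : GrothIdx F p q) (j : GrothIdx F q r) :
    i.map.map ◁ grothι F j ≫ grothCompAux F p q r i = grothι F (i.comp j) :=
  colDesc_fac (Bicategory.precomp z i.map.map) (GrothIdx.diag q r) _
    (fun _ _ s => grothCompAux_w F p q r i s) j

theorem grothComp_w {i i' : GrothIdx F p q} (s : i ⟶ i') :
    s.cell.cell ▷ grothHom F q r ≫ grothCompAux F p q r i' = grothCompAux F p q r i := by
  apply groth_ext_left
  intro j
  rw [whisker_exchange_assoc, ι_grothCompAux, ι_grothCompAux]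
  exact grothι_w F (GrothIdx.compMapLeft s j)

/-- The composition of the Grothendieck construction. -/
noncomputable def grothComp : grothHom F p q ≫ grothHom F q r ⟶ grothHom F p r :=
  colDesc (Bicategory.postcomp x (grothHom F q r)) (GrothIdx.diag p q)
    (fun i => grothCompAux F p q r i) (fun _ _ s => grothComp_w F p q r s)

theorem ι_grothComp (i : GrothIdx F p q) :
    grothι F i ▷ grothHom F q r ≫ grothComp F p q r = grothCompAux F p q r i :=
  colDesc_fac (Bicategory.postcomp x (grothHom F q r)) (GrothIdx.diag p q)
    (fun i => grothCompAux F p q r i) (fun _ _ s => grothComp_w F p q r s) i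

theorem ι_ι_grothComp (i : GrothIdx F p q) (j : GrothIdx F q r) :
    grothι F i ▷ j.map.map ≫ grothHom F p q ◁ grothι F j ≫ grothComp F p q r =
      grothι₂ F i j := by
  rw [← whisker_exchange_assoc, ι_grothComp, ι_grothCompAux, grothι₂]

variable {F p q r} in
theorem groth_ext₂ {d : x ⟶ z} {s t : grothHom F p q ≫ grothHom F q r ⟶ d}
    (h : ∀ (i : GrothIdx F p q) (j : GrothIdx F q r),
      grothι F i ▷ j.map.map ≫ grothHom F p q ◁ grothι F j ≫ s =
        grothι F i ▷ j.map.map ≫ grothHom F p q ◁ grothι F j ≫ t) : s = t := by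
  apply groth_ext_right
  intro i
  apply groth_ext_left
  intro j
  simp only [whisker_exchange_assoc]
  exact h i j

variable {F p q r o} in
theorem groth_ext₃ {d : x ⟶ t}
    {s t : (grothHom F p q ≫ grothHom F q r) ≫ grothHom F r o ⟶ d}
    (h : ∀ (i : GrothIdx F p q) (j : GrothIdx F q r) (k : GrothIdx F r o),
      (grothι F i ▷ j.map.map ≫ grothHom F p q ◁ grothι F j) ▷ k.map.map ≫
        (grothHom F p q ≫ grothHom F q r) ◁ grothι F k ≫ s =
      (grothι F i ▷ j.map.map ≫ grothHom F p q ◁ grothι F j) ▷ k.map.map ≫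
        (grothHom F p q ≫ grothHom F q r) ◁ grothι F k ≫ t) : s = t := by
  apply col_hom_ext (Bicategory.postcomp x (grothHom F q r) ⋙
    Bicategory.postcomp x (grothHom F r o)) (GrothIdx.diag p q)
  intro i
  apply col_hom_ext (Bicategory.precomp z i.map.map ⋙
    Bicategory.postcomp x (grothHom F r o)) (GrothIdx.diag q r)
  intro j
  apply col_hom_ext (Bicategory.precomp _ (i.map.map ≫ j.map.map)) (GrothIdx.diag r o)
  intro k
  change (i.map.map ≫ j.map.map) ◁ grothι F k ≫ (i.map.map ◁ grothι F j) ▷ grothHom F r o ≫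
    grothι F i ▷ grothHom F q r ▷ grothHom F r o ≫ s =
    (i.map.map ≫ j.map.map) ◁ grothι F k ≫ (i.map.map ◁ grothι F j) ▷ grothHom F r o ≫
    grothι F i ▷ grothHom F q r ▷ grothHom F r o ≫ t
  have h' := h i j k
  simp only [whisker_exchange_assoc] at h' ⊢
  rw [← comp_whiskerRight_assoc, ← comp_whiskerRight_assoc, whisker_exchange]
  exact h'

/-- The unit of the Grothendieck construction. -/
noncomputable def grothOne : 𝟙 x ⟶ grothHom F p p := grothι F (GrothIdx.id p)

theorem groth_one_comp : grothOne F p ▷ grothHom F p q ≫ grothComp F p p q = (λ_ _).hom := by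
  apply groth_ext_left
  intro j
  rw [whisker_exchange_assoc]
  have h := ι_ι_grothComp F p p q (GrothIdx.id p) j
  refine h.trans ?_
  refine (grothι_w F (GrothIdx.idComp j)).symm.trans ?_
  exact (leftUnitor_naturality (grothι F j)).symm

theorem groth_comp_one : grothHom F p q ◁ grothOne F q ≫ grothComp F p q q = (ρ_ _).hom := by
  apply groth_ext_right
  intro j
  have h := ι_ι_grothComp F p q q j (GrothIdx.id q)
  refine h.trans ?_
  refine (grothι_w F (GrothIdx.compId j)).symm.trans ?_
  exact (rightUnitor_naturality (grothι F j)).symm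

theorem groth_comp_assoc :
    grothComp F p q r ▷ grothHom F r o ≫ grothComp F p r o =
      (α_ _ _ _).hom ≫ grothHom F p q ◁ grothComp F q r o ≫ grothComp F p q o := by
  apply groth_ext₃
  intro i j k
  have h1 : (grothι₂ F i j) ▷ k.map.map ≫ grothHom F p r ◁ grothι F k ≫ grothComp F p r o =
    grothι F ((i.comp j).comp k) := ι_ι_grothComp F p r o (i.comp j) k
  have h2 : grothι F i ▷ (j.map.map ≫ k.map.map) ≫ grothHom F p q ◁ grothι₂ F j k ≫
    grothComp F p q o = grothι F (i.comp (j.comp k)) := ι_ι_grothComp F p q o i (j.comp k)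
  have h3 : (α_ i.map.map j.map.map k.map.map).hom ≫ grothι F (i.comp (j.comp k)) =
    grothι F ((i.comp j).comp k) := grothι_w F (GrothIdx.assoc i j k)
  have h4 : (grothι F i ▷ j.map.map ≫ grothHom F p q ◁ grothι F j ≫ grothComp F p q r) ▷
    k.map.map = grothι₂ F i j ▷ k.map.map :=
      congrArg (fun m => m ▷ k.map.map) (ι_ι_grothComp F p q r i j)
  have h5 : grothHom F p q ◁ (grothι F j ▷ k.map.map ≫ grothHom F q r ◁ grothι F k ≫
    grothComp F q r o) = grothHom F p q ◁ grothι₂ F j k :=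
      congrArg (fun m => grothHom F p q ◁ m) (ι_ι_grothComp F q r o j k)
  rw [← h3, ← h2] at h1
  simp only [comp_whiskerRight, Bicategory.whiskerLeft_comp, Category.assoc] at h4 h5 ⊢
  rw [whisker_exchange_assoc, reassoc_of% h4]
  refine h1.trans ?_
  rw [← h5]
  simp

/-- The Grothendieck construction `Σ F`: the `B`-category whose elements of type `x` are the
objects of `F(x)`. -/
noncomputable def groth : ECat.{w, v, u, a} B where
  Obj x := F.obj ⟨x⟩
  hom p q := grothHom F p q
  one p := grothOne F p
  comp p q r := grothComp F p q r
  one_comp p q := groth_one_comp F p q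
  comp_one p q := groth_comp_one F p q
  comp_assoc p q r o := groth_comp_assoc F p q r o

end Groth

namespace ECat

variable {X : ECat.{w, v, u, a} B}

namespace Restr

/-- The `2`-cell `γ ⟶ M(q, p)` which corresponds to an arrow `p ⟶ q γ`. -/
def leg {z y : B} {γ : z ⟶ y} {p : X.Obj z} {q : X.Obj y} (R : X.Restr γ q)
    (s : Fib.mk p ⟶ Fib.mk R.elt) : γ ⟶ X.hom p q :=
  (λ_ γ).inv ≫ X.mul s.cell R.j

section

variable {z y : B} {γ γ' : z ⟶ y} {p : X.Obj z} {q q' : X.Obj y}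

theorem leg_comp_map (R : X.Restr γ q) (R' : X.Restr γ' q') (s : Fib.mk p ⟶ Fib.mk R.elt)
    (α : γ' ⟶ γ) (k : Fib.mk q ⟶ Fib.mk q') :
    R'.leg (s ≫ R.map R' α k) = α ≫ (ρ_ γ).inv ≫ X.mul (R.leg s) k.cell := by
  rw [leg, leg, fib_comp_cell, comp_mul, comp_mul, mul_assoc, map_j, mul_comp, mul_comp, mul_comp,
    mul_assoc']
  simp

theorem leg_comp_map_id (R : X.Restr γ q) (R' : X.Restr γ' q) (s : Fib.mk p ⟶ Fib.mk R.elt)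
    (α : γ' ⟶ γ) : R'.leg (s ≫ R.map R' α (𝟙 _)) = α ≫ R.leg s := by
  rw [leg_comp_map, fib_id_cell, mul_one]
  simp

end

theorem leg_id {z : B} {p : X.Obj z} (R : X.Restr (𝟙 z) p) :
    R.leg ((Restr.id p).map R (𝟙 _) (𝟙 _)) = X.one p := by
  rw [← Category.id_comp (Restr.map _ _ _ _), leg_comp_map_id, leg, fib_id_cell, one_mul]
  simp

theorem leg_comp {t z y : B} {γ : z ⟶ y} {δ : t ⟶ z} {p : X.Obj t} {q : X.Obj z} {r : X.Obj y}
    (R : X.Restr γ r) (S : X.Restr δ q) (V : X.Restr δ R.elt) (T : X.Restr (δ ≫ γ) r)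
    (s : Fib.mk p ⟶ Fib.mk S.elt) (k : Fib.mk q ⟶ Fib.mk R.elt) :
    T.leg (s ≫ S.map V (𝟙 δ) k ≫ (R.comp V).map T (𝟙 _) (𝟙 _)) = X.mul (S.leg s) (R.leg k) := by
  have h1 : T.leg ((s ≫ S.map V (𝟙 δ) k) ≫ (R.comp V).map T (𝟙 _) (𝟙 _)) =
      𝟙 _ ≫ (R.comp V).leg (s ≫ S.map V (𝟙 δ) k) := leg_comp_map_id (R.comp V) T _ _
  have h2 := leg_comp_map S V s (𝟙 δ) k
  have h3 : (R.comp V).leg (s ≫ S.map V (𝟙 δ) k) =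
      X.mul (V.leg (s ≫ S.map V (𝟙 δ) k)) R.j := by
    rw [leg, leg, comp_mul, mul_assoc]
    simp
  have h4 : R.leg k = (λ_ γ).inv ≫ X.mul k.cell R.j := rfl
  rw [Category.assoc] at h1
  rw [h1, h3, h2, Category.id_comp, Category.id_comp, comp_mul, mul_assoc, h4, mul_comp]
  simp

end Restr

variable (X) [LocallyCocomplete.{w, v, u, max u a} B] [ClosedBicategory B]

variable (hX : X.IsComplete)

/-- The canonical `2`-cell `f ⟶ M(q, p)` of an index `(f, p ⟶ P(f)(q))`: it is the composite of
`p ⟶ q f` with the universal `2`-cell of `q f`. -/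
noncomputable def canonicalLeg {x y : B} {p : (X.P hX).obj ⟨x⟩} {q : (X.P hX).obj ⟨y⟩}
    (i : GrothIdx (X.P hX) p q) : i.map.map ⟶ X.hom (Fib.elt p) (Fib.elt q) :=
  (X.restr hX i.map.map i.map.isMap (Fib.elt q)).leg i.arrow

theorem canonicalLeg_w {x y : B} {p : (X.P hX).obj ⟨x⟩} {q : (X.P hX).obj ⟨y⟩}
    {i j : GrothIdx (X.P hX) p q} (s : i ⟶ j) :
    s.cell.cell ≫ X.canonicalLeg hX j = X.canonicalLeg hX i := by
  have h := Restr.leg_comp_map_id (X.restr hX j.map.map j.map.isMap (Fib.elt q))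
    (X.restr hX i.map.map i.map.isMap (Fib.elt q)) j.arrow s.cell.cell
  refine h.symm.trans ?_
  exact congrArg _ s.fac

variable [HasGroth (X.P hX)]

/-- The canonical `2`-cells `Σ P X (p, q) ⟶ X (p, q)`. -/
noncomputable def canonicalMap {x y : B} (p : (X.P hX).obj ⟨x⟩) (q : (X.P hX).obj ⟨y⟩) :
    grothHom (X.P hX) p q ⟶ X.hom (Fib.elt p) (Fib.elt q) :=
  colimit.desc (GrothIdx.diag p q) ⟨_,
    { app := fun i => X.canonicalLeg hX i
      naturality := fun _ _ s => (X.canonicalLeg_w hX s).trans (Category.comp_id _).symm }⟩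

theorem ι_canonicalMap {x y : B} {p : (X.P hX).obj ⟨x⟩} {q : (X.P hX).obj ⟨y⟩}
    (i : GrothIdx (X.P hX) p q) :
    grothι (X.P hX) i ≫ X.canonicalMap hX p q = X.canonicalLeg hX i :=
  colimit.ι_desc _ _

theorem canonicalMap_one {x : B} (p : (X.P hX).obj ⟨x⟩) :
    grothOne (X.P hX) p ≫ X.canonicalMap hX p p = X.one (Fib.elt p) :=
  (X.ι_canonicalMap hX (GrothIdx.id p)).trans (Restr.leg_id _)

theorem canonicalMap_comp {x y z : B} (p : (X.P hX).obj ⟨x⟩) (q : (X.P hX).obj ⟨y⟩)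
    (r : (X.P hX).obj ⟨z⟩) :
    grothComp (X.P hX) p q r ≫ X.canonicalMap hX p r =
      X.mul (X.canonicalMap hX p q) (X.canonicalMap hX q r) := by
  apply groth_ext₂
  intro i j
  have h1 := congrArg (fun m => m ≫ X.canonicalMap hX p r) (ι_ι_grothComp (X.P hX) p q r i j)
  simp only [Category.assoc] at h1
  refine h1.trans ?_
  rw [← mul_comp, ← comp_mul, ι_canonicalMap, ι_canonicalMap]
  refine (X.ι_canonicalMap hX (i.comp j)).trans ?_
  exact Restr.leg_comp _ _ _ _ _ _

/-- The canonical functor `Σ P X ⟶ X`, the identity on elements. -/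
noncomputable def canonical : EFunctor (groth (X.P hX)) X where
  obj {x} p := Fib.elt (X := X) (x := x) p
  map p q := X.canonicalMap hX p q
  map_one p := X.canonicalMap_one hX p
  map_comp p q r := X.canonicalMap_comp hX p q r

end ECat

namespace EFunctor

variable {X : ECat.{w, v, u, a} B} {Y : ECat.{w, v, u, a₁} B} {Z : ECat.{w, v, u, a₂} B}

/-- Composition of functors. -/
def comp (F : EFunctor X Y) (G : EFunctor Y Z) : EFunctor X Z where
  obj p := G.obj (F.obj p)
  map p q := F.map p q ≫ G.map (F.obj p) (F.obj q)
  map_one p := by rw [← Category.assoc, F.map_one, G.map_one]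
  map_comp p q r := by
    have h := G.map_comp (F.obj p) (F.obj q) (F.obj r)
    rw [ECat.comp_mul, ECat.mul_comp, ← h, ← Category.assoc, F.map_comp, ECat.mul]
    simp

/-- A natural isomorphism of functors: a family of isomorphisms in the fibres such that the two
`2`-cells `X(p, q) ⟶ Y(F p, G q)` coincide. -/
structure NatIso (F G : EFunctor X Y) where
  app : ∀ {x : B} (p : X.Obj x), ECat.Fib.mk (F.obj p) ≅ ECat.Fib.mk (G.obj p)
  naturality : ∀ {x y : B} (p : X.Obj x) (q : X.Obj y),
    (ρ_ _).inv ≫ Y.mul (F.map p q) (app q).hom.cell =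
      (λ_ _).inv ≫ Y.mul (app p).hom.cell (G.map p q)

end EFunctor

namespace ECat

variable (X : ECat.{w, v, u, a} B) [LocallyCocomplete.{w, v, u, max u a} B] [ClosedBicategory B]
  (hX : X.IsComplete) [HasGroth (X.P hX)]

variable {X} in
/-- The counit `C Σ P X ⟶ X`, at a complete category `X`, of the adjunction between complete
`B`-categories and pseudofunctors `Map(B)^coop ⟶ Cat`: it corresponds, under the adjunction between
`C` and the inclusion of complete categories, to the canonical functor `Σ P X ⟶ X`, that is, it is
the essentially unique functor extending the latter along the Yoneda embedding. -/
def IsCounit (E : EFunctor (singletons (groth (X.P hX))) X) : Prop :=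
  Nonempty (EFunctor.NatIso ((yoneda (groth (X.P hX))).comp E) (X.canonical hX))

/-- The complete category `X` is a fixed point of the adjunction: the counit is an equivalence. -/
def IsFixedPoint : Prop :=
  (∃ E, IsCounit hX E) ∧ ∀ E, IsCounit hX E → E.IsEquivalence

end ECat

end BicatEnriched

namespace BicatEnriched

/-- A quantaloid: a category whose hom-sets are complete lattices and whose composition preserves
suprema in both variables. -/
class Quantaloid (Q : Type u) extends Category.{v} Q where
  lattice : ∀ x y : Q, CompleteLattice (x ⟶ y)
  comp_sSup : ∀ {x y z : Q} (f : x ⟶ y) (S : Set (y ⟶ z)), f ≫ sSup S = sSup ((f ≫ ·) '' S)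
  sSup_comp : ∀ {x y z : Q} (S : Set (x ⟶ y)) (g : y ⟶ z), sSup S ≫ g = sSup ((· ≫ g) '' S)

namespace Quantaloid

attribute [reducible, instance] Quantaloid.lattice

variable {Q : Type u} [Quantaloid.{v} Q]

theorem comp_mono_right {x y z : Q} (f : x ⟶ y) {g h : y ⟶ z} (hgh : g ≤ h) : f ≫ g ≤ f ≫ h := by
  have h1 : sSup {g, h} = h := by simpa using hgh
  rw [← h1, comp_sSup]
  exact le_sSup ⟨g, by simp, rfl⟩

theorem comp_mono_left {x y z : Q} {f g : x ⟶ y} (hfg : f ≤ g) (h : y ⟶ z) : f ≫ h ≤ g ≫ h := by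
  have h1 : sSup {f, g} = g := by simpa using hfg
  rw [← h1, sSup_comp]
  exact le_sSup ⟨f, by simp, rfl⟩

/-- A quantaloid is a bicategory, whose `2`-cells are given by the order. -/
instance : Bicategory.{v, v} Q where
  whiskerLeft f _ _ η := homOfLE (comp_mono_right f (leOfHom η))
  whiskerRight η h := homOfLE (comp_mono_left (leOfHom η) h)
  associator f g h := eqToIso (Category.assoc f g h)
  leftUnitor f := eqToIso (Category.id_comp f)
  rightUnitor f := eqToIso (Category.comp_id f)

instance : ClosedBicategory Q where
  precomp {x y} z f := by
    have gc : GaloisConnection (fun g : y ⟶ z => f ≫ g) (fun h => sSup {g | f ≫ g ≤ h}) := by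
      intro g h
      constructor
      · exact fun hg => le_sSup hg
      · intro hg
        refine (comp_mono_right f hg).trans ?_
        rw [comp_sSup]
        exact sSup_le (by rintro _ ⟨g, hg, rfl⟩; exact hg)
    exact gc.adjunction.isLeftAdjoint
  postcomp x {y z} f := by
    have gc : GaloisConnection (fun g : x ⟶ y => g ≫ f) (fun h => sSup {g | g ≫ f ≤ h}) := by
      intro g h
      constructor
      · exact fun hg => le_sSup hg
      · intro hg
        refine (comp_mono_left hg f).trans ?_
        rw [sSup_comp]
        exact sSup_le (by rintro _ ⟨g, hg, rfl⟩; exact hg)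
    exact gc.adjunction.isLeftAdjoint

instance : LocallyCocomplete.{v, v, u, a} Q where
  hasColimits _ _ := inferInstance

end Quantaloid

open MonoidalCategory in
instance {V : Type u} [Category.{v} V] [MonoidalCategory V] [SymmetricCategory V]
    [MonoidalClosed V] : ClosedBicategory (MonoidalSingleObj V) where
  precomp _ f := (ihom.adjunction (C := V) f).isLeftAdjoint
  postcomp _ _ _ f :=
    have : (tensorLeft (C := V) f).IsLeftAdjoint := (ihom.adjunction (C := V) f).isLeftAdjoint
    Functor.isLeftAdjoint_of_iso (F := tensorLeft (C := V) f) (BraidedCategory.tensorLeftIsoTensorRight f)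

instance {V : Type u} [Category.{v} V] [MonoidalCategory V] [HasColimits V] :
    LocallyCocomplete.{v, u, 0, v} (MonoidalSingleObj V) where
  hasColimits _ _ := inferInstanceAs (HasColimitsOfSize.{v, v} V)

end BicatEnriched

/-! Everything rests on one colimit. For elements `p`, `q` of a complete category and a map `γ`, the
element `qγ` represents the singleton `M(-, q)γ`; hence an arrow `p ⟶ qγ` of the fibre is the same
thing as a `2`-cell from `γ` to `X.hom p q`, and an arrow of indices is the same thing as a `2`-cell
between maps that lies over `X.hom p q` (`exists_grothIdx`, `exists_grothIdx_hom`). The diagram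
which defines the `1`-cell of `Σ P X` is therefore the diagram of all maps over `X.hom p q`, and `κ`
is the comparison from its colimit. If the canonical cocone is a colimit, then the required colimits
exist and `κ` is an isomorphism (`hasGroth_of_isColimit`, `canonical_isIsomorphism`).

In a quantaloid, `2`-cells are inequalities, and the colimit property says exactly that `X.hom p q`
is the supremum of the maps below it. In a cosmos the hypothesis concerns only the unit object,
whereas the diagram ranges over all maps, that is, over all objects with a dual. The gap is closed
by `nonempty_isColimit_of_isDense`: enlarging a canonical diagram of a dense class of objects to a
bigger full subcategory does not change the colimit.

The fixed point property follows formally from `κ` being an isomorphism. Completeness passes along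
the inverse of `κ` to `Σ P X` (`IsComplete.of_isIsomorphism`), so the Yoneda embedding of `Σ P X` is
an equivalence; hence `κ` extends along it (`exists_extension`), and every extension is an
equivalence by cancellation (`isEquivalence_of_isCounit`). Over a quantaloid, isomorphic singletons
are equal (`sing_ext`), so for skeletal `X` an equivalence from a category of singletons to `X` is
bijective on elements. -/

namespace BicatEnriched

variable {B : Type u} [Bicategory.{w, v} B]

namespace ECat

/-! ### Arrows of the fibres acting on `2`-cells -/

section Action

variable {X : ECat.{w, v, u, a} B} {x y z : B} {p p' p'' : X.Obj x} {q q' q'' : X.Obj y}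
  {r : X.Obj z} {f f' : x ⟶ y} {g : y ⟶ z}

/-- The action of the arrows of the fibres on generalized elements, on the side of the domain. -/
def lact (s : Fib.mk p' ⟶ Fib.mk p) (k : f ⟶ X.hom p q) : f ⟶ X.hom p' q :=
  (λ_ f).inv ≫ X.mul s.cell k

/-- The action of the arrows of the fibres on generalized elements, on the side of the codomain. -/
def ract (k : f ⟶ X.hom p q) (t : Fib.mk q ⟶ Fib.mk q') : f ⟶ X.hom p q' :=
  (ρ_ f).inv ≫ X.mul k t.cell

theorem id_lact (k : f ⟶ X.hom p q) : lact (𝟙 _) k = k := by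
  simp [lact, one_mul]

theorem ract_id (k : f ⟶ X.hom p q) : ract k (𝟙 _) = k := by
  simp [ract, mul_one]

theorem comp_lact_left (h : f' ⟶ f) (s : Fib.mk p' ⟶ Fib.mk p) (k : f ⟶ X.hom p q) :
    lact s (h ≫ k) = h ≫ lact s k := by
  rw [lact, lact, mul_comp]
  simp

theorem comp_ract_left (h : f' ⟶ f) (k : f ⟶ X.hom p q) (t : Fib.mk q ⟶ Fib.mk q') :
    ract (h ≫ k) t = h ≫ ract k t := by
  rw [ract, ract, comp_mul]
  simp

/-- By naturality the action is composition with one universal `2`-cell, the value at the identity.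
This turns statements about actions into statements about composites, in particular about
invertibility. -/
theorem lact_eq (s : Fib.mk p' ⟶ Fib.mk p) (k : f ⟶ X.hom p q) :
    lact s k = k ≫ lact s (𝟙 _) := by
  rw [← comp_lact_left, Category.comp_id]

theorem ract_eq (k : f ⟶ X.hom p q) (t : Fib.mk q ⟶ Fib.mk q') :
    ract k t = k ≫ ract (𝟙 _) t := by
  rw [← comp_ract_left, Category.comp_id]

theorem comp_lact (s : Fib.mk p'' ⟶ Fib.mk p') (s' : Fib.mk p' ⟶ Fib.mk p) (k : f ⟶ X.hom p q) :
    lact (s ≫ s') k = lact s (lact s' k) := by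
  simp only [lact, fib_comp_cell, comp_mul, mul_comp, mul_assoc]
  simp

theorem ract_comp (k : f ⟶ X.hom p q) (t : Fib.mk q ⟶ Fib.mk q') (t' : Fib.mk q' ⟶ Fib.mk q'') :
    ract k (t ≫ t') = ract (ract k t) t' := by
  simp only [ract, fib_comp_cell, comp_mul, mul_comp, mul_assoc]
  simp

theorem lact_ract (s : Fib.mk p' ⟶ Fib.mk p) (k : f ⟶ X.hom p q) (t : Fib.mk q ⟶ Fib.mk q') :
    lact s (ract k t) = ract (lact s k) t := by
  simp only [lact, ract, comp_mul, mul_comp, mul_assoc]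
  simp

theorem lact_mul (s : Fib.mk p' ⟶ Fib.mk p) (k : f ⟶ X.hom p q) (l : g ⟶ X.hom q r) :
    X.mul (lact s k) l = lact s (X.mul k l) := by
  simp only [lact, comp_mul, mul_assoc]
  simp

theorem mul_ract {r' : X.Obj z} (k : f ⟶ X.hom p q) (l : g ⟶ X.hom q r)
    (t : Fib.mk r ⟶ Fib.mk r') : X.mul k (ract l t) = ract (X.mul k l) t := by
  simp only [ract, mul_comp, mul_assoc]
  simp

/-- The action is balanced: a fibre arrow sitting between two factors may be moved from one to the
other. This lets an isomorphism and its inverse meet and cancel in the middle of a product. -/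
theorem ract_mul (k : f ⟶ X.hom p q) (t : Fib.mk q ⟶ Fib.mk q') (l : g ⟶ X.hom q' r) :
    X.mul (ract k t) l = X.mul k (lact t l) := by
  simp only [ract, lact, comp_mul, mul_comp, mul_assoc]
  simp

theorem lact_one (s : Fib.mk p' ⟶ Fib.mk p) : lact s (X.one p) = s.cell := by
  rw [lact, mul_one, ← unitors_equal]
  simp

/-- The inverse isomorphism acts on the identity as an inverse of the universal `2`-cell of
`lact_eq`. -/
theorem isIso_lact (φ : Fib.mk p' ≅ Fib.mk p) (k : f ⟶ X.hom p q) [IsIso k] :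
    IsIso (lact φ.hom k) := by
  rw [lact_eq]
  have : IsIso (lact φ.hom (𝟙 (X.hom p q))) := by
    refine ⟨lact φ.inv (𝟙 _), ?_, ?_⟩ <;>
    · rw [← lact_eq, ← comp_lact]
      simp [id_lact]
  infer_instance

theorem isIso_ract (k : f ⟶ X.hom p q) (φ : Fib.mk q ≅ Fib.mk q') [IsIso k] :
    IsIso (ract k φ.hom) := by
  rw [ract_eq]
  have : IsIso (ract (𝟙 (X.hom p q)) φ.hom) := by
    refine ⟨ract (𝟙 _) φ.inv, ?_, ?_⟩ <;>
    · rw [← ract_eq, ← ract_comp]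
      simp [ract_id]
  infer_instance

end Action

end ECat

namespace EFunctor

open ECat

variable {X : ECat.{w, v, u, a} B} {Y : ECat.{w, v, u, a₁} B} {Z : ECat.{w, v, u, a₂} B}

/-! ### Functors acting on the fibres -/

section MapFib

variable (F : EFunctor X Y) {x y z : B} {p p' p'' : X.Obj x} {q q' : X.Obj y} {r : X.Obj z}
  {f : x ⟶ y} {g : y ⟶ z}

theorem mul_map (k : f ⟶ X.hom p q) (l : g ⟶ X.hom q r) :
    X.mul k l ≫ F.map p r = Y.mul (k ≫ F.map p q) (l ≫ F.map q r) := by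
  rw [comp_mul, mul_comp, ← F.map_comp, ECat.mul]
  simp

/-- The action of a functor on the arrows of the fibres. -/
def mapFib (s : Fib.mk p ⟶ Fib.mk p') : Fib.mk (F.obj p) ⟶ Fib.mk (F.obj p') :=
  ⟨s.cell ≫ F.map p p'⟩

theorem mapFib_id : F.mapFib (𝟙 (Fib.mk p)) = 𝟙 _ :=
  fib_hom_ext (F.map_one p)

theorem mapFib_comp (s : Fib.mk p ⟶ Fib.mk p') (t : Fib.mk p' ⟶ Fib.mk p'') :
    F.mapFib (s ≫ t) = F.mapFib s ≫ F.mapFib t := by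
  apply fib_hom_ext
  simp [mapFib, mul_map]

/-- The action of a functor on the isomorphisms of the fibres. -/
@[simps]
def mapFibIso (s : Fib.mk p ≅ Fib.mk p') : Fib.mk (F.obj p) ≅ Fib.mk (F.obj p') where
  hom := F.mapFib s.hom
  inv := F.mapFib s.inv
  hom_inv_id := by rw [← mapFib_comp, s.hom_inv_id, mapFib_id]
  inv_hom_id := by rw [← mapFib_comp, s.inv_hom_id, mapFib_id]

theorem lact_map (s : Fib.mk p' ⟶ Fib.mk p) (k : f ⟶ X.hom p q) :
    lact s k ≫ F.map p' q = lact (F.mapFib s) (k ≫ F.map p q) := by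
  rw [lact, Category.assoc, mul_map]
  rfl

theorem ract_map (k : f ⟶ X.hom p q) (t : Fib.mk q ⟶ Fib.mk q') :
    ract k t ≫ F.map p q' = ract (k ≫ F.map p q) (F.mapFib t) := by
  rw [ract, Category.assoc, mul_map]
  rfl

variable {F}

theorem mapFib_injective (hF : F.FullyFaithful) {s t : Fib.mk p ⟶ Fib.mk p'}
    (h : F.mapFib s = F.mapFib t) : s = t := by
  have := hF p p'
  apply fib_hom_ext
  rw [← cancel_mono (F.map p p')]
  exact congrArg FibHom.cell h

theorem exists_mapFib_eq (hF : F.FullyFaithful) (s : Fib.mk (F.obj p) ⟶ Fib.mk (F.obj p')) :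
    ∃ t, F.mapFib t = s := by
  have := hF p p'
  exact ⟨⟨s.cell ≫ inv (F.map p p')⟩, fib_hom_ext (by simp [mapFib])⟩

/-- Isomorphisms are reflected because both the arrow and its inverse lift, and faithfulness lifts
the two equations between them. -/
theorem exists_mapFibIso_eq (hF : F.FullyFaithful) (s : Fib.mk (F.obj p) ≅ Fib.mk (F.obj p')) :
    ∃ t, F.mapFibIso t = s := by
  obtain ⟨t, ht⟩ := exists_mapFib_eq hF s.hom
  obtain ⟨t', ht'⟩ := exists_mapFib_eq hF s.inv
  refine ⟨⟨t, t', ?_, ?_⟩, Iso.ext ht⟩ <;> apply mapFib_injective hF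
  · rw [mapFib_comp, ht, ht', mapFib_id, s.hom_inv_id]
  · rw [mapFib_comp, ht, ht', mapFib_id, s.inv_hom_id]

end MapFib

/-! ### Equivalences, quasi-inverses and extensions -/

section Equivalence

variable {F : EFunctor X Y}

/-- An equivalence of `B`-categories has a quasi-inverse, whose action on elements may be chosen
freely among the possible ones. -/
theorem exists_quasiInverse (hF : F.FullyFaithful) (r : ∀ {x : B}, Y.Obj x → X.Obj x)
    (hr : ∀ {x : B} (q : Y.Obj x), Nonempty (Fib.mk (F.obj (r q)) ≅ Fib.mk q)) :
    ∃ (H : EFunctor Y X) (φ : ∀ {x : B} (q : Y.Obj x), Fib.mk (F.obj (H.obj q)) ≅ Fib.mk q),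
      (∀ {x : B} (q : Y.Obj x), H.obj q = r q) ∧ ∀ {x y : B} (p : Y.Obj x) (q : Y.Obj y), H.map p q ≫ F.map (H.obj p) (H.obj q) =
        lact (φ p).hom (ract (𝟙 (Y.hom p q)) (φ q).inv) := by
  have φ : ∀ {x : B} (q : Y.Obj x), Fib.mk (F.obj (r q)) ≅ Fib.mk q := fun q => (hr q).some
  -- Full faithfulness forces the `2`-cells of the quasi-inverse: under `F` they must become the
  -- identity conjugated by `φ`. Only this equation is retained, since every later check is made
  -- after composition with the invertible `F.map`.
  choose m hm using fun {x y : B} (p : Y.Obj x) (q : Y.Obj y) =>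
    have := hF (r p) (r q)
    (⟨lact (φ p).hom (ract (𝟙 (Y.hom p q)) (φ q).inv) ≫ inv (F.map (r p) (r q)), by simp⟩ :
      ∃ m, m ≫ F.map (r p) (r q) = lact (φ p).hom (ract (𝟙 (Y.hom p q)) (φ q).inv))
  refine ⟨⟨fun {x} q => r q, fun {x y} p q => m p q, fun {x} p => ?_, fun {x y z} p q s => ?_⟩,
    fun {x} q => φ q, fun _ => rfl, fun {x y} p q => hm p q⟩
  · have := hF (r p) (r p)
    rw [← cancel_mono (F.map (r p) (r p)), F.map_one, Category.assoc, hm, ← comp_lact_left,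
      ← ract_eq, lact_ract, lact_one]
    have h := congrArg FibHom.cell (φ p).hom_inv_id
    rw [fib_id_cell, fib_comp_cell] at h
    rw [ract, ← unitors_inv_equal]
    exact h
  -- After applying `F`, the inverse of `φ q` from the first factor and `φ q` from the second meet
  -- through `ract_mul` and cancel; the conjugation by `φ p` and `φ s` survives.
  · have := hF (r p) (r s)
    rw [← cancel_mono (F.map (r p) (r s)), mul_map, hm, hm, Category.assoc, hm,
      ← comp_lact_left, ← ract_eq, lact_mul, ract_mul, ← comp_lact, Iso.inv_hom_id, id_lact,
      mul_ract, mul_id_id]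

/-- An isomorphism of `B`-categories has an inverse which is an isomorphism. -/
theorem IsIsomorphism.exists_inverse (hF : F.IsIsomorphism) :
    ∃ H : EFunctor Y X, H.IsIsomorphism := by
  choose r hr using fun {x : B} => (hF.2 x).surjective
  -- The function on elements is the strict inverse of `F.obj`, so the isomorphisms between `F (r
  -- q)` and `q` come from equalities. The free choice of `r` is what makes `H` bijective on
  -- elements, rather than only essentially surjective.
  obtain ⟨H, φ, hH, hφ⟩ := exists_quasiInverse hF.1 (fun {x} q => r q)
    (fun {x} q => ⟨eqToIso (by rw [hr])⟩)
  refine ⟨H, fun {x y} p q => ?_, fun x => ⟨fun p q h => ?_, fun p => ⟨F.obj p, ?_⟩⟩⟩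
  -- Two out of three: `H.map` followed by the invertible `F.map` is a conjugate of the identity.
  · have := hF.1 (H.obj p) (H.obj q)
    have := isIso_ract (𝟙 (Y.hom p q)) (φ q).symm
    have := isIso_lact (φ p) (ract (𝟙 (Y.hom p q)) (φ q).symm.hom)
    have : IsIso (H.map p q ≫ F.map (H.obj p) (H.obj q)) := by
      rw [hφ p q]
      assumption
    exact IsIso.of_isIso_comp_right _ (F.map (H.obj p) (H.obj q))
  · rw [hH, hH] at h
    rw [← hr p, h, hr]
  · rw [hH]
    exact (hF.2 x).injective (hr _)

theorem IsIsomorphism.isEquivalence (hF : F.IsIsomorphism) : F.IsEquivalence := by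
  refine ⟨hF.1, fun {x} q => ?_⟩
  obtain ⟨p, rfl⟩ := (hF.2 x).surjective q
  exact ⟨p, ⟨Iso.refl _⟩⟩

/-- Functors extend along equivalences. -/
theorem exists_extension (hF : F.IsEquivalence) (G : EFunctor X Z) :
    ∃ E : EFunctor Y Z, Nonempty (NatIso (F.comp E) G) := by
  choose r hr using @hF.2
  obtain ⟨H, φ, -, hφ⟩ := exists_quasiInverse hF.1 (fun {x} q => r q) (fun {x} q => hr q)
  -- The other half of the equivalence data: the isomorphism from `H F p` to `p` is the lift of `φ
  -- (F p)` along `F`. The extension is `G` after `H`, and its comparison with `G` is the image of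
  -- `ψ` under `G`.
  choose ψ hψ using fun {x : B} (p : X.Obj x) => exists_mapFibIso_eq hF.1 (φ (F.obj p))
  refine ⟨H.comp G, ⟨⟨fun p => G.mapFibIso (ψ p), fun {x y} p q => ?_⟩⟩⟩
  -- Naturality of `ψ`, verified after applying `F`, where it becomes the defining equation of
  -- `H.map`.
  have h1 : lact (ψ p).hom (𝟙 (X.hom p q)) =
      ract (F.map p q ≫ H.map (F.obj p) (F.obj q)) (ψ q).hom := by
    have := hF.1 (H.obj (F.obj p)) q
    rw [← cancel_mono (F.map (H.obj (F.obj p)) q), lact_map, ract_map, Category.assoc,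
      hφ, ← comp_lact_left, ← ract_eq, ← mapFibIso_hom,
      ← mapFibIso_hom, hψ, hψ, ← lact_ract, ← ract_comp, Iso.inv_hom_id, ract_id, Category.id_comp]
  have h2 := congrArg (fun m => m ≫ G.map (H.obj (F.obj p)) q) h1
  rw [lact_map, ract_map, Category.id_comp, Category.assoc] at h2
  exact h2.symm

/-- Naturality, solved for `F.map`, exhibits it as the conjugate of `G.map` by the components of
`α`; actions of isomorphisms preserve invertibility. -/
theorem NatIso.fullyFaithful {F G : EFunctor X Y} (α : NatIso F G) (hG : G.FullyFaithful) :
    F.FullyFaithful := by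
  intro x y p q
  have := hG p q
  have h : ract (F.map p q) (α.app q).hom = lact (α.app p).hom (G.map p q) := α.naturality p q
  have h1 : F.map p q = ract (lact (α.app p).hom (G.map p q)) (α.app q).symm.hom := by
    rw [← h, ← ract_comp, Iso.symm_hom, Iso.hom_inv_id, ract_id]
  have := isIso_lact (α.app p) (G.map p q)
  rw [h1]
  exact isIso_ract _ _

/-- Full faithfulness can be checked after composition with an equivalence. -/
theorem FullyFaithful.of_comp {E : EFunctor Y Z} (hF : F.IsEquivalence)
    (h : (F.comp E).FullyFaithful) : E.FullyFaithful := by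
  intro x y p q
  obtain ⟨p', ⟨φ⟩⟩ := hF.2 p
  obtain ⟨q', ⟨ψ⟩⟩ := hF.2 q
  have := hF.1 p' q'
  have h1 : IsIso (F.map p' q' ≫ E.map (F.obj p') (F.obj q')) := h p' q'
  have h2 : IsIso (E.map (F.obj p') (F.obj q')) := IsIso.of_isIso_comp_left (F.map p' q') _
  -- Since `F` is essentially surjective, `p` and `q` may be replaced by elements in its image:
  -- `E.map p q` is the conjugate of `E.map (F.obj p') (F.obj q')`, where invertibility comes from
  -- the composite.
  have h3 : E.map p q = ract (lact (E.mapFibIso φ.symm).hom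
      (lact φ.hom (ract (𝟙 (Y.hom p q)) ψ.symm.hom) ≫ E.map (F.obj p') (F.obj q')))
        (E.mapFibIso ψ).hom := by
    rw [mapFibIso_hom, mapFibIso_hom, ← lact_map, ← ract_map, ← comp_lact, Iso.symm_hom,
      Iso.inv_hom_id, id_lact, ← ract_comp, Iso.symm_hom, Iso.inv_hom_id, ract_id,
      Category.id_comp]
  rw [h3]
  have := isIso_ract (𝟙 (Y.hom p q)) ψ.symm
  have := isIso_lact φ (ract (𝟙 (Y.hom p q)) ψ.symm.hom)
  have := isIso_lact (E.mapFibIso φ.symm)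
    (lact φ.hom (ract (𝟙 (Y.hom p q)) ψ.symm.hom) ≫ E.map (F.obj p') (F.obj q'))
  exact isIso_ract _ _

theorem EssSurj.of_comp {E : EFunctor Y Z} (h : (F.comp E).EssSurj) : E.EssSurj := by
  intro x q
  obtain ⟨p, hp⟩ := h q
  exact ⟨F.obj p, hp⟩

theorem NatIso.essSurj {F G : EFunctor X Y} (α : NatIso F G) (hG : G.EssSurj) :
    F.EssSurj := by
  intro x q
  obtain ⟨p, ⟨φ⟩⟩ := hG q
  exact ⟨p, ⟨α.app p ≪≫ φ⟩⟩

end Equivalence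

end EFunctor

namespace ECat

/-! ### The Yoneda embedding of a complete category -/

section Yoneda

variable (X : ECat.{w, v, u, a} B) [LocallyCocomplete.{w, v, u, max u a} B] [ClosedBicategory B]

theorem reprEv_comp {x y z t : B} (p : X.Obj x) (q : X.Obj y) (b : X.Obj z) (c : X.Obj t) :
    X.reprEv p q b ▷ X.hom b c ≫ X.comp p b c =
      (α_ _ _ _).hom ≫ X.reprHom p q ◁ X.comp q b c ≫ X.reprEv p q c :=
  (Sing.repr X q).ev_act (PreSing.repr X p) b c

/-- This is the Yoneda lemma: the inverse evaluates at the unit of `q`. One composite is a unit law;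
the other is tested under evaluation, which is jointly injective by `reprEv_injective`. -/
theorem isIso_yonedaMap {x y : B} (p : X.Obj x) (q : X.Obj y) : IsIso (X.yonedaMap p q) := by
  refine ⟨(ρ_ _).inv ≫ X.reprHom p q ◁ X.one q ≫ X.reprEv p q q, ?_, ?_⟩
  · rw [rightUnitor_inv_naturality_assoc, ← whisker_exchange_assoc, yonedaMap_ev, X.comp_one]
    simp
  · apply reprEv_injective
    intro z b
    have h := congrArg (fun m => X.reprHom p q ◁ m) (X.one_comp q b)
    simp only [Bicategory.whiskerLeft_comp] at h
    simp only [comp_whiskerRight, Category.assoc, yonedaMap_ev, reprEv_comp]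
    rw [associator_naturality_middle_assoc, reassoc_of% h]
    simp

theorem yoneda_fullyFaithful : X.yoneda.FullyFaithful :=
  fun p q => X.isIso_yonedaMap p q

variable {X}

/-- The compatibility needed to apply the universal property of `coend Θ.left S.right`, by which
`2`-cells from `f` into it correspond to morphisms of presingletons `S.left f ⟶ Θ.left`. Here `f` is
the identity `1`-cell. -/
theorem Sing.homCell_aux {x : B} {Θ S : X.Sing x} (g : S.left ⟶ Θ.left) {y y' : B} (p : X.Obj y)
    (q : X.Obj y') : ((λ_ _).hom ≫ g.app p) ▷ X.hom p q ≫ Θ.left.act p q =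
      (α_ (𝟙 x) _ _).hom ≫ 𝟙 x ◁ S.left.act p q ≫ (λ_ _).hom ≫ g.app q := by
  rw [comp_whiskerRight, Category.assoc, ← g.naturality, leftUnitor_naturality_assoc]
  simp

/-- The `2`-cell which corresponds to a morphism of presingletons. -/
noncomputable def Sing.homCell {x : B} {Θ S : X.Sing x} (g : S.left ⟶ Θ.left) :
    𝟙 x ⟶ coend Θ.left S.right :=
  S.lift (fun p => (λ_ _).hom ≫ g.app p) (fun p q => Sing.homCell_aux g p q)

theorem Sing.homCell_ev {x y : B} {Θ S : X.Sing x} (g : S.left ⟶ Θ.left) (p : X.Obj y) :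
    Sing.homCell g ▷ S.left.val p ≫ S.ev Θ.left p = (λ_ _).hom ≫ g.app p :=
  S.lift_ev _ (fun p q => Sing.homCell_aux g p q) p

theorem Sing.homCell_id {x : B} (S : X.Sing x) : Sing.homCell (𝟙 S.left) = S.adj.unit := by
  apply Sing.ev_injective
  intro y p
  rw [Sing.homCell_ev, S.unit_ev, PreSing.id_app, Category.comp_id]

/-- Both sides are determined by their evaluations, and composition of singletons evaluates in two
successive steps. The order is reversed, because a morphism of presingletons from `S.left` to
`Θ.left` gives a fibre arrow from `Θ` to `S`. -/
theorem Sing.homCell_comp {x : B} {Θ S T : X.Sing x} (g : S.left ⟶ Θ.left)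
    (h : T.left ⟶ S.left) : (λ_ (𝟙 x)).inv ≫ Sing.homCell g ▷ 𝟙 x ≫
      coend Θ.left S.right ◁ Sing.homCell h ≫ X.singComp Θ S T = Sing.homCell (h ≫ g) := by
  apply Sing.ev_injective
  intro y p
  have h1 := congrArg (fun m => coend Θ.left S.right ◁ m) (Sing.homCell_ev h p)
  have h2 := Sing.homCell_ev g p
  simp only [Bicategory.whiskerLeft_comp] at h1
  simp only [comp_whiskerRight, Category.assoc]
  rw [singComp_ev, associator_naturality_middle_assoc, reassoc_of% h1,
    associator_naturality_left_assoc, ← whisker_exchange_assoc, ← whisker_exchange_assoc]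
  rw [h2, Sing.homCell_ev]
  simp

/-- The arrow of the fibre of the category of singletons which corresponds to a morphism of
presingletons. -/
noncomputable def Sing.fibHom {x : B} {Θ S : X.Sing x} (g : S.left ⟶ Θ.left) :
    Fib.mk (X := singletons X) Θ ⟶ Fib.mk (X := singletons X) S :=
  ⟨Sing.homCell g⟩

theorem Sing.fibHom_id {x : B} (S : X.Sing x) :
    Sing.fibHom (𝟙 S.left) = 𝟙 (Fib.mk (X := singletons X) S) :=
  fib_hom_ext (Sing.homCell_id S)

theorem Sing.fibHom_comp {x : B} {Θ S T : X.Sing x} (g : S.left ⟶ Θ.left) (h : T.left ⟶ S.left) :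
    Sing.fibHom g ≫ Sing.fibHom h = Sing.fibHom (h ≫ g) :=
  fib_hom_ext (Sing.homCell_comp g h)

/-- Isomorphic presingletons yield isomorphic elements of the category of singletons. -/
noncomputable def Sing.fibIso {x : B} {Θ S : X.Sing x} (g : S.left ≅ Θ.left) :
    Fib.mk (X := singletons X) Θ ≅ Fib.mk (X := singletons X) S where
  hom := Sing.fibHom g.hom
  inv := Sing.fibHom g.inv
  hom_inv_id := by rw [Sing.fibHom_comp, g.inv_hom_id, Sing.fibHom_id]
  inv_hom_id := by rw [Sing.fibHom_comp, g.hom_inv_id, Sing.fibHom_id]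

/-- The Yoneda embedding of a complete category is an equivalence. -/
theorem IsComplete.yoneda_isEquivalence (hX : X.IsComplete) : X.yoneda.IsEquivalence := by
  refine ⟨X.yoneda_fullyFaithful, fun {x} S => ?_⟩
  obtain ⟨p, ⟨φ⟩⟩ := hX S
  exact ⟨p, ⟨Sing.fibIso (Θ := Sing.repr X p) φ.symm⟩⟩

end Yoneda

/-! ### Restriction of distributors along a functor -/

section Pullback

variable {X : ECat.{w, v, u, a} B} {Y : ECat.{w, v, u, a₁} B} (G : EFunctor X Y) {x : B}

theorem comp_map_mul {x y z : B} (p : X.Obj x) (q : X.Obj y) (r : X.Obj z) :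
    X.comp p q r ≫ G.map p r = G.map p q ▷ X.hom q r ≫ Y.hom _ _ ◁ G.map q r ≫ Y.comp _ _ _ :=
  G.map_comp p q r

/-- The restriction of a presingleton along a functor. -/
@[simps]
def PreSing.pullback (σ : Y.PreSing x) : X.PreSing x where
  val p := σ.val (G.obj p)
  act p q := σ.val (G.obj p) ◁ G.map p q ≫ σ.act (G.obj p) (G.obj q)
  act_one p := by
    rw [← Bicategory.whiskerLeft_comp_assoc, G.map_one, σ.act_one]
  act_comp p q r := by
    rw [← Bicategory.whiskerLeft_comp_assoc, comp_map_mul]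
    simp only [comp_whiskerRight, Bicategory.whiskerLeft_comp, Category.assoc]
    rw [← whisker_exchange_assoc, σ.act_comp]
    simp

/-- The restriction of a precosingleton along a functor. -/
@[simps]
def PreCosing.pullback (τ : Y.PreCosing x) : X.PreCosing x where
  val p := τ.val (G.obj p)
  act p q := G.map p q ▷ τ.val (G.obj q) ≫ τ.act (G.obj p) (G.obj q)
  act_one p := by
    rw [← comp_whiskerRight_assoc, G.map_one, τ.act_one]
  act_comp p q r := by
    rw [← comp_whiskerRight_assoc, comp_map_mul]
    simp only [comp_whiskerRight, Bicategory.whiskerLeft_comp, Category.assoc]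
    rw [τ.act_comp]
    simp only [whisker_assoc, Category.assoc, Iso.inv_hom_id_assoc, associator_naturality_left_assoc]
    rw [whisker_exchange_assoc, ← whisker_exchange_assoc]

end Pullback

/-! ### Transport of singletons and of completeness along isomorphisms -/

section PullbackAdj

variable [LocallyCocomplete.{w, v, u, max u a} B]
  {X Y : ECat.{w, v, u, a} B} {G : EFunctor X Y} {x z : B} {σ : Y.PreSing x} {τ : Y.PreCosing z}

variable (G σ τ) in
/-- The universal cowedge of the restrictions of a presingleton and of a precosingleton. -/
noncomputable def pullι {y : B} (p : X.Obj y) :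
    σ.val (G.obj p) ≫ τ.val (G.obj p) ⟶ coend (σ.pullback G) (τ.pullback G) :=
  coendι (σ.pullback G) (τ.pullback G) p

/-- The cowedge condition over `X` is that over `Y`, precomposed with the `2`-cells of `G`. These
are invertible and can be cancelled, which yields the condition for the actions of `Y` at elements
in the image of `G`. -/
theorem pullι_condition {y y' : B} (hG : G.FullyFaithful) (p : X.Obj y) (q : X.Obj y') :
    σ.val (G.obj p) ◁ τ.act (G.obj p) (G.obj q) ≫ pullι G σ τ p =
      (α_ _ _ _).inv ≫ σ.act (G.obj p) (G.obj q) ▷ τ.val (G.obj q) ≫ pullι G σ τ q := by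
  have := hG p q
  have h : σ.val (G.obj p) ◁ (G.map p q ▷ τ.val (G.obj q) ≫ τ.act (G.obj p) (G.obj q)) ≫
      pullι G σ τ p = (α_ _ _ _).inv ≫ (σ.val (G.obj p) ◁ G.map p q ≫
        σ.act (G.obj p) (G.obj q)) ▷ τ.val (G.obj q) ≫ pullι G σ τ q :=
    coend_condition (σ.pullback G) (τ.pullback G) p q
  rw [← cancel_epi (σ.val (G.obj p) ◁ G.map p q ▷ τ.val (G.obj q))]
  simpa using h

/-- Every element of `Y` is the image of exactly one element of `X`, so the legs over `X` form a
cowedge over all of `Y`. -/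
theorem exists_coend_pullback (hG : G.IsIsomorphism) :
    ∃ T : coend σ τ ⟶ coend (σ.pullback G) (τ.pullback G), ∀ {y : B} (p : X.Obj y),
      coendι σ τ (G.obj p) ≫ T = pullι G σ τ p := by
  -- The leg at `q` lives over `q` itself, whereas the available legs live over elements `G.obj p`
  -- which are only equal to `q`. Heterogeneous equality states the agreement for all such `p` at
  -- once, so that the chosen family can be compared with `pullι` once `q` has been replaced by
  -- `G.obj p`.
  have h : ∀ {y : B} (q : Y.Obj y), ∃ k : σ.val q ≫ τ.val q ⟶
      coend (σ.pullback G) (τ.pullback G), ∀ p : X.Obj y, q = G.obj p →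
        HEq k (pullι G σ τ p) := by
    intro y q
    obtain ⟨p, rfl⟩ := (hG.2 y).surjective q
    refine ⟨pullι G σ τ p, fun p' h => ?_⟩
    cases (hG.2 y).injective h
    rfl
  choose k hk using @h
  refine ⟨coendDesc σ τ (𝟭 _) (fun {y} q => k q) ?_, fun {y} p => ?_⟩
  · intro y y' q q'
    obtain ⟨p, rfl⟩ := (hG.2 y).surjective q
    obtain ⟨p', rfl⟩ := (hG.2 y').surjective q'
    rw [eq_of_heq (hk (G.obj p) p rfl), eq_of_heq (hk (G.obj p') p' rfl)]
    have h := pullι_condition (σ := σ) (τ := τ) hG.1 p p'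
    simp [h]
  · refine (coendDesc_fac σ τ (𝟭 _) (fun {y} q => k q) _ (G.obj p)).trans ?_
    exact eq_of_heq (hk (G.obj p) p rfl)

/-- For any functor, restricting the universal cowedge of `Y` to the elements `G.obj p` gives a
cowedge over `X`. -/
theorem exists_coend_of_pullback : ∃ T : coend (σ.pullback G) (τ.pullback G) ⟶ coend σ τ,
    ∀ {y : B} (p : X.Obj y), pullι G σ τ p ≫ T = coendι σ τ (G.obj p) := by
  have h : ∀ {y y' : B} (p : X.Obj y) (q : X.Obj y'),
      ((α_ _ _ _).hom ≫ (σ.pullback G).val p ◁ (τ.pullback G).act p q) ≫ coendι σ τ (G.obj p) =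
        (σ.pullback G).act p q ▷ (τ.pullback G).val q ≫ coendι σ τ (G.obj q) := by
    intro y y' p q
    have h := coend_condition σ τ (G.obj p) (G.obj q)
    change ((α_ _ _ _).hom ≫ σ.val (G.obj p) ◁ (G.map p q ▷ τ.val (G.obj q) ≫
      τ.act (G.obj p) (G.obj q))) ≫ coendι σ τ (G.obj p) = (σ.val (G.obj p) ◁ G.map p q ≫
        σ.act (G.obj p) (G.obj q)) ▷ τ.val (G.obj q) ≫ coendι σ τ (G.obj q)
    simp [h]
  exact ⟨coendDesc (σ.pullback G) (τ.pullback G) (𝟭 _) (fun {y} p => coendι σ τ (G.obj p)) h,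
    fun {y} p => coendDesc_fac (σ.pullback G) (τ.pullback G) (𝟭 _)
      (fun {y} p => coendι σ τ (G.obj p)) h p⟩

/-- Singletons can be restricted along isomorphisms of `B`-categories. -/
theorem exists_sing_pullback (hG : G.IsIsomorphism) (S : Y.Sing x) :
    ∃ S' : X.Sing x, S'.left = S.left.pullback G := by
  obtain ⟨T, hT⟩ := exists_coend_pullback (σ := S.left) (τ := S.right) hG
  obtain ⟨T', hT'⟩ := exists_coend_of_pullback (G := G) (σ := S.left) (τ := S.right)
  -- Only this one of the two inverse laws is needed: the new unit is followed by `T`, the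
  -- evaluation `2`-cells are preceded by `T'`, and the composite `T ≫ T'` disappears in both
  -- triangle identities.
  have hTT' : T ≫ T' = 𝟙 _ := by
    apply coend_hom_ext S.left S.right (𝟭 _)
    intro y q
    obtain ⟨p, rfl⟩ := (hG.2 y).surjective q
    change coendι _ _ _ ≫ T ≫ T' = coendι _ _ _ ≫ 𝟙 _
    rw [reassoc_of% hT p, hT', Category.comp_id]
  have hm : ∀ {y z : B} (p : X.Obj y) (q : X.Obj z), IsIso (G.map p q) := fun p q => hG.1 p q
  -- Functoriality of `G`, rewritten for the inverses of its `2`-cells, which occur in the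
  -- transported counit.
  have hc : ∀ {y z t : B} (p : X.Obj y) (q : X.Obj z) (r : X.Obj t),
      inv (G.map p q) ▷ X.hom q r ≫ X.comp p q r =
        Y.hom _ _ ◁ G.map q r ≫ Y.comp _ _ _ ≫ inv (G.map p r) := by
    intro y z t p q r
    rw [← cancel_mono (G.map p r), Category.assoc, comp_map_mul]
    simp
  have hc' : ∀ {y z t : B} (p : X.Obj y) (q : X.Obj z) (r : X.Obj t),
      X.hom p q ◁ inv (G.map q r) ≫ X.comp p q r =
        G.map p q ▷ Y.hom _ _ ≫ Y.comp _ _ _ ≫ inv (G.map p r) := by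
    intro y z t p q r
    rw [← cancel_mono (G.map p r), Category.assoc, comp_map_mul, whisker_exchange_assoc]
    simp
  refine ⟨⟨S.left.pullback G, S.right.pullback G, ?_⟩, rfl⟩
  refine
  { unit := S.adj.unit ≫ T
    counit := fun p q => S.adj.counit (G.obj p) (G.obj q) ≫ inv (G.map p q)
    counit_right := fun p q r => ?_
    counit_left := fun p q r => ?_
    triangle_left := fun q => ?_
    triangle_right := fun q => ?_ }
  · have h := S.adj.counit_right (G.obj p) (G.obj q) (G.obj r)
    change (S.adj.counit (G.obj p) (G.obj q) ≫ inv (G.map p q)) ▷ X.hom q r ≫ X.comp p q r =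
      (α_ _ _ _).hom ≫ S.right.val (G.obj p) ◁ (S.left.val (G.obj q) ◁ G.map q r ≫
      S.left.act (G.obj q) (G.obj r)) ≫ S.adj.counit (G.obj p) (G.obj r) ≫ inv (G.map p r)
    rw [comp_whiskerRight, Category.assoc, hc, ← whisker_exchange_assoc, reassoc_of% h]
    simp
  · have h := S.adj.counit_left (G.obj p) (G.obj q) (G.obj r)
    change X.hom p q ◁ (S.adj.counit (G.obj q) (G.obj r) ≫ inv (G.map q r)) ≫ X.comp p q r =
      (α_ _ _ _).inv ≫ (G.map p q ▷ S.right.val (G.obj q) ≫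
      S.right.act (G.obj p) (G.obj q)) ▷ S.left.val (G.obj r) ≫
        S.adj.counit (G.obj p) (G.obj r) ≫ inv (G.map p r)
    rw [Bicategory.whiskerLeft_comp, Category.assoc, hc', whisker_exchange_assoc, reassoc_of% h]
    simp
  · obtain ⟨Φ, h1, h2⟩ := S.adj.triangle_left (G.obj q)
    refine ⟨T' ▷ S.left.val (G.obj q) ≫ Φ, fun p => ?_, ?_⟩
    · have h3 := congrArg (fun m => m ▷ S.left.val (G.obj q)) (hT' p)
      have h4 : pullι G S.left S.right p ▷ S.left.val (G.obj q) ≫ T' ▷ S.left.val (G.obj q) ≫ Φ =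
          (α_ _ _ _).hom ≫ S.left.val (G.obj p) ◁ (S.adj.counit (G.obj p) (G.obj q) ≫
            inv (G.map p q)) ≫ S.left.val (G.obj p) ◁ G.map p q ≫
              S.left.act (G.obj p) (G.obj q) := by
        simp only [comp_whiskerRight] at h3
        rw [reassoc_of% h3, h1]
        simp
      exact h4
    · have h3 := congrArg (fun m => (S.adj.unit ≫ m) ▷ S.left.val (G.obj q)) hTT'
      have h4 : (S.adj.unit ≫ T) ▷ S.left.val (G.obj q) ≫ T' ▷ S.left.val (G.obj q) ≫ Φ =
          (λ_ _).hom := by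
        simp only [comp_whiskerRight, Category.comp_id] at h3
        rw [← h2, ← h3]
        simp
      exact h4
  · obtain ⟨Ψ, h1, h2⟩ := S.adj.triangle_right (G.obj q)
    refine ⟨S.right.val (G.obj q) ◁ T' ≫ Ψ, fun p => ?_, ?_⟩
    · have h3 := congrArg (fun m => S.right.val (G.obj q) ◁ m) (hT' p)
      have h4 : S.right.val (G.obj q) ◁ pullι G S.left S.right p ≫
          S.right.val (G.obj q) ◁ T' ≫ Ψ =
          (α_ _ _ _).inv ≫ (S.adj.counit (G.obj q) (G.obj p) ≫ inv (G.map q p)) ▷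
            S.right.val (G.obj p) ≫ G.map q p ▷ S.right.val (G.obj p) ≫
              S.right.act (G.obj q) (G.obj p) := by
        simp only [Bicategory.whiskerLeft_comp] at h3
        rw [reassoc_of% h3, h1]
        simp
      exact h4
    · have h3 := congrArg (fun m => S.right.val (G.obj q) ◁ (S.adj.unit ≫ m)) hTT'
      have h4 : S.right.val (G.obj q) ◁ (S.adj.unit ≫ T) ≫ S.right.val (G.obj q) ◁ T' ≫ Ψ =
          (ρ_ _).hom := by
        simp only [Bicategory.whiskerLeft_comp, Category.comp_id] at h3
        rw [← h2, ← h3]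
        simp
      exact h4

/-- The morphism of presingletons `M(-, p) ⟶ σ` which corresponds to a generalized element. -/
def PreSing.ofElt {x : B} {p : Y.Obj x} {σ : Y.PreSing x} (c : 𝟙 x ⟶ σ.val p) :
    PreSing.repr Y p ⟶ σ where
  app q := (λ_ _).inv ≫ c ▷ Y.hom p q ≫ σ.act p q
  naturality q r := by
    change Y.comp p q r ≫ (λ_ _).inv ≫ c ▷ Y.hom p r ≫ σ.act p r =
      ((λ_ _).inv ≫ c ▷ Y.hom p q ≫ σ.act p q) ▷ Y.hom q r ≫ σ.act q r
    rw [leftUnitor_inv_naturality_assoc, whisker_exchange_assoc, σ.act_comp']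
    simp

/-- The inverses of the components are automatically compatible with the actions. -/
theorem PreSing.isIso_of_app {x : B} {σ τ : Y.PreSing x} (g : σ ⟶ τ)
    (h : ∀ {y : B} (p : Y.Obj y), IsIso (g.app p)) : IsIso g := by
  refine ⟨⟨fun p => have := h p; inv (g.app p), fun p q => ?_⟩, ?_, ?_⟩
  · have := h p
    have := h q
    rw [← cancel_mono (g.app q), Category.assoc, Category.assoc, g.naturality]
    simp
  · ext y p
    have := h p
    simp
  · ext y p
    have := h p
    simp

/-- Completeness is invariant under isomorphism. -/
theorem IsComplete.of_isIsomorphism (hX : X.IsComplete) (hG : G.IsIsomorphism) :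
    Y.IsComplete := by
  intro x S
  obtain ⟨S', hS⟩ := exists_sing_pullback hG S
  obtain ⟨p, ⟨φ⟩⟩ := hX S'
  rw [hS] at φ
  obtain ⟨ψ, hψ, hψ'⟩ : ∃ ψ : ∀ {y : B} (q : X.Obj y), X.hom p q ⟶ S.left.val (G.obj q),
      (∀ {y : B} (q : X.Obj y), IsIso (ψ q)) ∧ ∀ {y : B} (q : X.Obj y), X.comp p p q ≫ ψ q =
        ψ p ▷ X.hom p q ≫ S.left.val (G.obj p) ◁ G.map p q ≫ S.left.act (G.obj p) (G.obj q) :=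
    ⟨fun q => φ.hom.app q, fun q => ⟨φ.inv.app q,
      congrArg (fun m => PreSing.Hom.app m q) φ.hom_inv_id,
      congrArg (fun m => PreSing.Hom.app m q) φ.inv_hom_id⟩, fun q => φ.hom.naturality p q⟩
  -- The candidate for a representing isomorphism of `S` is the morphism out of `M(-, G p)`
  -- determined by the image of the unit of `p` under `ψ`. As `G` is surjective on elements, it
  -- suffices to invert its components at the elements `G q`.
  have h : ∀ {y : B} (q : Y.Obj y),
      IsIso ((PreSing.ofElt (p := G.obj p) (X.one p ≫ ψ p)).app q) := by
    intro y q
    obtain ⟨q, rfl⟩ := (hG.2 y).surjective q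
    have := hG.1 p q
    -- By the Yoneda argument `ψ` is recovered from its value on the unit of `p`. Hence the
    -- component at `G q`, precomposed with the invertible `G.map p q`, is the invertible `ψ q`.
    have h1 : G.map p q ≫ (λ_ _).inv ≫ (X.one p ≫ ψ p) ▷ Y.hom (G.obj p) (G.obj q) ≫
        S.left.act (G.obj p) (G.obj q) = ψ q := by
      have h2 : ψ q = (λ_ _).inv ≫ X.one p ▷ X.hom p q ≫ X.comp p p q ≫ ψ q := by
        rw [reassoc_of% X.one_comp p q, Iso.inv_hom_id_assoc]
      rw [h2, hψ', leftUnitor_inv_naturality_assoc, whisker_exchange_assoc]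
      simp
    have h3 : IsIso (G.map p q ≫ (PreSing.ofElt (p := G.obj p)
        (X.one p ≫ ψ p)).app (G.obj q)) := h1 ▸ hψ q
    exact IsIso.of_isIso_comp_left (G.map p q) _
  have := PreSing.isIso_of_app (PreSing.ofElt (p := G.obj p) (X.one p ≫ ψ p)) h
  exact ⟨G.obj p, ⟨asIso (PreSing.ofElt (p := G.obj p) (X.one p ≫ ψ p))⟩⟩

end PullbackAdj

end ECat

/-! ### Reduction to a colimit of maps -/

section General

variable {X : ECat.{w, v, u, a} B}
  [LocallyCocomplete.{w, v, u, max u a} B] [ClosedBicategory B] (hX : X.IsComplete)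

namespace ECat

/-- Cancellation: `E` after Yoneda is isomorphic to `κ`, and the Yoneda embedding of `Σ P X` is an
equivalence because `Σ P X` inherits completeness from `X`. -/
theorem isEquivalence_of_isCounit [HasGroth (X.P hX)] (h : (X.canonical hX).IsIsomorphism)
    {E : EFunctor (singletons (groth (X.P hX))) X} (hE : IsCounit hX E) : E.IsEquivalence := by
  obtain ⟨G, hG⟩ := h.exists_inverse
  obtain ⟨α⟩ := hE
  exact ⟨EFunctor.FullyFaithful.of_comp (IsComplete.yoneda_isEquivalence (hX.of_isIsomorphism hG))
    (α.fullyFaithful h.1), EFunctor.EssSurj.of_comp (α.essSurj h.isEquivalence.2)⟩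

theorem isFixedPoint_of_isIsomorphism [HasGroth (X.P hX)]
    (h : (X.canonical hX).IsIsomorphism) : X.IsFixedPoint hX := by
  obtain ⟨G, hG⟩ := h.exists_inverse
  exact ⟨EFunctor.exists_extension (IsComplete.yoneda_isEquivalence (hX.of_isIsomorphism hG)) _,
    fun E hE => isEquivalence_of_isCounit hX h hE⟩

/-- The cocone of the canonical `2`-cells on the diagram which defines `Σ P X`. -/
@[simps]
noncomputable def canonicalCocone {x y : B} (p : (X.P hX).obj ⟨x⟩) (q : (X.P hX).obj ⟨y⟩) :
    Cocone (GrothIdx.diag p q) where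
  pt := X.hom (Fib.elt p) (Fib.elt q)
  ι :=
    { app := fun i => X.canonicalLeg hX i
      naturality := fun _ _ s => (X.canonicalLeg_w hX s).trans (Category.comp_id _).symm }

/-- The index category contains all maps and need not be small, so local cocompleteness does not
directly supply these colimits; they exist because a colimit cocone is exhibited. -/
theorem hasGroth_of_isColimit
    (h : ∀ {x y : B} (p : (X.P hX).obj ⟨x⟩) (q : (X.P hX).obj ⟨y⟩),
      Nonempty (IsColimit (canonicalCocone hX p q))) : HasGroth (X.P hX) :=
  ⟨fun p q => ⟨⟨_, (h p q).some⟩⟩⟩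

theorem isIso_canonicalMap [HasGroth (X.P hX)] {x y : B} {p : (X.P hX).obj ⟨x⟩}
    {q : (X.P hX).obj ⟨y⟩} (hc : IsColimit (canonicalCocone hX p q)) :
    IsIso (X.canonicalMap hX p q) :=
  (IsColimit.coconePointUniqueUpToIso (colimit.isColimit (GrothIdx.diag p q)) hc).isIso_hom

/-- On elements `κ` only removes the wrapper `Fib`, so the whole content lies in the `2`-cells,
which compare two colimits of the same diagram. -/
theorem canonical_isIsomorphism [HasGroth (X.P hX)]
    (h : ∀ {x y : B} (p : (X.P hX).obj ⟨x⟩) (q : (X.P hX).obj ⟨y⟩),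
      Nonempty (IsColimit (canonicalCocone hX p q))) : (X.canonical hX).IsIsomorphism := by
  refine ⟨fun {x y} p q => ?_, fun x => ⟨fun p q hpq => ?_, fun p => ⟨Fib.mk p, rfl⟩⟩⟩
  · obtain ⟨hc⟩ := h p q
    exact isIso_canonicalMap hX hc
  · exact congrArg Fib.mk hpq

/-- The universal property of the restriction of `q` along `f`: a `2`-cell into `X.hom p q` factors
through the universal one, and the factor is the required arrow. -/
theorem exists_grothIdx {x y : B} (p : (X.P hX).obj ⟨x⟩) (q : (X.P hX).obj ⟨y⟩) {f : x ⟶ y}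
    (hf : Bicategory.IsLeftAdjoint f) (k : f ⟶ X.hom (Fib.elt p) (Fib.elt q)) :
    ∃ s : p ⟶ ((X.P hX).map (⟨f, hf⟩ : MapCoop.mk y ⟶ MapCoop.mk x)).toFunctor.obj q,
      X.canonicalLeg hX ⟨⟨f, hf⟩, s⟩ = k := by
  let R := X.restr hX f hf (Fib.elt q)
  let s : Fib.mk (X := X) (Fib.elt p) ⟶ Fib.mk R.elt := ⟨R.fac ((λ_ f).hom ≫ k)⟩
  have h : R.leg s = k := by
    rw [Restr.leg, R.mul_fac, Iso.inv_hom_id_assoc]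
  exact ⟨s, h⟩

/-- Fullness: a `2`-cell over `X.hom p q` respects the arrows of the indices, because an arrow into
a restriction is determined by its leg (`Restr.j_injective`). -/
theorem exists_grothIdx_hom {x y : B} {p : (X.P hX).obj ⟨x⟩} {q : (X.P hX).obj ⟨y⟩}
    (i j : GrothIdx (X.P hX) p q) (m : i.map.map ⟶ j.map.map)
    (h : m ≫ X.canonicalLeg hX j = X.canonicalLeg hX i) :
    ∃ s : i ⟶ j, (GrothIdx.diag p q).map s = m := by
  let R := X.restr hX i.map.map i.map.isMap (Fib.elt q)
  let R' := X.restr hX j.map.map j.map.isMap (Fib.elt q)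
  let s : Fib.mk (X := X) (Fib.elt p) ⟶ Fib.mk R.elt := i.arrow
  let s' : Fib.mk (X := X) (Fib.elt p) ⟶ Fib.mk R'.elt := j.arrow
  have h' : R.leg (s' ≫ R'.map R m (𝟙 _)) = R.leg s :=
    (Restr.leg_comp_map_id R' R s' m).trans h
  have h'' : s' ≫ R'.map R m (𝟙 _) = s := by
    apply fib_hom_ext
    apply R.j_injective
    simpa [Restr.leg] using h'
  exact ⟨⟨⟨m⟩, h''⟩, rfl⟩

end ECat

end General

/-! ### Quantaloids with dense maps -/

section Quantaloid

namespace Quantaloid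

variable {Q : Type u} [Quantaloid.{v} Q]

/-- When maps are dense, the `1`-cells of a category are colimits of the maps below them. -/
theorem isColimit_canonicalCocone
    (hQ : ∀ {x y : Q} (f : x ⟶ y), f = sSup {γ | Bicategory.IsLeftAdjoint γ ∧ γ ≤ f})
    {X : ECat.{v, v, u, a} Q} (hX : X.IsComplete) {x y : Q} (p : (X.P hX).obj ⟨x⟩)
    (q : (X.P hX).obj ⟨y⟩) : Nonempty (IsColimit (ECat.canonicalCocone hX p q)) := by
  -- As all `2`-cells with the same source and target are equal, the colimit property reduces to
  -- this inequality. Each map below `X.hom p q` underlies an index, so it lies below the point of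
  -- every cocone; density then bounds the supremum.
  have h : ∀ s : Cocone (GrothIdx.diag p q),
      X.hom (ECat.Fib.elt p) (ECat.Fib.elt q) ≤ s.pt := by
    intro s
    rw [hQ (X.hom (ECat.Fib.elt p) (ECat.Fib.elt q))]
    refine sSup_le ?_
    rintro γ ⟨hγ, hle⟩
    obtain ⟨k, -⟩ := ECat.exists_grothIdx hX p q hγ (homOfLE hle)
    exact leOfHom (s.ι.app ⟨⟨γ, hγ⟩, k⟩)
  exact ⟨⟨fun s => homOfLE (h s), fun _ _ => Subsingleton.elim _ _,
    fun _ _ _ => Subsingleton.elim _ _⟩⟩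

end Quantaloid

namespace ECat

variable {Q : Type u} [Quantaloid.{v} Q] {X : ECat.{v, v, u, a} Q}

/-- The given inequality inserts `coend S.left T.right` in front of `T.left`, and evaluation of `T`
absorbs the latter. -/
theorem left_le {x y : Q} {S T : X.Sing x} (h : 𝟙 x ⟶ coend S.left T.right) (p : X.Obj y) :
    T.left.val p ≤ S.left.val p :=
  leOfHom ((λ_ _).inv ≫ h ▷ T.left.val p ≫ T.ev S.left p)

/-- Dual to `left_le`: the counit of `S` contracts `S.right` with `S.left`, and the result acts on
`T.right`. The order is reversed, as it must be for right adjoints. -/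
theorem right_le {x y : Q} {S T : X.Sing x} (h : 𝟙 x ⟶ coend S.left T.right) (p : X.Obj y) :
    S.right.val p ≤ T.right.val p := by
  have k : S.right.val p ≫ coend S.left T.right ⟶ T.right.val p :=
    coendDesc S.left T.right (Bicategory.precomp x (S.right.val p))
      (fun q => (α_ _ _ _).inv ≫ S.adj.counit p q ▷ T.right.val q ≫ T.right.act p q)
      (fun _ _ => Subsingleton.elim _ _)
  exact leOfHom ((ρ_ _).inv ≫ S.right.val p ◁ h ≫ k)

theorem preSing_ext {x : Q} {σ τ : X.PreSing x} (h : ∀ {y : Q} (p : X.Obj y), σ.val p = τ.val p) :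
    σ = τ := by
  obtain ⟨f, m, _, _⟩ := σ
  obtain ⟨g, n, _, _⟩ := τ
  obtain rfl : @f = @g := by
    funext y p
    exact h p
  obtain rfl : @m = @n := by
    funext y z p q
    exact Subsingleton.elim _ _
  rfl

theorem preCosing_ext {x : Q} {σ τ : X.PreCosing x}
    (h : ∀ {y : Q} (p : X.Obj y), σ.val p = τ.val p) : σ = τ := by
  obtain ⟨f, m, _, _⟩ := σ
  obtain ⟨g, n, _, _⟩ := τ
  obtain rfl : @f = @g := by
    funext y p
    exact h p
  obtain rfl : @m = @n := by
    funext y z p q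
    exact Subsingleton.elim _ _
  rfl

/-- Unit and counit are inequalities and all other fields are propositions, so being right adjoint
is a property here. -/
instance {x : Q} (σ : X.PreSing x) (τ : X.PreCosing x) : Subsingleton (SingAdj σ τ) := by
  refine ⟨fun c c' => ?_⟩
  obtain ⟨i, m, _, _, _, _⟩ := c
  obtain ⟨j, n, _, _, _, _⟩ := c'
  obtain rfl : i = j := Subsingleton.elim _ _
  obtain rfl : @m = @n := by
    funext y z p q
    exact Subsingleton.elim _ _
  rfl

/-- Isomorphic singletons of a category enriched in a quantaloid are equal. -/
theorem sing_ext {x : Q} {S T : X.Sing x} (h : 𝟙 x ⟶ coend S.left T.right)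
    (h' : 𝟙 x ⟶ coend T.left S.right) : S = T := by
  have h1 : S.left = T.left := preSing_ext fun p => le_antisymm (left_le h' p) (left_le h p)
  have h2 : S.right = T.right := preCosing_ext fun p => le_antisymm (right_le h p) (right_le h' p)
  obtain ⟨σ, τ, c⟩ := S
  obtain ⟨σ', τ', c'⟩ := T
  obtain rfl : σ = σ' := h1
  obtain rfl : τ = τ' := h2
  obtain rfl : c = c' := Subsingleton.elim _ _
  rfl

/-- Injectivity comes from the domain, where isomorphic singletons are equal; surjectivity from the
codomain, where skeletality turns essential surjectivity into surjectivity. -/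
theorem isIsomorphism_of_isSkeletal {Y : ECat.{v, v, u, a₁} Q} (hX : X.IsSkeletal) {E : EFunctor (singletons Y) X}
    (hE : E.IsEquivalence) : E.IsIsomorphism := by
  refine ⟨hE.1, fun x => ⟨fun S T h => ?_, fun p => ?_⟩⟩
  · have e : Fib.mk (E.obj S) ≅ Fib.mk (E.obj T) := eqToIso (by rw [h])
    obtain ⟨φ, -⟩ := EFunctor.exists_mapFibIso_eq hE.1 e
    exact sing_ext φ.hom.cell φ.inv.cell
  · obtain ⟨S, ⟨φ⟩⟩ := hE.2 p
    -- An isomorphism in the fibre acts on the representables, so `E.obj S` and `p` represent the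
    -- same singleton; all coherence conditions are equations between inequalities.
    refine ⟨S, hX _ _ ⟨⟨⟨fun q => lact φ.inv (𝟙 _), fun _ _ => Subsingleton.elim _ _⟩,
      ⟨fun q => lact φ.hom (𝟙 _), fun _ _ => Subsingleton.elim _ _⟩, ?_, ?_⟩⟩⟩ <;>
    · ext
      exact Subsingleton.elim _ _

end ECat

end Quantaloid

/-! ### Colimits over full subcategories containing a dense class -/

section Dense

variable {C : Type*} [Category* C] (P : ObjectProperty C) [P.ι.IsDense]

/-- By density `A` is the colimit of the objects of the class over it, and the legs of a colimit
cocone are jointly epimorphic. -/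
theorem hom_ext_of_isDense {A Z : C} {f g : A ⟶ Z}
    (h : ∀ (D : C) (_ : P D) (t : D ⟶ A), t ≫ f = t ≫ g) : f = g :=
  (P.ι.denseAt A).hom_ext' fun D t => by
    change 𝟙 _ ≫ t ≫ f = 𝟙 _ ≫ t ≫ g
    rw [Category.id_comp, Category.id_comp]
    exact h D.obj D.property t

/-- A cocone is a colimit cocone if its diagram is, up to isomorphism, a full subcategory of the
category of objects over its point and contains all the arrows from a dense class of objects. -/
theorem nonempty_isColimit_of_isDense {J : Type*} [Category* J] {D : J ⥤ C} (c : Cocone D)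
    (h : ∀ (A : C) (_ : P A) (k : A ⟶ c.pt), ∃ (j : J) (e : D.obj j ≅ A), e.hom ≫ k = c.ι.app j)
    (h' : ∀ (i j : J) (m : D.obj i ⟶ D.obj j), m ≫ c.ι.app j = c.ι.app i →
      ∃ s : i ⟶ j, D.map s = m) : Nonempty (IsColimit c) := by
  have hs : ∀ s : Cocone D, ∃ d : c.pt ⟶ s.pt, ∀ j : J, c.ι.app j ≫ d = s.ι.app j := by
    intro s
    choose i e he using h
    -- Independence of choices: the leg of `s` attached to `k` may be computed at any index through
    -- which `k` factors, since fullness of the diagram provides an arrow from the chosen index.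
    have hw : ∀ (A : C) (hA : P A) (k : A ⟶ c.pt) (j : J) (m : A ⟶ D.obj j),
        m ≫ c.ι.app j = k → (e A hA k).inv ≫ s.ι.app (i A hA k) = m ≫ s.ι.app j := by
      intro A hA k j m hm
      obtain ⟨t, ht⟩ := h' (i A hA k) j ((e A hA k).hom ≫ m) (by rw [Category.assoc, hm, he])
      rw [← s.w t, ht, Category.assoc, Iso.inv_hom_id_assoc]
    -- The legs of `s`, transported to the dense objects over the point of `c`, form a cocone on the
    -- canonical diagram; its naturality is an instance of `hw`. Density then gives the descent,
    -- whose compatibility with `s` is tested on arrows from dense objects.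
    let c' : Cocone (CostructuredArrow.proj P.ι c.pt ⋙ P.ι) :=
      { pt := s.pt
        ι :=
          { app := fun g => (e g.left.obj g.left.property g.hom).inv ≫ s.ι.app _
            naturality := fun g g' φ => by
              have h1 := he g'.left.obj g'.left.property g'.hom
              have h2 := hw g.left.obj g.left.property g.hom _
                (φ.left.hom ≫ (e g'.left.obj g'.left.property g'.hom).inv) (by
                  rw [← h1, Category.assoc, Iso.inv_hom_id_assoc]
                  exact CostructuredArrow.w φ)
              rw [Category.assoc] at h2
              exact h2.symm.trans (Category.comp_id _).symm } }
    refine ⟨(P.ι.denseAt c.pt).desc c', fun j => hom_ext_of_isDense P fun A hA t => ?_⟩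
    have h3 := (P.ι.denseAt c.pt).fac c' (CostructuredArrow.mk (Y := ⟨A, hA⟩) (t ≫ c.ι.app j))
    rw [← hw A hA (t ≫ c.ι.app j) j t rfl]
    refine Eq.trans ?_ h3
    change _ = (𝟙 _ ≫ t ≫ c.ι.app j) ≫ _
    rw [Category.id_comp]
    exact (Category.assoc _ _ _).symm
  choose d hd using hs
  refine ⟨⟨d, hd, fun s m hm => hom_ext_of_isDense P fun A hA t => ?_⟩⟩
  -- Uniqueness: every test arrow `t` is, up to the isomorphism `e`, a leg of `c`, and there both
  -- candidates are prescribed.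
  obtain ⟨j, e, he⟩ := h A hA t
  rw [← cancel_epi e.hom, reassoc_of% he, reassoc_of% he, hm, hd]

end Dense

/-! ### Cosmoi with a dense unit object -/

section Cosmos

open MonoidalCategory

variable {V : Type u} [Category.{v} V] [MonoidalCategory V] [SymmetricCategory V]
  [MonoidalClosed V] [HasColimits V]

/-- When the unit object is dense, the `1`-cells of a category are colimits of maps. -/
theorem isColimit_canonicalCocone_of_isDense
    [hV : (ObjectProperty.singleton (MonoidalCategoryStruct.tensorUnit V)).ι.IsDense]
    {X : ECat.{v, u, 0, v} (MonoidalSingleObj V)} (hX : X.IsComplete) {x y : MonoidalSingleObj V}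
    (p : (X.P hX).obj ⟨x⟩) (q : (X.P hX).obj ⟨y⟩) :
    Nonempty (IsColimit (ECat.canonicalCocone hX p q)) := by
  -- The hom-category of the one-object bicategory is `V` itself, with the unit object as identity
  -- `1`-cell; naming `V` explicitly makes the density hypothesis on `V` applicable.
  refine @nonempty_isColimit_of_isDense V _ (ObjectProperty.singleton (𝟙_ V)) hV _ _ _
    (ECat.canonicalCocone hX p q) (fun A hA k => ?_)
    (fun i j m hm => ECat.exists_grothIdx_hom hX i j m hm)
  obtain ⟨⟩ := hA
  -- The unit object is a map, being the identity `1`-cell, so every arrow from it to the `1`-cell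
  -- of `X` is the leg of an index.
  obtain ⟨s, hs⟩ := ECat.exists_grothIdx hX p q (MapCoop.isMap_id x) k
  exact ⟨⟨⟨𝟙 x, MapCoop.isMap_id x⟩, s⟩, Iso.refl (C := V) (𝟙_ V), (Category.id_comp _).trans hs.symm⟩

end Cosmos

end BicatEnriched

/-! ### The two cases of the theorem -/

theorem mainTheorem11 :
    (∀ (Q : Type u) [BicatEnriched.Quantaloid.{v} Q]
      (_ : ∀ {x y : Q} (f : x ⟶ y), f = sSup {γ | Bicategory.IsLeftAdjoint γ ∧ γ ≤ f})
      (X : BicatEnriched.ECat.{v, v, u, a} Q) (hX : X.IsComplete),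
      ∃ _ : BicatEnriched.HasGroth (X.P hX),
        (X.canonical hX).IsIsomorphism ∧ X.IsFixedPoint hX ∧
          (X.IsSkeletal → ∀ E, BicatEnriched.ECat.IsCounit hX E → E.IsIsomorphism)) ∧
    (∀ (V : Type u) [Category.{v} V] [MonoidalCategory V] [SymmetricCategory V]
      [MonoidalClosed V] [HasLimits V] [HasColimits V]
      (_ : (ObjectProperty.singleton (MonoidalCategoryStruct.tensorUnit V)).ι.IsDense)
      (X : BicatEnriched.ECat.{v, u, 0, v} (MonoidalSingleObj V)) (hX : X.IsComplete),
      ∃ _ : BicatEnriched.HasGroth (X.P hX),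
        (X.canonical hX).IsIsomorphism ∧ X.IsFixedPoint hX) := by
  refine ⟨fun Q _ hQ X hX => ?_, fun V _ _ _ _ _ _ hV X hX => ?_⟩
  · have h := fun {x y : Q} (p : (X.P hX).obj ⟨x⟩) (q : (X.P hX).obj ⟨y⟩) =>
      BicatEnriched.Quantaloid.isColimit_canonicalCocone hQ hX p q
    have hG := BicatEnriched.ECat.hasGroth_of_isColimit hX h
    have hc := BicatEnriched.ECat.canonical_isIsomorphism hX h
    exact ⟨hG, hc, BicatEnriched.ECat.isFixedPoint_of_isIsomorphism hX hc, fun hs E hE =>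
      BicatEnriched.ECat.isIsomorphism_of_isSkeletal hs
        (BicatEnriched.ECat.isEquivalence_of_isCounit hX hc hE)⟩
  · have h := fun {x y : MonoidalSingleObj V} (p : (X.P hX).obj ⟨x⟩) (q : (X.P hX).obj ⟨y⟩) =>
      BicatEnriched.isColimit_canonicalCocone_of_isDense hX p q
    have hG := BicatEnriched.ECat.hasGroth_of_isColimit hX h
    have hc := BicatEnriched.ECat.canonical_isIsomorphism hX h
    exact ⟨hG, hc, BicatEnriched.ECat.isFixedPoint_of_isIsomorphism hX hc⟩
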